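/- All groups are countable and discrete. A sofic approximation to $\Gamma$ is a sequence of nonempty finite sets $V_n$ and maps $\sigma_n:\Gamma\to\mathrm{Sym}(V_n)$, $g\mapsto\sigma_n^g$, such that for all $g,h\in\Gamma$ the proportion of $v\in V_n$ with $\sigma_n^g(\sigma_n^h(v))=\sigma_n^{gh}(v)$ tends to $1$, and for all $g\ne e$ the proportion of $v\in V_n$ with $\sigma_n^g(v)\ne v$ tends to $1$. A $\Gamma$-system $(X,\mu,T)$ is a measurable, measure-preserving action $T$ of $\Gamma$ on a standard Borel probability space $(X,\mu)$. A metric $\Gamma$-process $(\mathcal X^\Gamma,\nu,S,d)$ consists of a compact metric space $(\mathcal X,d)$ and a Borel probability measure $\nu$ on $\mathcal X^\Gamma$ invariant under the right shift $S^g((x_h)_h)=(x_{hg})_h$. Let $(\mathcal X^\Gamma,\nu,S,d)$ be a metric $\Gamma$-process and $\Sigma=(\sigma_n:\Gamma\to\mathrm{Sym}(V_n))_n$ a sofic approximation. For $\mathbf x\in\mathcal X^{V_n}$ and $v\in V_n$ put $\Pi^{\sigma_n}_v(\mathbf x)=(x_{\sigma_n^g(v)})_{g\in\Gamma}$, $P^{\sigma_n}_{\mathbf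 x}=\frac1{|V_n|}\sum_{v}\delta_{\Pi^{\sigma_n}_v(\mathbf x)}$, and $\Omega(\mathcal O,\sigma_n)=\{\mathbf x\in\mathcal X^{V_n}:P^{\sigma_n}_{\mathbf x}\in\mathcal O\}$ for $\mathcal O\subseteq\mathrm{Pr}(\mathcal X^\Gamma)$; let $d^{(V_n)}(\mathbf x,\mathbf y)=\frac1{|V_n|}\sum_v d(x_v,y_v)$. Let $\mathrm{cov}_\delta(Y,d)$ be the least size of a subset $F\subseteq Y$ whose open $\delta$-neighbourhood contains $Y$, and $\mathrm{cov}_{\varepsilon,\delta}(m,d)=\min\{\mathrm{cov}_\delta(Y,d):m(Y)>1-\varepsilon\}$. Measures $m_n\in\mathrm{Pr}(\mathcal X^{V_n})$ quenched converge to $\nu$ over $(\sigma_n)_n$ if for every weak$^*$ neighbourhood $\mathcal O$ of $\nu$ both the proportion of $v\in V_n$ with $(\Pi^{\sigma_n}_v)_*m_n\in\mathcal O$ and $m_n(\Omega(\mathcal O,\sigma_n))$ tend to $1$; they doubly-quenched converge to $\nu$ if $m_n\times m_n$ quenched converges to $\nu\times\nu$, regarded as measures on $(\mathcal X\times\mathcal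 X)^{V_n}$ and $(\mathcal X\times\mathcal X)^\Gamma$. The sofic entropy is $$\mathrm h_\Sigma(\nu)=\sup_{\delta>0}\inf_{\mathcal O}\limsup_{n\to\infty}\frac1{|V_n|}\log\mathrm{cov}_\delta\big(\Omega(\mathcal O,\sigma_n),d^{(V_n)}\big)$$ ($\mathcal O$ ranging over weak$^*$ neighbourhoods of $\nu$, $\log 0=-\infty$). The quenched model-measure sofic entropy $\mathrm h^{\mathrm q}_\Sigma(\nu)$ and the doubly-quenched model-measure sofic entropy $\mathrm h^{\mathrm{dq}}_\Sigma(\nu)$ are the suprema of $$\sup_{\delta,\varepsilon>0}\limsup_{i\to\infty}\frac1{|V_{n_i}|}\log\mathrm{cov}_{\varepsilon,\delta}\big(m_i,d^{(V_{n_i})}\big)$$ over all $n_1<n_2<\cdots$ and all $m_i\in\mathrm{Pr}(\mathcal X^{V_{n_i}})$ that respectively quenched or doubly-quenched converge to $\nu$ over $(\sigma_{n_i})_i$ (with $\sup\emptyset=-\infty$). The three entropies of a $\Gamma$-system are those of any metric $\Gamma$-process which is measure-theoretically isomorphic to it. **Theorem E.** Let $G$ and $H$ be groups with sofic approximations $\Sigma=(\sigma_n:G\to\mathrm{Sym}(V_n))_n$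 and $\mathrm T=(\tau_n:H\to\mathrm{Sym}(W_n))_n$, and let $\Sigma\times\mathrm T$ be the product sofic approximation $(g,h)\mapsto\sigma_n^g\times\tau_n^h\in\mathrm{Sym}(V_n\times W_n)$ of $G\times H$. Let $(X,\mu,T)$ be a $G$-system, and let $\mathrm{CInd}_G^{G\times H}T$ be the co-induced action of $G\times H$ on $(X^H,\mu^{\times H})$, in which $(g,h)$ maps $(x_k)_{k\in H}$ to $(T^gx_{kh})_{k\in H}$. If $H$ is infinite, then $$\mathrm h_{\Sigma\times\mathrm T}\big(\mu^{\times H},\mathrm{CInd}_G^{G\times H}T\big)=\mathrm h^{\mathrm q}_{\Sigma\times\mathrm T}\big(\mu^{\times H},\mathrm{CInd}_G^{G\times H}T\big)=\mathrm h^{\mathrm{dq}}_{\Sigma\times\mathrm T}\big(\mu^{\times H},\mathrm{CInd}_G^{G\times H}T\big).$$ Here each of the three entropies may be computed from any metric $(G\times H)$-process isomorphic to the co-induced system, not necessarily the same one for the three. -/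

import Mathlib

open MeasureTheory Filter Topology
open scoped ENNReal

noncomputable section

universe u v w

/-! ### Probability-preserving systems, processes and co-induction -/

/-- A `Γ`-system: a measurable, measure-preserving action of `Γ` on a standard Borel probability
space. -/
structure GSystem (Γ : Type w) [Group Γ] where
  carrier : Type u
  [measurableSpace : MeasurableSpace carrier]
  [standardBorel : StandardBorelSpace carrier]
  measure : Measure carrier
  [isProbability : IsProbabilityMeasure measure]
  act : Γ → carrier → carrier
  act_one : ∀ x, act 1 x = x
  act_mul : ∀ g h x, act (g * h) x = act g (act h x)
  measurePreserving : ∀ g, MeasurePreserving (act g) measure measure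

attribute [instance] GSystem.measurableSpace GSystem.standardBorel GSystem.isProbability

/-- Measure-theoretic isomorphism of two `Γ`-systems (modulo null sets). -/
def GSystem.Isomorphic {Γ : Type w} [Group Γ] (A : GSystem.{u} Γ) (B : GSystem.{v} Γ) : Prop :=
  ∃ (φ : A.carrier → B.carrier) (ψ : B.carrier → A.carrier),
    MeasurePreserving φ A.measure B.measure ∧ Measurable ψ ∧
    (∀ᵐ x ∂A.measure, ψ (φ x) = x) ∧ (∀ᵐ y ∂B.measure, φ (ψ y) = y) ∧
    ∀ g : Γ, ∀ᵐ x ∂A.measure, φ (A.act g x) = B.act g (φ x)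

/-- The underlying transformations of the co-induced action of `G × H` on `X ^ H`: the group `G`
acts diagonally and the group `H` acts by the right shift. -/
def coindAct {G H X : Type*} [Group H] (T : G → X → X) (p : G × H) (x : H → X) : H → X :=
  fun k => T p.1 (x (k * p.2))

theorem measurePreserving_coindAct {G H X : Type*} [Group H] [MeasurableSpace X]
    (μ : Measure X) [IsProbabilityMeasure μ] (T : G → X → X)
    (hT : ∀ g, MeasurePreserving (T g) μ μ) (p : G × H) :
    MeasurePreserving (coindAct T p) (Measure.infinitePi fun _ : H => μ)
      (Measure.infinitePi fun _ : H => μ) := by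
  have h1 : MeasurePreserving (fun (x : H → X) k => T p.1 (x k))
      (Measure.infinitePi fun _ : H => μ) (Measure.infinitePi fun _ : H => μ) := by
    refine ⟨measurable_pi_lambda _ fun k => (hT p.1).measurable.comp (measurable_pi_apply k), ?_⟩
    rw [Measure.infinitePi_map_pi (μ := fun _ : H => μ) fun _ => (hT p.1).measurable]
    simp only [(hT p.1).map_eq]
  have h2 : MeasurePreserving (fun (x : H → X) k => x (k * p.2))
      (Measure.infinitePi fun _ : H => μ) (Measure.infinitePi fun _ : H => μ) := by
    refine ⟨measurable_pi_lambda _ fun k => measurable_pi_apply _, ?_⟩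
    refine Measure.eq_infinitePi (fun _ : H => μ) fun s t ht => ?_
    rw [Measure.map_apply (f := fun (x : H → X) k => x (k * p.2))
      (measurable_pi_lambda _ fun k => measurable_pi_apply _) (MeasurableSet.pi s.countable_toSet fun i _ => ht i)]
    have : (fun (x : H → X) k => x (k * p.2)) ⁻¹' (Set.pi (s : Set H) t)
        = Set.pi ((s.map (Equiv.mulRight p.2).toEmbedding : Finset H) : Set H)
          (fun k => t (k * p.2⁻¹)) := by
      ext x
      simp only [Set.mem_preimage, Set.mem_pi, Finset.coe_map, Equiv.coe_toEmbedding,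
        Set.forall_mem_image, Equiv.coe_mulRight, mul_inv_cancel_right]
    rw [this, Measure.infinitePi_pi (fun _ : H => μ) fun i _ => ht _]
    simp
  exact h1.comp h2

/-- The co-induction to `G × H` of a `G`-system `(X, μ, T)`: the space is `X ^ H` with the product
measure `μ ^ H`. -/
def GSystem.coind {G : Type w} [Group G] (A : GSystem.{u} G) (H : Type v) [Group H]
    [Countable H] : GSystem.{max u v} (G × H) where
  carrier := H → A.carrier
  measure := Measure.infinitePi fun _ : H => A.measure
  act := coindAct A.act
  act_one x := by
    funext k
    simp [coindAct, A.act_one]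
  act_mul p q x := by
    funext k
    simp [coindAct, A.act_mul, mul_assoc]
  measurePreserving := measurePreserving_coindAct A.measure A.act A.measurePreserving

/-- The right shift on `𝒳 ^ Γ`. -/
def rightShift {Γ 𝒳 : Type*} [Group Γ] (g : Γ) (x : Γ → 𝒳) : Γ → 𝒳 :=
  fun h => x (h * g)

/-- A metric `Γ`-process: a compact metric space `𝒳` with its Borel `σ`-algebra, and a
shift-invariant probability measure on `𝒳 ^ Γ`. -/
structure MetricProcess (Γ : Type w) [Group Γ] where
  State : Type u
  [metricSpace : MetricSpace State]
  [compactSpace : CompactSpace State]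
  [measurableSpace : MeasurableSpace State]
  [borelSpace : BorelSpace State]
  law : ProbabilityMeasure (Γ → State)
  invariant : ∀ g : Γ, MeasurePreserving (rightShift g) (law : Measure (Γ → State)) law

attribute [instance] MetricProcess.metricSpace MetricProcess.compactSpace
  MetricProcess.measurableSpace MetricProcess.borelSpace

/-- The `Γ`-system given by a metric `Γ`-process. -/
def MetricProcess.toGSystem {Γ : Type w} [Group Γ] [Countable Γ] (P : MetricProcess.{u} Γ) :
    GSystem.{max u w} Γ where
  carrier := Γ → P.State
  measure := P.law
  act := rightShift
  act_one x := by
    funext k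
    simp [rightShift]
  act_mul g h x := by
    funext k
    simp [rightShift, mul_assoc]
  measurePreserving := P.invariant

/-- Every system on a standard Borel probability space is isomorphic to a metric process. -/
theorem GSystem.exists_isomorphic_metricProcess {Γ : Type w} [Group Γ]
    [Countable Γ] (A : GSystem.{u} Γ) : ∃ P : MetricProcess.{0} Γ, P.toGSystem.Isomorphic A := by
  obtain ⟨f, hf⟩ : ∃ f : A.carrier → unitInterval, MeasurableEmbedding f :=
    ⟨_, measurableEmbedding_sigmoid_comp_embeddingReal A.carrier⟩
  let F : A.carrier → Γ → unitInterval := fun x g => f (A.act g x)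
  have hF : Measurable F := measurable_pi_lambda _ fun g =>
    hf.measurable.comp (A.measurePreserving g).measurable
  have hFe : MeasurableEmbedding F := hF.measurableEmbedding fun x y h => by
    have := congrFun h 1
    simpa [F, A.act_one] using hf.injective this
  have hinv : ∀ g x, F (A.act g x) = rightShift g (F x) := fun g x => by
    funext k; simp [F, rightShift, A.act_mul]
  let μ : ProbabilityMeasure A.carrier := ⟨A.measure, inferInstance⟩
  have hne : Nonempty A.carrier := by
    exact nonempty_of_isProbabilityMeasure A.measure
  have hsm : ∀ g : Γ, Measurable (rightShift g : (Γ → unitInterval) → _) := fun g =>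
    measurable_pi_lambda _ fun k => measurable_pi_apply _
  let P : MetricProcess.{0} Γ :=
    { State := unitInterval
      law := μ.map hF.aemeasurable
      invariant := fun g => by
        refine ⟨hsm g, ?_⟩
        change Measure.map _ (Measure.map F A.measure) = Measure.map F A.measure
        rw [Measure.map_map (hsm g) hF]
        conv_rhs => rw [← (A.measurePreserving g).map_eq,
          Measure.map_map hF (A.measurePreserving g).measurable]
        congr 1
        funext x
        exact (hinv g x).symm }
  have hlaw : (P.law : Measure _) = Measure.map F A.measure := rfl
  obtain ⟨ψ, hψ, hψF⟩ : ∃ ψ : (Γ → unitInterval) → A.carrier, Measurable ψ ∧ ∀ x, ψ (F x) = x := by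
    obtain ⟨ψ, h1, h2⟩ := hFe.exists_measurable_extend measurable_id fun _ => hne
    exact ⟨ψ, h1, fun x => congrFun h2 x⟩
  have hr : MeasurableSet (Set.range F) := hFe.measurableSet_range
  have hmp : MeasurePreserving ψ (P.law : Measure _) A.measure := ⟨hψ, by
    rw [hlaw, Measure.map_map hψ hF]
    have : ψ ∘ F = id := funext hψF
    rw [this, Measure.map_id]⟩
  have hae : ∀ᵐ y ∂(P.law : Measure (Γ → unitInterval)), y ∈ Set.range F := by
    rw [hlaw]
    exact (ae_map_iff hF.aemeasurable hr).2 (Filter.Eventually.of_forall fun x => ⟨x, rfl⟩)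
  refine ⟨P, ψ, F, hmp, hF, ?_, ?_, ?_⟩
  · filter_upwards [hae] with y hy
    obtain ⟨x, rfl⟩ := hy
    rw [hψF]
  · exact Filter.Eventually.of_forall hψF
  · intro g
    filter_upwards [hae] with y hy
    obtain ⟨x, rfl⟩ := hy
    change ψ (rightShift g (F x)) = _
    rw [← hinv, hψF, hψF]

/-! ### Sofic approximations -/

/-- The property `p n` holds with high probability in `v ∈ V n` (uniformly distributed), as
`n → ∞`. -/
def WHP {V : ℕ → Type*} [∀ n, Fintype (V n)] (p : ∀ n, V n → Prop) : Prop :=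
  Tendsto (fun n => (Nat.card {v : V n // p n v} : ℝ) / Fintype.card (V n)) atTop (𝓝 1)

/-- The maps `σ n : Γ → Sym (V n)` form a sofic approximation to `Γ`. -/
structure IsSoficApproximation {Γ : Type*} [Group Γ] {V : ℕ → Type*} [∀ n, Fintype (V n)]
    (σ : ∀ n, Γ → Equiv.Perm (V n)) : Prop where
  mul : ∀ g h : Γ, WHP fun n v => σ n g (σ n h v) = σ n (g * h) v
  free : ∀ g : Γ, g ≠ 1 → WHP fun n v => σ n g v ≠ v

/-- The product of two sequences of maps `G → Sym (V n)` and `H → Sym (W n)`. -/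
def soficProd {G H : Type*} {V W : ℕ → Type*} (σ : ∀ n, G → Equiv.Perm (V n))
    (τ : ∀ n, H → Equiv.Perm (W n)) (n : ℕ) (p : G × H) : Equiv.Perm (V n × W n) :=
  Equiv.prodCongr (σ n p.1) (τ n p.2)

/-! ### Model spaces -/

/-- The pullback name of `x ∈ 𝒳 ^ V` at `v ∈ V`. -/
def pullbackName {Γ V 𝒳 : Type*} (σ : Γ → Equiv.Perm V) (v : V) (x : V → 𝒳) : Γ → 𝒳 :=
  fun g => x (σ g v)

theorem measurable_pullbackName {Γ V 𝒳 : Type*} [MeasurableSpace 𝒳] (σ : Γ → Equiv.Perm V)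
    (v : V) : Measurable (pullbackName σ v : (V → 𝒳) → Γ → 𝒳) :=
  measurable_pi_lambda _ fun _ => measurable_pi_apply _

/-- The empirical distribution of `x ∈ 𝒳 ^ V`: the average over `v ∈ V` of the point masses at the
pullback names. -/
def empirical {Γ V 𝒳 : Type*} [Fintype V] [Nonempty V] [MeasurableSpace 𝒳]
    (σ : Γ → Equiv.Perm V) (x : V → 𝒳) : ProbabilityMeasure (Γ → 𝒳) :=
  ⟨(Fintype.card V : ℝ≥0∞)⁻¹ • ∑ v : V, Measure.dirac (pullbackName σ v x), ⟨by
    simp [ENNReal.inv_mul_cancel]⟩⟩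

/-- The set `Ω(𝒪, σ)` of the models whose empirical distribution lies in `𝒪`. -/
def goodModels {Γ V 𝒳 : Type*} [Fintype V] [Nonempty V] [MeasurableSpace 𝒳]
    (𝒪 : Set (ProbabilityMeasure (Γ → 𝒳))) (σ : Γ → Equiv.Perm V) : Set (V → 𝒳) :=
  {x | empirical σ x ∈ 𝒪}

/-- The Hamming average over `V` of the metric of `𝒳`. -/
def hammingAvg {V 𝒳 : Type*} [Fintype V] [MetricSpace 𝒳] (x y : V → 𝒳) : ℝ :=
  (∑ v, dist (x v) (y v)) / Fintype.card V

/-- The `δ`-covering number of `Y` for the metric `d`: the least cardinality of a subset of `Y`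
whose open `δ`-neighbourhood contains `Y`. -/
def covNum {α : Type*} (d : α → α → ℝ) (δ : ℝ) (Y : Set α) : ℕ∞ :=
  ⨅ (F : Finset α) (_ : (F : Set α) ⊆ Y ∧ ∀ y ∈ Y, ∃ z ∈ F, d y z < δ), (F.card : ℕ∞)

/-- The `(ε, δ)`-covering number of the measure `μ` for the metric `d`. -/
def covNumMeasure {α : Type*} [MeasurableSpace α] (d : α → α → ℝ) (ε δ : ℝ)
    (μ : ProbabilityMeasure α) : ℕ∞ :=
  ⨅ (Y : Set α) (_ : 1 - ε < (μ : Measure α).real Y), covNum d δ Y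

/-- The exponential rate `(1 / |V|) log N`, with `log 0 = -∞`. -/
def expRate (V : Type*) [Fintype V] (N : ℕ∞) : EReal :=
  ENNReal.log (N : ℝ≥0∞) / (Fintype.card V : EReal)

/-! ### Convergence of measures on model spaces -/

section Convergence

variable {Γ : Type*} [Countable Γ] {V : ℕ → Type*} [∀ n, Fintype (V n)] [∀ n, Nonempty (V n)]
  {𝒳 : Type*} [TopologicalSpace 𝒳] [SecondCountableTopology 𝒳] [MeasurableSpace 𝒳] [BorelSpace 𝒳]

/-- Local weak* convergence of `m n ∈ Pr (𝒳 ^ V n)` to `μ ∈ Pr (𝒳 ^ Γ)` over `σ`. -/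
def LocalWeakConv (σ : ∀ n, Γ → Equiv.Perm (V n)) (m : ∀ n, ProbabilityMeasure (V n → 𝒳))
    (μ : ProbabilityMeasure (Γ → 𝒳)) : Prop :=
  ∀ 𝒪 ∈ 𝓝 μ, WHP fun n v => (m n).map (measurable_pullbackName (σ n) v).aemeasurable ∈ 𝒪

/-- Quenched convergence. -/
def QuenchedConv (σ : ∀ n, Γ → Equiv.Perm (V n)) (m : ∀ n, ProbabilityMeasure (V n → 𝒳))
    (μ : ProbabilityMeasure (Γ → 𝒳)) : Prop :=
  LocalWeakConv σ m μ ∧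
    ∀ 𝒪 ∈ 𝓝 μ, Tendsto (fun n => (m n : Measure (V n → 𝒳)).real (goodModels 𝒪 (σ n)))
      atTop (𝓝 1)

/-- The Cartesian square of a measure on `𝒳 ^ ι`, as a measure on `(𝒳 × 𝒳) ^ ι`. -/
def squareLaw {ι 𝒴 : Type*} [MeasurableSpace 𝒴] (μ : ProbabilityMeasure (ι → 𝒴)) :
    ProbabilityMeasure (ι → 𝒴 × 𝒴) :=
  (μ.prod μ).map (f := fun p i => (p.1 i, p.2 i))
    (measurable_pi_lambda _ fun i => ((measurable_pi_apply i).comp measurable_fst).prodMk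
      ((measurable_pi_apply i).comp measurable_snd)).aemeasurable

/-- Doubly-quenched convergence. -/
def DoublyQuenchedConv (σ : ∀ n, Γ → Equiv.Perm (V n)) (m : ∀ n, ProbabilityMeasure (V n → 𝒳))
    (μ : ProbabilityMeasure (Γ → 𝒳)) : Prop :=
  QuenchedConv σ (fun n => squareLaw (m n)) (squareLaw μ)

end Convergence

/-! ### The three entropies -/

namespace MetricProcess

variable {Γ : Type w} [Group Γ] [Countable Γ] {V : ℕ → Type v} [∀ n, Fintype (V n)]
  [∀ n, Nonempty (V n)]

/-- The sofic entropy of a metric process relative to `σ`. -/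
def soficEntropy (P : MetricProcess.{u} Γ) (σ : ∀ n, Γ → Equiv.Perm (V n)) : EReal :=
  ⨆ (δ : ℝ) (_ : 0 < δ), ⨅ 𝒪 ∈ 𝓝 P.law,
    limsup (fun n => expRate (V n) (covNum hammingAvg δ (goodModels 𝒪 (σ n)))) atTop

/-- The quenched model-measure sofic entropy of a metric process relative to `σ`. -/
def quenchedEntropy (P : MetricProcess.{u} Γ) (σ : ∀ n, Γ → Equiv.Perm (V n)) : EReal :=
  ⨆ (k : ℕ → ℕ) (_ : StrictMono k) (m : ∀ i, ProbabilityMeasure (V (k i) → P.State))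
    (_ : QuenchedConv (fun i => σ (k i)) m P.law) (δ : ℝ) (_ : 0 < δ) (ε : ℝ) (_ : 0 < ε),
    limsup (fun i => expRate (V (k i)) (covNumMeasure hammingAvg ε δ (m i))) atTop

/-- The doubly-quenched model-measure sofic entropy of a metric process relative to `σ`. -/
def doublyQuenchedEntropy (P : MetricProcess.{u} Γ) (σ : ∀ n, Γ → Equiv.Perm (V n)) : EReal :=
  ⨆ (k : ℕ → ℕ) (_ : StrictMono k) (m : ∀ i, ProbabilityMeasure (V (k i) → P.State))
    (_ : DoublyQuenchedConv (fun i => σ (k i)) m P.law) (δ : ℝ) (_ : 0 < δ) (ε : ℝ) (_ : 0 < ε),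
    limsup (fun i => expRate (V (k i)) (covNumMeasure hammingAvg ε δ (m i))) atTop

end MetricProcess

end

-- For a fixed process, doubly-quenched entropy is at most quenched entropy, because a measure is
-- the first marginal of its square. Quenched entropy is at most sofic entropy, because good models
-- eventually carry almost all the mass of a quenched convergent sequence. Sofic and doubly-quenched
-- entropy are monotone under isomorphism. Hence it suffices to find one process of the co-induced
-- system whose sofic entropy is at most its doubly-quenched entropy; quenched entropy is then
-- squeezed and needs no invariance proof of its own.
--
-- Monotonicity uses the graph joining of two isomorphic processes (`exists_joint`). It is a limit
-- of images under finitely determined, almost everywhere continuous maps, and these carry good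
-- models to good models. For good models of the joining, Hamming closeness of the second
-- coordinates forces closeness of the first (`exists_determination`), so coverings can be pulled
-- back.
--
-- The special process embeds the base space in the Cantor space and reads the coordinate at the
-- identity of `H`. Its law is a power `ν ^ H`, where `ν` is the law of the `G`-names. Suppose that
-- its good models over `V × W` need more than `exp (a |V × W|)` balls of radius `δ`. A finite
-- partition of the Cantor space into pieces of diameter below `δ`, separated by some `η`, yields at
-- least as many good models `X` with distinct colourings. Let `q` be the law of a uniformly random
-- column of a uniformly random member of `X`; the required measures are the powers `q ^ W`. Three
-- facts are needed.
--
-- Convergence of columns (`tendsto_columnLaw`): goodness says that averages over many columns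
-- indexed by a finite `T ⊆ H` are close to their mean under `ν`. This is a law of large numbers,
-- available since `H` is infinite, and it makes `q` converge to `ν` locally.
--
-- Convergence of powers (`quenchedConv_powLaw`, `doublyQuenchedConv_powLaw`): since `|W| → ∞`,
-- finite orbit pieces of two random points of `W` are disjoint, so the names there are independent
-- and a variance estimate applies. The square of a power is the power of the square, so double
-- convergence comes for free.
--
-- Size (`log_card_le_of_powers`, `log_card_le_of_cover`): by subadditivity, the entropy of the
-- coloured `q ^ W` is at least `log |X|`. A set of words of mass at least `1 - ε` must then have
-- almost that logarithmic size, and passing from words to Hamming balls costs only a small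
-- exponential factor.

universe u'

set_option linter.unusedSectionVars false

noncomputable section

/-! ### Filters of sets of asymptotically full measure -/

section Filters

/-- The filter of the sets whose sections contain a proportion of the points tending to `1`. -/
def whp (V : ℕ → Type*) [∀ n, Fintype (V n)] : Filter (Σ n, V n) where
  -- The bad proportion is used because it is subadditive, which makes finite intersections
  -- immediate.
  sets := {S | Tendsto (fun n => (Nat.card {v : V n // (⟨n, v⟩ : Σ n, V n) ∉ S} : ℝ)
    / Fintype.card (V n)) atTop (𝓝 0)}
  univ_sets := by simp
  sets_of_superset := by
    intro S T hS hST
    refine squeeze_zero (fun n => by positivity) (fun n => ?_) hS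
    gcongr
    exact Nat.card_le_card_of_injective
      (fun v : {v : V n // (⟨n, v⟩ : Σ n, V n) ∉ T} => ⟨v.1, fun h => v.2 (hST h)⟩)
      fun a b h => by simpa [Subtype.ext_iff] using h
  inter_sets := by
    intro S T hS hT
    have := hS.add hT
    rw [add_zero] at this
    refine squeeze_zero (fun n => by positivity) (fun n => ?_) this
    rw [← add_div]
    gcongr
    classical
    norm_cast
    simp only [Nat.card_eq_fintype_card, Fintype.card_subtype]
    refine (Finset.card_le_card ?_).trans (Finset.card_union_le _ _)
    intro v
    simp only [Set.mem_inter_iff, Finset.mem_filter, Finset.mem_univ, true_and, Finset.mem_union]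
    tauto

theorem mem_whp {V : ℕ → Type*} [∀ n, Fintype (V n)] {S : Set (Σ n, V n)} :
    S ∈ whp V ↔ Tendsto (fun n => (Nat.card {v : V n // (⟨n, v⟩ : Σ n, V n) ∉ S} : ℝ)
      / Fintype.card (V n)) atTop (𝓝 0) := Iff.rfl

/-- Statements holding with high probability become eventual statements along a filter, so finitely
many of them can be combined and pulled back along maps. -/
theorem WHP_iff {V : ℕ → Type*} [∀ n, Fintype (V n)] [∀ n, Nonempty (V n)]
    {p : ∀ n, V n → Prop} : WHP p ↔ ∀ᶠ a in whp V, p a.1 a.2 := by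
  have key : ∀ n, (Nat.card {v : V n // p n v} : ℝ) / Fintype.card (V n)
      = 1 - (Nat.card {v : V n // ¬ p n v} : ℝ) / Fintype.card (V n) := fun n => by
    classical
    have h : (Fintype.card (V n) : ℝ) ≠ 0 := by exact_mod_cast Fintype.card_ne_zero
    rw [eq_sub_iff_add_eq, ← add_div, div_eq_one_iff_eq h]
    simp only [Nat.card_eq_fintype_card]
    norm_cast
    rw [Fintype.card_subtype_compl]
    exact Nat.add_sub_cancel' (Fintype.card_subtype_le _)
  have : (∀ᶠ a in whp V, p a.1 a.2) ↔ Tendsto (fun n => (Nat.card {v : V n // ¬ p n v} : ℝ)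
      / Fintype.card (V n)) atTop (𝓝 0) := Iff.rfl
  rw [this, WHP]
  simp only [key]
  constructor
  · intro h
    simpa using h.const_sub 1
  · intro h
    simpa using h.const_sub 1

/-- The filter of the sets whose sections have measure tending to `1`. -/
def whm {α : ℕ → Type*} [∀ n, MeasurableSpace (α n)] (m : ∀ n, ProbabilityMeasure (α n)) :
    Filter (Σ n, α n) where
  -- Only monotonicity and subadditivity of the outer measure of the complement are used, so the
  -- sets need not be measurable.
  sets := {S | Tendsto (fun n => (m n : Measure (α n)).real {x | (⟨n, x⟩ : Σ n, α n) ∉ S})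
    atTop (𝓝 0)}
  univ_sets := by simp
  sets_of_superset := by
    intro S T hS hST
    exact squeeze_zero (fun n => measureReal_nonneg)
      (fun n => measureReal_mono fun x hx h => hx (hST h)) hS
  inter_sets := by
    intro S T hS hT
    have := hS.add hT
    rw [add_zero] at this
    refine squeeze_zero (fun n => measureReal_nonneg) (fun n => ?_) this
    refine (measureReal_mono ?_).trans (measureReal_union_le _ _)
    intro x
    simp only [Set.mem_inter_iff, Set.mem_ofPred_eq, Set.mem_union]
    tauto

theorem mem_whm {α : ℕ → Type*} [∀ n, MeasurableSpace (α n)] {m : ∀ n, ProbabilityMeasure (α n)}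
    {S : Set (Σ n, α n)} : S ∈ whm m ↔
      Tendsto (fun n => (m n : Measure (α n)).real {x | (⟨n, x⟩ : Σ n, α n) ∉ S})
        atTop (𝓝 0) := Iff.rfl

theorem tendsto_fst_whm {α : ℕ → Type*} [∀ n, MeasurableSpace (α n)]
    {m : ∀ n, ProbabilityMeasure (α n)} :
    Tendsto (Sigma.fst : (Σ n, α n) → ℕ) (whm m) atTop := by
  intro S hS
  refine mem_whm.2 (tendsto_const_nhds.congr' ?_)
  filter_upwards [hS] with n hn
  simp [hn]

/-- A quantity bounded by an average over `V n` that tends to zero is small with high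
probability. -/
theorem tendsto_whp_of_average {V : ℕ → Type*} [∀ n, Fintype (V n)] [∀ n, Nonempty (V n)]
    {f : (Σ n, V n) → ℝ} (hf : ∀ a, 0 ≤ f a)
    (h : Tendsto (fun n => (∑ v : V n, f ⟨n, v⟩) / Fintype.card (V n)) atTop (𝓝 0)) :
    Tendsto f (whp V) (𝓝 0) := by
  rw [Metric.tendsto_nhds]
  intro ε hε
  have h2 := h.div_const ε
  rw [zero_div] at h2
  refine mem_whp.2 (squeeze_zero (fun n => by positivity) (fun n => ?_) h2)
  rw [div_right_comm]
  gcongr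
  rw [le_div_iff₀ hε]
  classical
  rw [Nat.card_eq_fintype_card, Fintype.card_subtype, ← nsmul_eq_mul]
  refine (Finset.card_nsmul_le_sum _ (fun v => f ⟨n, v⟩) ε ?_).trans
    (Finset.sum_le_sum_of_subset_of_nonneg (Finset.filter_subset _ _) fun _ _ _ => hf _)
  intro v hv
  simpa [abs_of_nonneg (hf _)] using hv

/-- Averages over `V n` of bounded functions tending to zero with high probability tend to
zero. -/
theorem average_tendsto_of_whp {V : ℕ → Type*} [∀ n, Fintype (V n)] [∀ n, Nonempty (V n)]
    {f : (Σ n, V n) → ℝ} {C : ℝ} (hC : ∀ a, |f a| ≤ C) {c : ℝ} (h : Tendsto f (whp V) (𝓝 c)) :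
    Tendsto (fun n => (∑ v : V n, f ⟨n, v⟩) / Fintype.card (V n)) atTop (𝓝 c) := by
  have hC0 : 0 ≤ C := (abs_nonneg _).trans (hC ⟨0, Classical.arbitrary _⟩)
  rw [Metric.tendsto_nhds] at h ⊢
  intro ε hε
  have h1 := (mem_whp.1 (h (ε / 2) (half_pos hε))).mul_const (C + |c|)
  rw [zero_mul] at h1
  filter_upwards [h1.eventually (gt_mem_nhds (half_pos hε))] with n hn
  have hcard : (0 : ℝ) < Fintype.card (V n) := by exact_mod_cast Fintype.card_pos
  classical
  have e1 : (∑ v : V n, f ⟨n, v⟩) / Fintype.card (V n) - c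
      = (∑ v : V n, (f ⟨n, v⟩ - c)) / Fintype.card (V n) := by
    rw [Finset.sum_sub_distrib, sub_div]
    simp [hcard.ne']
  rw [Real.dist_eq, e1, abs_div, abs_of_pos hcard, div_lt_iff₀ hcard]
  refine (Finset.abs_sum_le_sum_abs _ _).trans_lt ?_
  have e2 : ∀ v : V n, |f ⟨n, v⟩ - c| ≤ ε / 2
      + (if ¬ dist (f ⟨n, v⟩) c < ε / 2 then (C + |c|) else 0) := fun v => by
    by_cases hv : dist (f ⟨n, v⟩) c < ε / 2
    · rw [if_neg (not_not.2 hv), add_zero]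
      exact hv.le
    · rw [if_pos hv]
      have := abs_sub (f ⟨n, v⟩) c
      have := hC ⟨n, v⟩
      linarith
  refine (Finset.sum_le_sum fun v _ => e2 v).trans_lt ?_
  rw [Finset.sum_add_distrib, ← Finset.sum_filter, Finset.sum_const, Finset.sum_const,
    nsmul_eq_mul, nsmul_eq_mul, Finset.card_univ]
  have e3 : (Nat.card {v : V n // ¬ dist (f ⟨n, v⟩) c < ε / 2} : ℝ)
      = ((Finset.univ.filter fun v : V n => ¬ dist (f ⟨n, v⟩) c < ε / 2).card : ℝ) := by
    rw [Nat.card_eq_fintype_card, Fintype.card_subtype]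
  change (Nat.card {v : V n // ¬ dist (f ⟨n, v⟩) c < ε / 2} : ℝ) / _ * _ < _ at hn
  rw [e3, div_mul_eq_mul_div, div_lt_iff₀ hcard] at hn
  linarith

theorem tendsto_perm_whp {V : ℕ → Type*} [∀ n, Fintype (V n)] (π : ∀ n, Equiv.Perm (V n)) :
    Tendsto (fun a : Σ n, V n => (⟨a.1, π a.1 a.2⟩ : Σ n, V n)) (whp V) (whp V) := by
  intro S hS
  refine mem_whp.2 ((mem_whp.1 hS).congr fun n => ?_)
  congr 2
  exact (Nat.card_congr ((π n).subtypeEquiv fun v => Iff.rfl)).symm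

theorem IsSoficApproximation.comp {Γ : Type*} [Group Γ] {V : ℕ → Type*} [∀ n, Fintype (V n)]
    [∀ n, Nonempty (V n)]
    {σ : ∀ n, Γ → Equiv.Perm (V n)} (hσ : IsSoficApproximation σ) {k : ℕ → ℕ}
    (hk : Tendsto k atTop atTop) : IsSoficApproximation fun i => σ (k i) where
  mul g h := (hσ.mul g h).comp hk
  free g hg := (hσ.free g hg).comp hk

end Filters

/-! ### Test functions and empirical distributions -/

/-- Weak convergence may be tested on a point-separating multiplicative family of functions. -/
theorem tendsto_of_submonoid {X : Type*} [TopologicalSpace X] [CompactSpace X] [MeasurableSpace X]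
    [OpensMeasurableSpace X] (S : Submonoid C(X, ℝ))
    (hS : ∀ x y : X, x ≠ y → ∃ f ∈ S, f x ≠ f y)
    {ι : Type*} {l : Filter ι} {P : ι → ProbabilityMeasure X} {μ : ProbabilityMeasure X}
    (h : ∀ f ∈ S, Tendsto (fun i => ∫ x, f x ∂(P i : Measure X)) l
      (𝓝 (∫ x, f x ∂(μ : Measure X)))) : Tendsto P l (𝓝 μ) := by
  have hint : ∀ (ν : ProbabilityMeasure X) (f : C(X, ℝ)), Integrable f (ν : Measure X) :=
    fun ν f => (BoundedContinuousFunction.mkOfCompact f).integrable _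
  have hA : ∀ f ∈ Algebra.adjoin ℝ (S : Set C(X, ℝ)),
      Tendsto (fun i => ∫ x, f x ∂(P i : Measure X)) l (𝓝 (∫ x, f x ∂(μ : Measure X))) := by
    intro f hf
    -- The linear span of a multiplicative family is already the algebra it generates, so linearity
    -- suffices here and Stone-Weierstrass finishes.
    rw [← Subalgebra.mem_toSubmodule, Algebra.adjoin_eq_span, Submonoid.closure_eq] at hf
    induction hf using Submodule.span_induction with
    | mem f hf => exact h f hf
    | zero => simpa using tendsto_const_nhds
    | add f g _ _ hf hg =>
      simp only [ContinuousMap.add_apply]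
      simp_rw [fun ν : ProbabilityMeasure X => integral_add (hint ν f) (hint ν g)]
      exact hf.add hg
    | smul c f _ hf =>
      simp only [ContinuousMap.smul_apply, integral_smul]
      exact hf.const_smul c
  have hsep : (Algebra.adjoin ℝ (S : Set C(X, ℝ))).SeparatesPoints := fun x y hxy => by
    obtain ⟨f, hf, hne⟩ := hS x y hxy
    exact ⟨f, ⟨f, Algebra.subset_adjoin hf, rfl⟩, hne⟩
  rw [ProbabilityMeasure.tendsto_iff_forall_integral_tendsto]
  intro F
  rw [Metric.tendsto_nhds]
  intro ε hε
  obtain ⟨⟨g, hg⟩, hgF⟩ := ContinuousMap.exists_mem_subalgebra_near_continuousMap_of_separatesPoints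
    _ hsep F.toContinuousMap (ε / 3) (by positivity)
  have hd : ∀ ν : ProbabilityMeasure X,
      |∫ x, g x ∂(ν : Measure X) - ∫ x, F x ∂(ν : Measure X)| ≤ ε / 3 := fun ν => by
    rw [← integral_sub (hint ν g) (F.integrable _)]
    have := norm_integral_le_of_norm_le_const (μ := (ν : Measure X)) (f := fun x => g x - F x)
      (C := ε / 3) (Filter.Eventually.of_forall fun x =>
        ((g - F.toContinuousMap).norm_coe_le_norm x).trans hgF.le)
    simpa using this
  filter_upwards [Metric.tendsto_nhds.1 (hA g hg) (ε / 3) (by positivity)] with i hi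
  have h1 := abs_le.1 (hd (P i))
  have h2 := abs_le.1 (hd μ)
  rw [Real.dist_eq, abs_lt] at hi ⊢
  constructor <;> linarith [h1.1, h1.2, h2.1, h2.2, hi.1, hi.2]

section Cyl

variable {Γ 𝒳 : Type*} [MetricSpace 𝒳]

/-- The product over `g ∈ E` of the functions `f g` of the coordinates at `g`. -/
def cylFun (E : Finset Γ) (f : Γ → C(𝒳, ℝ)) : C(Γ → 𝒳, ℝ) :=
  ∏ g ∈ E, (f g).comp (ContinuousMap.eval g)

@[simp] theorem cylFun_apply (E : Finset Γ) (f : Γ → C(𝒳, ℝ)) (y : Γ → 𝒳) :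
    cylFun E f y = ∏ g ∈ E, f g (y g) := by
  simp [cylFun]

/-- The multiplicative family of the products of functions of finitely many coordinates. -/
def cylSubmonoid (Γ 𝒳 : Type*) [MetricSpace 𝒳] : Submonoid C(Γ → 𝒳, ℝ) where
  carrier := {F | ∃ (E : Finset Γ) (f : Γ → C(𝒳, ℝ)), F = cylFun E f}
  one_mem' := ⟨∅, fun _ => 1, by ext; simp⟩
  mul_mem' := by
    classical
    rintro _ _ ⟨E, f, rfl⟩ ⟨E', f', rfl⟩
    refine ⟨E ∪ E', fun g => (if g ∈ E then f g else 1) * (if g ∈ E' then f' g else 1), ?_⟩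
    ext y
    simp only [ContinuousMap.mul_apply, cylFun_apply, Finset.prod_mul_distrib]
    congr 1
    · rw [← Finset.prod_subset Finset.subset_union_left]
      · exact Finset.prod_congr rfl fun g hg => by rw [if_pos hg]
      · intro g _ hg
        simp [hg]
    · rw [← Finset.prod_subset Finset.subset_union_right]
      · exact Finset.prod_congr rfl fun g hg => by rw [if_pos hg]
      · intro g _ hg
        simp [hg]

variable [CompactSpace 𝒳] [Countable Γ] [MeasurableSpace 𝒳] [BorelSpace 𝒳]

/-- Distances to a point in a single coordinate already separate names. Products over coordinates
are the test functions that independence can evaluate. -/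
theorem tendsto_of_cylFun {ι : Type*} {l : Filter ι} {P : ι → ProbabilityMeasure (Γ → 𝒳)}
    {μ : ProbabilityMeasure (Γ → 𝒳)}
    (h : ∀ (E : Finset Γ) (f : Γ → C(𝒳, ℝ)),
      Tendsto (fun i => ∫ x, cylFun E f x ∂(P i : Measure (Γ → 𝒳))) l
        (𝓝 (∫ x, cylFun E f x ∂(μ : Measure (Γ → 𝒳))))) : Tendsto P l (𝓝 μ) := by
  refine tendsto_of_submonoid (cylSubmonoid Γ 𝒳) ?_ ?_
  · intro x y hxy
    obtain ⟨g, hg⟩ := Function.ne_iff.1 hxy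
    refine ⟨_, ⟨{g}, fun _ => ⟨fun a => dist a (y g), by fun_prop⟩, rfl⟩, ?_⟩
    simpa using hg
  · rintro _ ⟨E, f, rfl⟩
    exact h E f

theorem tendsto_integral_of_tendsto {X : Type*} [TopologicalSpace X] [CompactSpace X]
    [MeasurableSpace X] [OpensMeasurableSpace X] {ι : Type*} {l : Filter ι}
    {P : ι → ProbabilityMeasure X} {μ : ProbabilityMeasure X} (h : Tendsto P l (𝓝 μ))
    (F : C(X, ℝ)) :
    Tendsto (fun i => ∫ x, F x ∂(P i : Measure X)) l (𝓝 (∫ x, F x ∂(μ : Measure X))) :=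
  (ProbabilityMeasure.tendsto_iff_forall_integral_tendsto.1 h)
    (BoundedContinuousFunction.mkOfCompact F)

theorem integral_empirical {V : Type*} [Fintype V] [Nonempty V] (σ : Γ → Equiv.Perm V)
    (x : V → 𝒳) (F : (Γ → 𝒳) → ℝ) :
    ∫ y, F y ∂(empirical σ x : Measure (Γ → 𝒳))
      = (∑ v, F (pullbackName σ v x)) / Fintype.card V := by
  change ∫ y, F y ∂((Fintype.card V : ℝ≥0∞)⁻¹ • ∑ v : V, Measure.dirac (pullbackName σ v x)) = _
  rw [integral_smul_measure, integral_finsetSum_measure fun v _ => integrable_dirac (by simp)]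
  simp [div_eq_inv_mul]

theorem continuous_empirical {V : Type*} [Fintype V] [Nonempty V] (σ : Γ → Equiv.Perm V) :
    Continuous (empirical σ : (V → 𝒳) → ProbabilityMeasure (Γ → 𝒳)) := by
  rw [ProbabilityMeasure.continuous_iff_forall_continuous_integral]
  intro F
  simp only [integral_empirical]
  have : ∀ v, Continuous (pullbackName σ v : (V → 𝒳) → Γ → 𝒳) := fun v =>
    continuous_pi fun g => continuous_apply _
  fun_prop

theorem isOpen_goodModels {V : Type*} [Fintype V] [Nonempty V] (σ : Γ → Equiv.Perm V)
    {U : Set (ProbabilityMeasure (Γ → 𝒳))} (hU : IsOpen U) : IsOpen (goodModels U σ) :=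
  hU.preimage (continuous_empirical σ)

variable {V : ℕ → Type*} [∀ n, Fintype (V n)] [∀ n, Nonempty (V n)]

theorem localWeakConv_iff {σ : ∀ n, Γ → Equiv.Perm (V n)}
    {m : ∀ n, ProbabilityMeasure (V n → 𝒳)} {μ : ProbabilityMeasure (Γ → 𝒳)} :
    LocalWeakConv σ m μ ↔ Tendsto (fun a : Σ n, V n =>
      (m a.1).map (measurable_pullbackName (σ a.1) a.2).aemeasurable) (whp V) (𝓝 μ) :=
  forall₂_congr fun _ _ => WHP_iff

/-- A neighbourhood need not give a measurable set of models. In one direction it is shrunk to an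
open set, so that complements can be taken; in the other, subadditivity of the outer measure
suffices. -/
theorem quenched_empirical_iff {σ : ∀ n, Γ → Equiv.Perm (V n)}
    {m : ∀ n, ProbabilityMeasure (V n → 𝒳)} {μ : ProbabilityMeasure (Γ → 𝒳)} :
    (∀ 𝒪 ∈ 𝓝 μ, Tendsto (fun n => (m n : Measure (V n → 𝒳)).real (goodModels 𝒪 (σ n)))
      atTop (𝓝 1)) ↔
    Tendsto (fun a : Σ n, (V n → 𝒳) => empirical (σ a.1) a.2) (whm m) (𝓝 μ) := by
  constructor
  · intro h O hO
    obtain ⟨U, hUO, hU, hμU⟩ := mem_nhds_iff.1 hO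
    refine mem_of_superset ?_ (Set.preimage_mono hUO)
    have := (h U (hU.mem_nhds hμU)).const_sub 1
    rw [sub_self] at this
    refine mem_whm.2 (this.congr fun n => ?_)
    rw [← probReal_compl_eq_one_sub (isOpen_goodModels (σ n) hU).measurableSet]
    rfl
  · intro h O hO
    have := (mem_whm.1 (h hO)).const_sub 1
    rw [sub_zero] at this
    refine tendsto_of_tendsto_of_tendsto_of_le_of_le this tendsto_const_nhds (fun n => ?_)
      fun n => measureReal_le_one
    have h1 : (m n : Measure (V n → 𝒳)).real Set.univ ≤
        (m n : Measure (V n → 𝒳)).real (goodModels O (σ n)) +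
        (m n : Measure (V n → 𝒳)).real (goodModels O (σ n))ᶜ := by
      rw [← Set.union_compl_self (goodModels O (σ n))]
      exact measureReal_union_le _ _
    rw [probReal_univ] at h1
    change 1 - (m n : Measure (V n → 𝒳)).real (goodModels O (σ n))ᶜ ≤ _
    linarith

theorem quenchedConv_iff {σ : ∀ n, Γ → Equiv.Perm (V n)}
    {m : ∀ n, ProbabilityMeasure (V n → 𝒳)} {μ : ProbabilityMeasure (Γ → 𝒳)} :
    QuenchedConv σ m μ ↔
      Tendsto (fun a : Σ n, V n =>
        (m a.1).map (measurable_pullbackName (σ a.1) a.2).aemeasurable) (whp V) (𝓝 μ) ∧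
      Tendsto (fun a : Σ n, (V n → 𝒳) => empirical (σ a.1) a.2) (whm m) (𝓝 μ) :=
  and_congr localWeakConv_iff quenched_empirical_iff

/-! ### Continuous maps of the state spaces -/

variable {𝒴 : Type*} [MetricSpace 𝒴] [CompactSpace 𝒴] [MeasurableSpace 𝒴] [BorelSpace 𝒴]

/-- The image of a measure on `𝒳 ^ ι` under a map of the state spaces. -/
def mapState {ι 𝒳 𝒴 : Type*} [MeasurableSpace 𝒳] [MeasurableSpace 𝒴] {f : 𝒳 → 𝒴}
    (hf : Measurable f) (μ : ProbabilityMeasure (ι → 𝒳)) : ProbabilityMeasure (ι → 𝒴) :=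
  μ.map (f := fun x i => f (x i))
    (measurable_pi_lambda _ fun i => hf.comp (measurable_pi_apply i)).aemeasurable

theorem ProbabilityMeasure.map_comp {X Y Z : Type*} [MeasurableSpace X] [MeasurableSpace Y]
    [MeasurableSpace Z] (μ : ProbabilityMeasure X) {f : X → Y} {g : Y → Z} (hf : Measurable f)
    (hg : Measurable g) : (μ.map hf.aemeasurable).map hg.aemeasurable
      = μ.map (hg.comp hf).aemeasurable :=
  Subtype.ext (Measure.map_map hg hf)

theorem empirical_map {V : Type*} [Fintype V] [Nonempty V] (σ : Γ → Equiv.Perm V) {f : 𝒳 → 𝒴}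
    (hf : Measurable f) (x : V → 𝒳) :
    empirical σ (fun v => f (x v)) = mapState hf (empirical σ x) := by
  refine Subtype.ext ?_
  have hm : Measurable fun (x : Γ → 𝒳) i => f (x i) :=
    measurable_pi_lambda _ fun i => hf.comp (measurable_pi_apply i)
  change _ = Measure.map (fun (x : Γ → 𝒳) i => f (x i))
    ((Fintype.card V : ℝ≥0∞)⁻¹ • ∑ v : V, Measure.dirac (pullbackName σ v x))
  rw [Measure.map_smul, ← Measure.mapₗ_apply_of_measurable hm, map_sum]
  simp only [Measure.mapₗ_apply_of_measurable hm, Measure.map_dirac' hm]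
  rfl

theorem tendsto_empirical_map {α : ℕ → Type*} [∀ n, MeasurableSpace (α n)]
    {m : ∀ n, ProbabilityMeasure (α n)} {Ψ : ∀ n, α n → V n → 𝒳} (hΨ : ∀ n, Measurable (Ψ n))
    {σ : ∀ n, Γ → Equiv.Perm (V n)} {μ : ProbabilityMeasure (Γ → 𝒳)}
    (h : Tendsto (fun a : Σ n, α n => empirical (σ a.1) (Ψ a.1 a.2)) (whm m) (𝓝 μ)) :
    Tendsto (fun a : Σ n, (V n → 𝒳) => empirical (σ a.1) a.2)
      (whm fun n => (m n).map (hΨ n).aemeasurable) (𝓝 μ) := by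
  intro O hO
  refine mem_of_superset ?_ (Set.preimage_mono (interior_subset (s := O)))
  refine mem_whm.2 ((mem_whm.1 (h (interior_mem_nhds.2 hO))).congr fun n => ?_)
  exact (map_measureReal_apply (hΨ n)
    (isOpen_goodModels (σ n) (isOpen_interior (s := O))).measurableSet.compl).symm

theorem QuenchedConv.mapState {σ : ∀ n, Γ → Equiv.Perm (V n)}
    {m : ∀ n, ProbabilityMeasure (V n → 𝒳)} {μ : ProbabilityMeasure (Γ → 𝒳)}
    (h : QuenchedConv σ m μ) {f : 𝒳 → 𝒴} (hf : Continuous f) :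
    QuenchedConv σ (fun n => mapState hf.measurable (m n)) (mapState hf.measurable μ) := by
  rw [quenchedConv_iff] at h ⊢
  have hc : Continuous fun (x : Γ → 𝒳) i => f (x i) := by fun_prop
  have hmap := ProbabilityMeasure.continuous_map hc
  refine ⟨(hmap.continuousAt.tendsto.comp h.1).congr fun a => Subtype.ext ?_, ?_⟩
  · exact (Measure.map_map hc.measurable (measurable_pullbackName _ _)).trans
      (Measure.map_map (measurable_pullbackName _ _)
        (measurable_pi_lambda _ fun i => hf.measurable.comp (measurable_pi_apply i))).symm
  · refine tendsto_empirical_map (Ψ := fun n (x : V n → 𝒳) v => f (x v))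
      (fun n => measurable_pi_lambda _ fun i => hf.measurable.comp (measurable_pi_apply i)) ?_
    simp only [empirical_map _ hf.measurable]
    exact hmap.continuousAt.tendsto.comp h.2

end Cyl

/-! ### Maps of model spaces induced by functions of finitely many coordinates -/

/-- The equivariant map induced by a function of the names. -/
def factorMap {Γ 𝒳 𝒵 : Type*} [Group Γ] (ψ : (Γ → 𝒳) → 𝒵) (x : Γ → 𝒳) : Γ → 𝒵 :=
  fun g => ψ (rightShift g x)

/-- The map of model spaces induced by a function of the names. -/
def modelMap {Γ V 𝒳 𝒵 : Type*} (σ : Γ → Equiv.Perm V) (ψ : (Γ → 𝒳) → 𝒵) (x : V → 𝒳) : V → 𝒵 :=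
  fun v => ψ (pullbackName σ v x)

/-- The function `ψ` depends only on finitely many coordinates. -/
def FinDep {Γ 𝒳 𝒵 : Type*} (ψ : (Γ → 𝒳) → 𝒵) : Prop :=
  ∃ E : Finset Γ, ∀ x x' : Γ → 𝒳, (∀ g ∈ E, x g = x' g) → ψ x = ψ x'

theorem measurable_rightShift {Γ 𝒳 : Type*} [Group Γ] [MeasurableSpace 𝒳] (g : Γ) :
    Measurable (rightShift g : (Γ → 𝒳) → Γ → 𝒳) :=
  measurable_pi_lambda _ fun _ => measurable_pi_apply _

theorem measurable_factorMap {Γ 𝒳 𝒵 : Type*} [Group Γ] [MeasurableSpace 𝒳] [MeasurableSpace 𝒵]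
    {ψ : (Γ → 𝒳) → 𝒵} (hψ : Measurable ψ) : Measurable (factorMap ψ) :=
  measurable_pi_lambda _ fun g => hψ.comp (measurable_rightShift g)

theorem measurable_modelMap {Γ V 𝒳 𝒵 : Type*} [MeasurableSpace 𝒳] [MeasurableSpace 𝒵]
    (σ : Γ → Equiv.Perm V) {ψ : (Γ → 𝒳) → 𝒵} (hψ : Measurable ψ) : Measurable (modelMap σ ψ) :=
  measurable_pi_lambda _ fun v => hψ.comp (measurable_pullbackName σ v)

/-- The mapping theorem for maps that are continuous almost everywhere. -/
theorem continuousAt_map_of_ae_continuousAt {X Y : Type*} [TopologicalSpace X]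
    [TopologicalSpace.PseudoMetrizableSpace X] [TopologicalSpace.SeparableSpace X]
    [MeasurableSpace X] [BorelSpace X] [TopologicalSpace Y] [MeasurableSpace Y]
    [OpensMeasurableSpace Y] {Φ : X → Y} (hΦ : Measurable Φ) {μ : ProbabilityMeasure X}
    (hc : ∀ᵐ x ∂(μ : Measure X), ContinuousAt Φ x) :
    ContinuousAt (fun P : ProbabilityMeasure X => P.map hΦ.aemeasurable) μ := by
  refine tendsto_of_forall_isClosed_limsup_le' fun F hF => ?_
  have h1 : ∀ P : ProbabilityMeasure X,
      (P.map hΦ.aemeasurable : Measure Y) F ≤ (P : Measure X) (closure (Φ ⁻¹' F)) := fun P => by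
    rw [ProbabilityMeasure.toMeasure_map, Measure.map_apply hΦ hF.measurableSet]
    exact measure_mono subset_closure
  refine (limsup_le_limsup (Filter.Eventually.of_forall h1)).trans
    ((ProbabilityMeasure.limsup_measure_closed_le_of_tendsto tendsto_id isClosed_closure).trans ?_)
  rw [ProbabilityMeasure.toMeasure_map, Measure.map_apply hΦ hF.measurableSet]
  -- At a continuity point of `Φ`, belonging to the closure of the preimage of the closed set `F`
  -- implies belonging to the preimage. The closure therefore adds only a null set.
  refine measure_mono_ae ?_
  filter_upwards [hc] with x hx hxF
  have h2 := mem_closure_image hx hxF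
  exact hF.closure_subset_iff.2 (Set.image_preimage_subset Φ F) h2

section Lift

variable {Γ 𝒳 𝒵 : Type*} [Group Γ] [Countable Γ] [MetricSpace 𝒳] [CompactSpace 𝒳]
  [MeasurableSpace 𝒳] [BorelSpace 𝒳] [MetricSpace 𝒵] [CompactSpace 𝒵] [MeasurableSpace 𝒵]
  [BorelSpace 𝒵]
  {V : ℕ → Type*} [∀ n, Fintype (V n)] [∀ n, Nonempty (V n)] {σ : ∀ n, Γ → Equiv.Perm (V n)}

/-- The two sides read `x` at `σ h (σ g v)` and at `σ (h * g) v`. If `ψ` depends on the coordinates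
in `E`, only the finitely many pairs in `E × F` matter, and the action is multiplicative on these at
most points `v`. -/
theorem eventually_name_modelMap (hσ : IsSoficApproximation σ) {ψ : (Γ → 𝒳) → 𝒵}
    (hψ : FinDep ψ) (F : Finset Γ) : ∀ᶠ a : (Σ n, V n) in whp V, ∀ (x : V a.1 → 𝒳), ∀ g ∈ F,
      pullbackName (σ a.1) a.2 (modelMap (σ a.1) ψ x) g
        = factorMap ψ (pullbackName (σ a.1) a.2 x) g := by
  obtain ⟨E, hE⟩ := hψ
  have h1 : ∀ h g : Γ, ∀ᶠ a : (Σ n, V n) in whp V, σ a.1 h (σ a.1 g a.2) = σ a.1 (h * g) a.2 :=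
    fun h g => (WHP_iff (p := fun n v => σ n h (σ n g v) = σ n (h * g) v)).1 (hσ.mul h g)
  have h2 : ∀ᶠ a : (Σ n, V n) in whp V, ∀ g ∈ F, ∀ h ∈ E,
      σ a.1 h (σ a.1 g a.2) = σ a.1 (h * g) a.2 := by
    rw [eventually_all_finset]
    intro g _
    rw [eventually_all_finset]
    intro h _
    exact h1 h g
  refine h2.mono fun a ha x g hg => hE _ _ fun h hh => ?_
  exact congrArg x (ha g hg h hh)

theorem eventually_cylFun_modelMap (hσ : IsSoficApproximation σ) {ψ : (Γ → 𝒳) → 𝒵}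
    (hψ : FinDep ψ) (F : Finset Γ) (f : Γ → C(𝒵, ℝ)) : ∀ᶠ a : (Σ n, V n) in whp V, ∀ (x : V a.1 → 𝒳),
      cylFun F f (pullbackName (σ a.1) a.2 (modelMap (σ a.1) ψ x))
        = cylFun F f (factorMap ψ (pullbackName (σ a.1) a.2 x)) := by
  filter_upwards [eventually_name_modelMap hσ hψ F] with a ha x
  simp only [cylFun_apply]
  exact Finset.prod_congr rfl fun g hg => by rw [ha x g hg]

/-- The filter is left general for two uses: models that are random under a sequence of measures,
and all models whose empirical distribution is near `μ`. -/
theorem tendsto_empirical_modelMap (hσ : IsSoficApproximation σ) {ψ : (Γ → 𝒳) → 𝒵}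
    (hψ : FinDep ψ) (hm : Measurable ψ) {μ : ProbabilityMeasure (Γ → 𝒳)}
    (hc : ∀ᵐ x ∂(μ : Measure (Γ → 𝒳)), ContinuousAt (factorMap ψ) x)
    {ι : Type*} {l : Filter ι} {a : ι → Σ n, (V n → 𝒳)}
    (ha : Tendsto (fun i => (a i).1) l atTop)
    (h : Tendsto (fun i => empirical (σ (a i).1) (a i).2) l (𝓝 μ)) :
    Tendsto (fun i => empirical (σ (a i).1) (modelMap (σ (a i).1) ψ (a i).2)) l
      (𝓝 (μ.map (measurable_factorMap hm).aemeasurable)) := by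
  refine tendsto_of_cylFun fun F f => ?_
  have h1 := tendsto_integral_of_tendsto
    ((continuousAt_map_of_ae_continuousAt (measurable_factorMap hm) hc).tendsto.comp h)
    (cylFun F f)
  refine (tendsto_iff_of_dist ?_).1 h1
  classical
  -- A uniform bound for the error at one point, independent of the model; its average tends to
  -- zero.
  let bad : (Σ n, V n) → ℝ := fun b =>
    if ∀ (x : V b.1 → 𝒳), cylFun F f (pullbackName (σ b.1) b.2 (modelMap (σ b.1) ψ x))
        = cylFun F f (factorMap ψ (pullbackName (σ b.1) b.2 x)) then 0 else 2 * ‖cylFun F f‖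
  have hbad : Tendsto bad (whp V) (𝓝 0) := by
    refine tendsto_const_nhds.congr' ?_
    filter_upwards [eventually_cylFun_modelMap hσ hψ F f] with b hb
    exact (if_pos hb).symm
  have hb2 : ∀ b, |bad b| ≤ 2 * ‖cylFun F f‖ := fun b => by
    simp only [bad]
    split_ifs
    · simp
    · rw [abs_of_nonneg (by positivity)]
  refine squeeze_zero (fun _ => dist_nonneg) (fun i => ?_)
    ((average_tendsto_of_whp hb2 hbad).comp ha)
  simp only [Function.comp_apply, ProbabilityMeasure.toMeasure_map]
  rw [integral_map (measurable_factorMap hm).aemeasurable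
    (cylFun F f).continuous.measurable.aestronglyMeasurable, integral_empirical,
    integral_empirical, Real.dist_eq, ← sub_div, abs_div, ← Finset.sum_sub_distrib, Nat.abs_cast]
  gcongr
  refine (Finset.abs_sum_le_sum_abs _ _).trans (Finset.sum_le_sum fun v _ => ?_)
  simp only [bad]
  split_ifs with hv
  · simp [hv]
  · refine (abs_sub _ _).trans ?_
    rw [two_mul]
    exact add_le_add ((cylFun F f).norm_coe_le_norm _) ((cylFun F f).norm_coe_le_norm _)

theorem QuenchedConv.modelMap (hσ : IsSoficApproximation σ) {ψ : (Γ → 𝒳) → 𝒵}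
    (hψ : FinDep ψ) (hm : Measurable ψ) {m : ∀ n, ProbabilityMeasure (V n → 𝒳)}
    {μ : ProbabilityMeasure (Γ → 𝒳)} (h : QuenchedConv σ m μ)
    (hc : ∀ᵐ x ∂(μ : Measure (Γ → 𝒳)), ContinuousAt (factorMap ψ) x) :
    QuenchedConv σ (fun n => (m n).map (measurable_modelMap (σ n) hm).aemeasurable)
      (μ.map (measurable_factorMap hm).aemeasurable) := by
  rw [quenchedConv_iff] at h ⊢
  constructor
  · refine tendsto_of_cylFun fun F f => ?_
    have h1 := tendsto_integral_of_tendsto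
      ((continuousAt_map_of_ae_continuousAt (measurable_factorMap hm) hc).tendsto.comp h.1)
      (cylFun F f)
    refine h1.congr' ?_
    filter_upwards [eventually_cylFun_modelMap hσ hψ F f] with a ha
    have hF := (cylFun F f).continuous.measurable
    simp only [Function.comp_apply, ProbabilityMeasure.toMeasure_map]
    rw [integral_map (measurable_factorMap hm).aemeasurable hF.aestronglyMeasurable,
      integral_map (φ := pullbackName (σ a.1) a.2) (f := fun x => cylFun F f (factorMap ψ x))
        (measurable_pullbackName _ _).aemeasurable
        (hF.comp (measurable_factorMap hm)).aestronglyMeasurable,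
      integral_map (measurable_pullbackName _ _).aemeasurable hF.aestronglyMeasurable,
      integral_map (φ := _root_.modelMap (σ a.1) ψ)
        (f := fun x => cylFun F f (pullbackName (σ a.1) a.2 x))
        (measurable_modelMap _ hm).aemeasurable
        (hF.comp (measurable_pullbackName _ _)).aestronglyMeasurable]
    exact integral_congr_ae (Filter.Eventually.of_forall fun x => (ha x).symm)
  · exact tendsto_empirical_map (fun n => measurable_modelMap (σ n) hm)
      (tendsto_empirical_modelMap hσ hψ hm hc tendsto_fst_whm h.2)

theorem exists_diagonal {p : ℕ → ℕ → Prop} (h : ∀ i, ∀ᶠ n in atTop, p i n) :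
    ∃ I : ℕ → ℕ, Tendsto I atTop atTop ∧ ∀ᶠ n in atTop, p (I n) n := by
  choose N hN using fun i => eventually_atTop.1 (h i)
  classical
  -- The index is the largest `i ≤ n` whose threshold has been passed. The search returns `0` if
  -- there is none, hence the restriction to `n ≥ N 0` below.
  refine ⟨fun n => Nat.findGreatest (fun i => N i ≤ n) n, ?_, ?_⟩
  · refine tendsto_atTop.2 fun i => ?_
    filter_upwards [eventually_ge_atTop (max i (N i))] with n hn
    exact Nat.le_findGreatest ((le_max_left _ _).trans hn) ((le_max_right _ _).trans hn)
  · filter_upwards [eventually_ge_atTop (N 0)] with n hn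
    exact hN _ n (Nat.findGreatest_spec (P := fun i => N i ≤ n) (Nat.zero_le n) hn)

/-- The limit law has a countable neighbourhood basis. At level `i`, a sufficiently close `μs j`
satisfies both conditions with error `1 / (i + 1)` for all large `n`, and the level may then grow
slowly with `n`. -/
theorem QuenchedConv.diagonal {m : ℕ → ∀ n, ProbabilityMeasure (V n → 𝒳)}
    {μs : ℕ → ProbabilityMeasure (Γ → 𝒳)} {μ : ProbabilityMeasure (Γ → 𝒳)}
    (h : ∀ j, QuenchedConv σ (m j) (μs j)) (hμ : Tendsto μs atTop (𝓝 μ)) :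
    ∃ J : ℕ → ℕ, QuenchedConv σ (fun n => m (J n) n) μ := by
  obtain ⟨B, hB⟩ := (𝓝 μ).exists_antitone_basis
  let p : ℕ → ℕ → ℕ → Prop := fun j i n =>
    (Nat.card {v : V n // (m j n).map (measurable_pullbackName (σ n) v).aemeasurable ∉ B i} : ℝ)
      / Fintype.card (V n) < 1 / ((i : ℝ) + 1) ∧
    1 - 1 / ((i : ℝ) + 1) < (m j n : Measure (V n → 𝒳)).real (goodModels (B i) (σ n))
  have hp : ∀ i, ∀ᶠ n in atTop, ∃ j, p j i n := fun i => by
    -- The set `B i` has to be a neighbourhood of `μs j`, not merely to contain it, for the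
    -- convergence of `m j` to apply.
    obtain ⟨j, hj⟩ := (hμ.eventually (eventually_eventually_nhds.2 (hB.mem i))).exists
    have hi : (0 : ℝ) < 1 / ((i : ℝ) + 1) := by positivity
    have h1 := mem_whp.1 (localWeakConv_iff.1 (h j).1 hj)
    have h2 := (h j).2 _ hj
    filter_upwards [h1.eventually (gt_mem_nhds hi),
      h2.eventually (lt_mem_nhds (show 1 - 1 / ((i : ℝ) + 1) < 1 by linarith))] with n h3 h4
    exact ⟨j, h3, h4⟩
  obtain ⟨I, hI, hpI⟩ := exists_diagonal hp
  -- The value `0` is a default for the finitely many `n` at which no suitable `j` is known to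
  -- exist.
  choose J hJ using fun n => (em (∃ j, p j (I n) n)).elim (fun ⟨j, hj⟩ => ⟨j, fun _ => hj⟩)
    fun hn => (⟨0, fun h => absurd h hn⟩ : ∃ j, (∃ j, p j (I n) n) → p j (I n) n)
  have hlim : Tendsto (fun n => 1 / ((I n : ℝ) + 1)) atTop (𝓝 0) :=
    tendsto_one_div_add_atTop_nhds_zero_nat.comp hI
  refine ⟨J, localWeakConv_iff.2 fun O hO => ?_, fun O hO => ?_⟩
  · obtain ⟨i, hi⟩ := hB.mem_iff.1 hO
    refine mem_whp.2 (squeeze_zero' (Filter.Eventually.of_forall fun n => by positivity) ?_ hlim)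
    filter_upwards [hpI, hI.eventually_ge_atTop i] with n h1 h2
    refine le_trans ?_ (hJ n h1).1.le
    gcongr
    exact Nat.card_le_card_of_injective
      (fun v : {v : V n // (⟨n, v⟩ : Σ n, V n) ∉ _} => ⟨v.1, fun h => v.2 (hi (hB.antitone h2 h))⟩)
      fun a b h => by simpa [Subtype.ext_iff] using h
  · obtain ⟨i, hi⟩ := hB.mem_iff.1 hO
    have h3 := hlim.const_sub 1
    rw [sub_zero] at h3
    refine tendsto_of_tendsto_of_tendsto_of_le_of_le' h3 tendsto_const_nhds ?_
      (Filter.Eventually.of_forall fun n => measureReal_le_one)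
    filter_upwards [hpI, hI.eventually_ge_atTop i] with n h1 h2
    exact (hJ n h1).2.le.trans (measureReal_mono fun x hx => hi (hB.antitone h2 hx))

end Lift

/-! ### Cartesian squares -/

section Square

theorem measurable_zip {ι 𝒳 : Type*} [MeasurableSpace 𝒳] :
    Measurable fun (p : (ι → 𝒳) × (ι → 𝒳)) i => (p.1 i, p.2 i) :=
  measurable_pi_lambda _ fun i => ((measurable_pi_apply i).comp measurable_fst).prodMk
      ((measurable_pi_apply i).comp measurable_snd)

theorem measurable_unzip_fst {ι 𝒳 𝒴 : Type*} [MeasurableSpace 𝒳] [MeasurableSpace 𝒴] :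
    Measurable fun (z : ι → 𝒳 × 𝒴) i => (z i).1 :=
  measurable_pi_lambda _ fun i => measurable_fst.comp (measurable_pi_apply i)

theorem measurable_unzip_snd {ι 𝒳 𝒴 : Type*} [MeasurableSpace 𝒳] [MeasurableSpace 𝒴] :
    Measurable fun (z : ι → 𝒳 × 𝒴) i => (z i).2 :=
  measurable_pi_lambda _ fun i => measurable_snd.comp (measurable_pi_apply i)

theorem toMeasure_squareLaw {ι 𝒳 : Type*} [MeasurableSpace 𝒳]
    (μ : ProbabilityMeasure (ι → 𝒳)) : (squareLaw μ : Measure (ι → 𝒳 × 𝒳))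
      = Measure.map (fun (p : (ι → 𝒳) × (ι → 𝒳)) i => (p.1 i, p.2 i))
        ((μ : Measure (ι → 𝒳)).prod (μ : Measure (ι → 𝒳))) := rfl

theorem continuous_squareLaw {ι 𝒳 : Type*} [Countable ι] [MetricSpace 𝒳] [CompactSpace 𝒳]
    [MeasurableSpace 𝒳] [BorelSpace 𝒳] :
    Continuous (squareLaw : ProbabilityMeasure (ι → 𝒳) → ProbabilityMeasure (ι → 𝒳 × 𝒳)) :=
  (ProbabilityMeasure.continuous_map (f := fun (p : (ι → 𝒳) × (ι → 𝒳)) i => (p.1 i, p.2 i))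
    (by fun_prop)).comp (ProbabilityMeasure.continuous_prod.comp (continuous_id.prodMk continuous_id))

theorem mapState_fst_squareLaw {ι 𝒳 : Type*} [MeasurableSpace 𝒳]
    (μ : ProbabilityMeasure (ι → 𝒳)) : mapState measurable_fst (squareLaw μ) = μ := by
  refine ProbabilityMeasure.toMeasure_injective ?_
  rw [mapState, ProbabilityMeasure.toMeasure_map, toMeasure_squareLaw,
    Measure.map_map measurable_unzip_fst measurable_zip]
  exact Measure.map_fst_prod.trans (by simp)

theorem mapState_snd_squareLaw {ι 𝒳 : Type*} [MeasurableSpace 𝒳]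
    (μ : ProbabilityMeasure (ι → 𝒳)) : mapState measurable_snd (squareLaw μ) = μ := by
  refine ProbabilityMeasure.toMeasure_injective ?_
  rw [mapState, ProbabilityMeasure.toMeasure_map, toMeasure_squareLaw,
    Measure.map_map measurable_unzip_snd measurable_zip]
  exact Measure.map_snd_prod.trans (by simp)

/-- The Cartesian square of a map between powers. -/
def squareMap {ι κ 𝒳 𝒵 : Type*} (f : (ι → 𝒳) → κ → 𝒵) (z : ι → 𝒳 × 𝒳) : κ → 𝒵 × 𝒵 :=
  fun k => (f (fun i => (z i).1) k, f (fun i => (z i).2) k)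

theorem measurable_squareMap {ι κ 𝒳 𝒵 : Type*} [MeasurableSpace 𝒳] [MeasurableSpace 𝒵]
    {f : (ι → 𝒳) → κ → 𝒵} (hf : Measurable f) : Measurable (squareMap f) :=
  measurable_zip.comp ((hf.comp measurable_unzip_fst).prodMk (hf.comp measurable_unzip_snd))

theorem squareLaw_map {ι κ 𝒳 𝒵 : Type*} [MeasurableSpace 𝒳] [MeasurableSpace 𝒵]
    {f : (ι → 𝒳) → κ → 𝒵} (hf : Measurable f) (μ : ProbabilityMeasure (ι → 𝒳)) :
    squareLaw (μ.map hf.aemeasurable) = (squareLaw μ).map (measurable_squareMap hf).aemeasurable := by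
  refine ProbabilityMeasure.toMeasure_injective ?_
  rw [ProbabilityMeasure.toMeasure_map, toMeasure_squareLaw, toMeasure_squareLaw,
    ProbabilityMeasure.toMeasure_map, Measure.map_prod_map _ _ hf hf,
    Measure.map_map measurable_zip (hf.prodMap hf),
    Measure.map_map (measurable_squareMap hf) measurable_zip]
  rfl

theorem DoublyQuenchedConv.quenchedConv {Γ 𝒳 : Type*} [Countable Γ] [MetricSpace 𝒳]
    [CompactSpace 𝒳] [MeasurableSpace 𝒳] [BorelSpace 𝒳] {V : ℕ → Type*} [∀ n, Fintype (V n)]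
    [∀ n, Nonempty (V n)] {σ : ∀ n, Γ → Equiv.Perm (V n)}
    {m : ∀ n, ProbabilityMeasure (V n → 𝒳)} {μ : ProbabilityMeasure (Γ → 𝒳)}
    (h : DoublyQuenchedConv σ m μ) : QuenchedConv σ m μ := by
  have := QuenchedConv.mapState h continuous_fst
  simpa only [mapState_fst_squareLaw] using this

/-- The Cartesian square of a function of the names. -/
def squareFun {Γ 𝒳 𝒵 : Type*} (ψ : (Γ → 𝒳) → 𝒵) (z : Γ → 𝒳 × 𝒳) : 𝒵 × 𝒵 :=
  (ψ fun g => (z g).1, ψ fun g => (z g).2)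

/-- The square of an induced map is induced by `squareFun ψ`. Its almost everywhere continuity is
inherited, since both marginals of the square of `μ` are `μ`. -/
theorem DoublyQuenchedConv.modelMap {Γ 𝒳 𝒵 : Type*} [Group Γ] [Countable Γ] [MetricSpace 𝒳]
    [CompactSpace 𝒳] [MeasurableSpace 𝒳] [BorelSpace 𝒳] [MetricSpace 𝒵] [CompactSpace 𝒵]
    [MeasurableSpace 𝒵] [BorelSpace 𝒵] {V : ℕ → Type*} [∀ n, Fintype (V n)] [∀ n, Nonempty (V n)]
    {σ : ∀ n, Γ → Equiv.Perm (V n)} (hσ : IsSoficApproximation σ) {ψ : (Γ → 𝒳) → 𝒵}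
    (hψ : FinDep ψ) (hm : Measurable ψ) {m : ∀ n, ProbabilityMeasure (V n → 𝒳)}
    {μ : ProbabilityMeasure (Γ → 𝒳)} (h : DoublyQuenchedConv σ m μ)
    (hc : ∀ᵐ x ∂(μ : Measure (Γ → 𝒳)), ContinuousAt (factorMap ψ) x) :
    DoublyQuenchedConv σ (fun n => (m n).map (measurable_modelMap (σ n) hm).aemeasurable)
      (μ.map (measurable_factorMap hm).aemeasurable) := by
  have hψ2 : FinDep (squareFun ψ) := by
    obtain ⟨E, hE⟩ := hψ
    exact ⟨E, fun z z' hz => Prod.ext (hE _ _ fun g hg => by rw [hz g hg])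
      (hE _ _ fun g hg => by rw [hz g hg])⟩
  have hm2 : Measurable (squareFun ψ) :=
    (hm.comp measurable_unzip_fst).prodMk (hm.comp measurable_unzip_snd)
  have hfst : ∀ᵐ z ∂(squareLaw μ : Measure (Γ → 𝒳 × 𝒳)),
      ContinuousAt (factorMap ψ) fun g => (z g).1 := by
    have e : Measure.map (fun (z : Γ → 𝒳 × 𝒳) g => (z g).1) (squareLaw μ : Measure _)
      = (μ : Measure _) := congrArg Subtype.val (mapState_fst_squareLaw μ)
    rw [← e] at hc
    exact ae_of_ae_map measurable_unzip_fst.aemeasurable hc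
  have hsnd : ∀ᵐ z ∂(squareLaw μ : Measure (Γ → 𝒳 × 𝒳)),
      ContinuousAt (factorMap ψ) fun g => (z g).2 := by
    have e : Measure.map (fun (z : Γ → 𝒳 × 𝒳) g => (z g).2) (squareLaw μ : Measure _)
      = (μ : Measure _) := congrArg Subtype.val (mapState_snd_squareLaw μ)
    rw [← e] at hc
    exact ae_of_ae_map measurable_unzip_snd.aemeasurable hc
  have hc2 : ∀ᵐ z ∂(squareLaw μ : Measure (Γ → 𝒳 × 𝒳)),
      ContinuousAt (factorMap (squareFun ψ)) z := by
    filter_upwards [hfst, hsnd] with z h1 h2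
    refine continuousAt_pi.2 fun g => ?_
    have c1 : ContinuousAt (fun (z : Γ → 𝒳 × 𝒳) g => (z g).1) z :=
      (continuous_pi fun g => continuous_fst.comp (continuous_apply g)).continuousAt
    have c2 : ContinuousAt (fun (z : Γ → 𝒳 × 𝒳) g => (z g).2) z :=
      (continuous_pi fun g => continuous_snd.comp (continuous_apply g)).continuousAt
    exact ((continuousAt_pi.1 (ContinuousAt.comp (f := fun (z : Γ → 𝒳 × 𝒳) g => (z g).1) h1 c1)
      g).prodMk
      (continuousAt_pi.1 (ContinuousAt.comp (f := fun (z : Γ → 𝒳 × 𝒳) g => (z g).2) h2 c2) g))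
  have := QuenchedConv.modelMap hσ hψ2 hm2 h hc2
  unfold DoublyQuenchedConv
  rw [squareLaw_map (measurable_factorMap hm)]
  simp only [squareLaw_map (measurable_modelMap _ hm)]
  exact this

theorem DoublyQuenchedConv.diagonal {Γ 𝒳 : Type*} [Group Γ] [Countable Γ] [MetricSpace 𝒳]
    [CompactSpace 𝒳] [MeasurableSpace 𝒳] [BorelSpace 𝒳] {V : ℕ → Type*} [∀ n, Fintype (V n)]
    [∀ n, Nonempty (V n)] {σ : ∀ n, Γ → Equiv.Perm (V n)}
    {m : ℕ → ∀ n, ProbabilityMeasure (V n → 𝒳)} {μs : ℕ → ProbabilityMeasure (Γ → 𝒳)}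
    {μ : ProbabilityMeasure (Γ → 𝒳)} (h : ∀ j, DoublyQuenchedConv σ (m j) (μs j))
    (hμ : Tendsto μs atTop (𝓝 μ)) : ∃ J : ℕ → ℕ, DoublyQuenchedConv σ (fun n => m (J n) n) μ :=
  QuenchedConv.diagonal (m := fun j n => squareLaw (m j n)) (μs := fun j => squareLaw (μs j)) h
    (continuous_squareLaw.continuousAt.tendsto.comp hμ)

theorem squareLaw_mapState {ι 𝒳 𝒴 : Type*} [MeasurableSpace 𝒳] [MeasurableSpace 𝒴] {f : 𝒳 → 𝒴}
    (hf : Measurable f) (μ : ProbabilityMeasure (ι → 𝒳)) :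
    squareLaw (mapState hf μ) = mapState (hf.prodMap hf) (squareLaw μ) :=
  squareLaw_map (measurable_pi_lambda _ fun i => hf.comp (measurable_pi_apply i)) μ

theorem DoublyQuenchedConv.mapState {Γ 𝒳 𝒴 : Type*} [Countable Γ] [MetricSpace 𝒳]
    [CompactSpace 𝒳] [MeasurableSpace 𝒳] [BorelSpace 𝒳] [MetricSpace 𝒴] [CompactSpace 𝒴]
    [MeasurableSpace 𝒴] [BorelSpace 𝒴] {V : ℕ → Type*} [∀ n, Fintype (V n)] [∀ n, Nonempty (V n)]
    {σ : ∀ n, Γ → Equiv.Perm (V n)} {m : ∀ n, ProbabilityMeasure (V n → 𝒳)}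
    {μ : ProbabilityMeasure (Γ → 𝒳)} (h : DoublyQuenchedConv σ m μ) {f : 𝒳 → 𝒴}
    (hf : Continuous f) :
    DoublyQuenchedConv σ (fun n => mapState hf.measurable (m n)) (mapState hf.measurable μ) := by
  have := QuenchedConv.mapState h (hf.prodMap hf)
  unfold DoublyQuenchedConv
  simp only [squareLaw_mapState]
  exact this

end Square

/-! ### Approximation of measurable functions of the names -/

section Approx

variable {Γ 𝒳 : Type*} [Countable Γ] [MetricSpace 𝒳] [CompactSpace 𝒳]
  [MeasurableSpace 𝒳] [BorelSpace 𝒳]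

/-- The algebra of the functions that are Lipschitz in finitely many coordinates. -/
def lipCyl (Γ 𝒳 : Type*) [MetricSpace 𝒳] [CompactSpace 𝒳] : Subalgebra ℝ C(Γ → 𝒳, ℝ) where
  carrier := {F | ∃ (E : Finset Γ) (C : ℝ), 0 ≤ C ∧
    ∀ y y' : Γ → 𝒳, |F y - F y'| ≤ C * ∑ g ∈ E, dist (y g) (y' g)}
  mul_mem' := by
    classical
    rintro a b ⟨E, C, hC, h⟩ ⟨E', C', hC', h'⟩
    refine ⟨E ∪ E', ‖b‖ * C + ‖a‖ * C', by positivity, fun y y' => ?_⟩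
    have e : (a * b) y - (a * b) y' = b y * (a y - a y') + a y' * (b y - b y') := by
      simp only [ContinuousMap.mul_apply]; ring
    rw [e]
    refine (abs_add_le _ _).trans ?_
    rw [abs_mul, abs_mul, add_mul, mul_assoc, mul_assoc]
    refine add_le_add (mul_le_mul (b.norm_coe_le_norm y) ((h y y').trans ?_) (abs_nonneg _)
      (norm_nonneg _)) (mul_le_mul (a.norm_coe_le_norm y') ((h' y y').trans ?_) (abs_nonneg _)
      (norm_nonneg _))
    · exact mul_le_mul_of_nonneg_left (Finset.sum_le_sum_of_subset_of_nonneg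
        Finset.subset_union_left fun _ _ _ => dist_nonneg) hC
    · exact mul_le_mul_of_nonneg_left (Finset.sum_le_sum_of_subset_of_nonneg
        Finset.subset_union_right fun _ _ _ => dist_nonneg) hC'
  add_mem' := by
    classical
    rintro a b ⟨E, C, hC, h⟩ ⟨E', C', hC', h'⟩
    refine ⟨E ∪ E', C + C', by positivity, fun y y' => ?_⟩
    have e : (a + b) y - (a + b) y' = (a y - a y') + (b y - b y') := by
      simp only [ContinuousMap.add_apply]; ring
    rw [e, add_mul]
    refine (abs_add_le _ _).trans (add_le_add ((h y y').trans ?_) ((h' y y').trans ?_))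
    · exact mul_le_mul_of_nonneg_left (Finset.sum_le_sum_of_subset_of_nonneg
        Finset.subset_union_left fun _ _ _ => dist_nonneg) hC
    · exact mul_le_mul_of_nonneg_left (Finset.sum_le_sum_of_subset_of_nonneg
        Finset.subset_union_right fun _ _ _ => dist_nonneg) hC'
  algebraMap_mem' r := ⟨∅, 0, le_rfl, fun y y' => by simp⟩

theorem mem_lipCyl {F : C(Γ → 𝒳, ℝ)} : F ∈ lipCyl Γ 𝒳 ↔ ∃ (E : Finset Γ) (C : ℝ), 0 ≤ C ∧
    ∀ y y' : Γ → 𝒳, |F y - F y'| ≤ C * ∑ g ∈ E, dist (y g) (y' g) := Iff.rfl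

theorem finDep_of_mem_lipCyl {F : C(Γ → 𝒳, ℝ)} (hF : F ∈ lipCyl Γ 𝒳) : FinDep F := by
  obtain ⟨E, C, -, h⟩ := mem_lipCyl.1 hF
  refine ⟨E, fun x x' hx => ?_⟩
  have h1 := h x x'
  rw [Finset.sum_eq_zero fun g hg => by rw [hx g hg, dist_self], mul_zero] at h1
  exact sub_eq_zero.1 (abs_nonpos_iff.1 h1)

theorem separatesPoints_lipCyl : (lipCyl Γ 𝒳).SeparatesPoints := by
  intro x y hxy
  obtain ⟨g, hg⟩ := Function.ne_iff.1 hxy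
  refine ⟨_, ⟨(⟨fun z => dist (z g) (y g), by fun_prop⟩ : C(Γ → 𝒳, ℝ)), ?_, rfl⟩, by simpa using hg⟩
  exact ⟨{g}, 1, zero_le_one, fun z z' => by simpa using abs_dist_sub_le (z g) (z' g) (y g)⟩

/-- The approximants serve twice: finite dependence makes them act on models, and the Lipschitz
bound turns Hamming closeness into closeness of their averages. -/
theorem exists_lipCyl_approx (μ : ProbabilityMeasure (Γ → 𝒳)) {f : (Γ → 𝒳) → ℝ}
    (hf : Integrable f (μ : Measure (Γ → 𝒳))) {ε : ℝ} (hε : 0 < ε) :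
    ∃ g ∈ lipCyl Γ 𝒳, ∫ x, |f x - g x| ∂(μ : Measure (Γ → 𝒳)) ≤ ε := by
  obtain ⟨g₀, hg₀, hgi⟩ := hf.exists_boundedContinuous_integral_sub_le (half_pos hε)
  obtain ⟨⟨g, hg⟩, hgg⟩ := ContinuousMap.exists_mem_subalgebra_near_continuousMap_of_separatesPoints
    _ separatesPoints_lipCyl g₀.toContinuousMap (ε / 2) (by positivity)
  refine ⟨g, hg, ?_⟩
  have hint : Integrable g (μ : Measure (Γ → 𝒳)) :=
    (BoundedContinuousFunction.mkOfCompact g).integrable _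
  calc ∫ x, |f x - g x| ∂(μ : Measure (Γ → 𝒳))
      ≤ ∫ x, (‖f x - g₀ x‖ + ε / 2) ∂(μ : Measure (Γ → 𝒳)) := by
        refine integral_mono (hf.sub hint).abs ((hf.sub hgi).norm.add (integrable_const _))
          fun x => ?_
        have h1 : |f x - g x| ≤ |f x - g₀ x| + |g x - g₀ x| := by
          rw [abs_sub_comm (g x)]
          exact abs_sub_le _ _ _
        have h2 : |g x - g₀ x| ≤ ε / 2 :=
          ((g - g₀.toContinuousMap).norm_coe_le_norm x).trans hgg.le
        simp only [Real.norm_eq_abs]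
        linarith
    _ ≤ ε := by
        have hn : Integrable (fun x => ‖f x - g₀ x‖) (μ : Measure (Γ → 𝒳)) := (hf.sub hgi).norm
        rw [integral_add hn (integrable_const _)]
        simp only [integral_const, probReal_univ, one_smul]
        linarith

/-- A simple function of the names agrees up to small measure with a finitely determined function
whose discontinuities form a null set. -/
theorem exists_ae_continuous_approx (μ : ProbabilityMeasure (Γ → 𝒳)) {𝒵 : Type*}
    [TopologicalSpace 𝒵] [MeasurableSpace 𝒵] (s : SimpleFunc (Γ → 𝒳) 𝒵) {ε : ℝ} (hε : 0 < ε) :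
    ∃ ψ : (Γ → 𝒳) → 𝒵, Measurable ψ ∧ FinDep ψ ∧
      (∀ᵐ x ∂(μ : Measure (Γ → 𝒳)), ContinuousAt ψ x) ∧
      (μ : Measure (Γ → 𝒳)) {x | ψ x ≠ s x} ≤ ENNReal.ofReal ε := by
  have hne : Nonempty (Γ → 𝒳) := μ.nonempty
  have hnz : Nonempty 𝒵 := hne.map s
  -- The finitely many values are coded by integers, the code is approximated in `L¹` by a
  -- continuous `g`, and `g` is rounded back to an integer.
  obtain ⟨i, hi⟩ := Set.countable_iff_exists_injOn.1 (s.range.countable_toSet)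
  let j : 𝒵 → ℤ := fun z => i z
  have hj : Set.InjOn j s.range := fun a ha b hb h => hi ha hb (Int.ofNat_inj.1 h)
  let e : ℤ → 𝒵 := Function.invFunOn j s.range
  have he : ∀ x, e (j (s x)) = s x := fun x =>
    hj.leftInvOn_invFunOn (Finset.mem_coe.2 (s.mem_range_self x))
  let f : (Γ → 𝒳) → ℝ := (s.map fun z => (j z : ℝ))
  have hf : Integrable f (μ : Measure (Γ → 𝒳)) := SimpleFunc.integrable_of_isFiniteMeasure _
  obtain ⟨g, hg, hfg⟩ := exists_lipCyl_approx μ hf (show 0 < ε / 4 by positivity)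
  have hgm : Measurable g := g.continuous.measurable
  -- Rounding by `⌊g + t⌋` jumps only where `g + t` is an integer, that is, where `fract (-g) = t`.
  -- These sets are disjoint, so all but countably many `t` give a null set. Any `t` between `1/4`
  -- and `3/4` recovers the code wherever `g` is within `1/4` of it.
  obtain ⟨t, ht, hμt⟩ : ∃ t ∈ Set.Ioo (1 / 4 : ℝ) (3 / 4),
      (μ : Measure (Γ → 𝒳)) {x | Int.fract (-g x) = t} = 0 := by
    have mbles : ∀ t : ℝ, MeasurableSet {x | Int.fract (-g x) = t} := fun t =>
      (measurable_fract.comp hgm.neg) (measurableSet_singleton t)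
    have disjs : Pairwise (Function.onFun Disjoint fun t : ℝ => {x | Int.fract (-g x) = t}) :=
      fun a b hab => Set.disjoint_left.2 fun x hx hx' => hab (hx.symm.trans hx')
    have key := Measure.countable_meas_pos_of_disjoint_iUnion
      (μ := (μ : Measure (Γ → 𝒳))) mbles disjs
    have aux := measure_sdiff_null (s := Set.Ioo (1 / 4 : ℝ) (3 / 4))
      (Set.Countable.measure_zero key volume)
    have len_pos : 0 < volume (Set.Ioo (1 / 4 : ℝ) (3 / 4)) := by
      rw [Real.volume_Ioo]; norm_num
    rw [← aux] at len_pos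
    obtain ⟨t, ht, ht'⟩ := nonempty_of_measure_ne_zero len_pos.ne'
    exact ⟨t, ht, by simpa using ht'⟩
  refine ⟨fun x => e ⌊g x + t⌋, ?_, ?_, ?_, ?_⟩
  · exact (measurable_from_top (f := e)).comp (Int.measurable_floor.comp (hgm.add_const t))
  · obtain ⟨E, hE⟩ := finDep_of_mem_lipCyl hg
    exact ⟨E, fun x x' h => by simp only [hE x x' h]⟩
  · have h0 : ∀ᵐ x ∂(μ : Measure (Γ → 𝒳)), Int.fract (-g x) ≠ t := by
      rw [ae_iff]
      simpa using hμt
    filter_upwards [h0] with x hx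
    have hfl : (⌊g x + t⌋ : ℝ) < g x + t := by
      refine lt_of_le_of_ne (Int.floor_le _) fun h => hx ?_
      rw [Int.fract_eq_iff]
      exact ⟨by linarith [ht.1], by linarith [ht.2], -⌊g x + t⌋, by push_cast; linarith⟩
    have hev : ∀ᶠ x' in 𝓝 x, ⌊g x' + t⌋ = ⌊g x + t⌋ := by
      have hc : ContinuousAt (fun x' => g x' + t) x := by fun_prop
      filter_upwards [hc.eventually (lt_mem_nhds hfl),
        hc.eventually (gt_mem_nhds (Int.lt_floor_add_one (g x + t)))] with x' h1 h2
      exact Int.floor_eq_iff.2 ⟨h1.le, h2⟩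
    exact (continuousAt_const (y := e ⌊g x + t⌋)).congr (hev.mono fun x' hx' => by simp only [hx'])
  · have hsub : {x | e ⌊g x + t⌋ ≠ s x} ⊆ {x | 1 / 4 ≤ |f x - g x|} := by
      intro x hx
      by_contra hlt
      simp only [Set.mem_ofPred_eq, not_le] at hlt
      apply hx
      rw [abs_lt] at hlt
      have : ⌊g x + t⌋ = j (s x) := by
        rw [Int.floor_eq_iff]
        change (f x : ℝ) ≤ _ ∧ _ < f x + 1
        constructor <;> linarith [hlt.1, hlt.2, ht.1, ht.2]
      rw [this, he]
    refine (measure_mono hsub).trans ?_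
    have hint : Integrable (fun x => |f x - g x|) (μ : Measure (Γ → 𝒳)) :=
      (hf.sub ((BoundedContinuousFunction.mkOfCompact g).integrable _)).abs
    have := mul_meas_ge_le_integral_of_nonneg
      (Filter.Eventually.of_forall fun x => abs_nonneg (f x - g x)) hint (1 / 4)
    rw [← ofReal_measureReal]
    refine ENNReal.ofReal_le_ofReal ?_
    linarith

variable [Group Γ]

/-- The exceptional measures are at most `(1 / 2) ^ j`, hence summable. By Borel-Cantelli, almost
every name eventually sees the simple approximations of `φ` themselves. -/
theorem exists_seq_ae_continuous_approx (μ : ProbabilityMeasure (Γ → 𝒳)) {𝒵 : Type*}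
    [MetricSpace 𝒵] [CompactSpace 𝒵] [MeasurableSpace 𝒵] [BorelSpace 𝒵] {φ : (Γ → 𝒳) → 𝒵}
    (hφ : Measurable φ) :
    ∃ ψ : ℕ → (Γ → 𝒳) → 𝒵, (∀ j, Measurable (ψ j)) ∧ (∀ j, FinDep (ψ j)) ∧
      (∀ j, ∀ᵐ x ∂(μ : Measure (Γ → 𝒳)), ContinuousAt (ψ j) x) ∧
      ∀ᵐ x ∂(μ : Measure (Γ → 𝒳)), Tendsto (fun j => ψ j x) atTop (𝓝 (φ x)) := by
  have hne : Nonempty (Γ → 𝒳) := μ.nonempty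
  obtain ⟨z₀⟩ : Nonempty 𝒵 := hne.map φ
  choose ψ h1 h2 h3 h4 using fun j : ℕ => exists_ae_continuous_approx μ
    (SimpleFunc.approxOn φ hφ Set.univ z₀ (Set.mem_univ _) j)
    (show (0 : ℝ) < (1 / 2) ^ j by positivity)
  refine ⟨ψ, h1, h2, h3, ?_⟩
  have hsum : ∑' j, (μ : Measure (Γ → 𝒳))
      {x | ψ j x ≠ SimpleFunc.approxOn φ hφ Set.univ z₀ (Set.mem_univ _) j x} ≠ ∞ := by
    refine ne_top_of_le_ne_top ?_ (ENNReal.tsum_le_tsum h4)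
    rw [← ENNReal.ofReal_tsum_of_nonneg (fun j => by positivity) summable_geometric_two]
    exact ENNReal.ofReal_ne_top
  filter_upwards [ae_eventually_notMem hsum] with x hx
  refine (SimpleFunc.tendsto_approxOn hφ (Set.mem_univ z₀) (x := x) (by simp)).congr' ?_
  filter_upwards [hx] with j hj
  simpa using (not_not.1 hj).symm

/-- Continuity into a product is coordinatewise; each coordinate is `ψ` after a shift preserving
`μ`, and there are countably many. -/
theorem ae_continuousAt_factorMap {μ : ProbabilityMeasure (Γ → 𝒳)}
    (hμ : ∀ g : Γ, MeasurePreserving (rightShift g) (μ : Measure (Γ → 𝒳)) μ) {𝒵 : Type*}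
    [TopologicalSpace 𝒵] {ψ : (Γ → 𝒳) → 𝒵}
    (hc : ∀ᵐ x ∂(μ : Measure (Γ → 𝒳)), ContinuousAt ψ x) :
    ∀ᵐ x ∂(μ : Measure (Γ → 𝒳)), ContinuousAt (factorMap ψ) x := by
  have : ∀ᵐ x ∂(μ : Measure (Γ → 𝒳)), ∀ g, ContinuousAt ψ (rightShift g x) :=
    ae_all_iff.2 fun g => (hμ g).quasiMeasurePreserving.ae hc
  filter_upwards [this] with x hx
  refine continuousAt_pi.2 fun g => ?_
  have hr : Continuous (rightShift g : (Γ → 𝒳) → Γ → 𝒳) :=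
    continuous_pi fun h => continuous_apply _
  exact ContinuousAt.comp (hx g) hr.continuousAt

theorem tendsto_map_factorMap {μ : ProbabilityMeasure (Γ → 𝒳)}
    (hμ : ∀ g : Γ, MeasurePreserving (rightShift g) (μ : Measure (Γ → 𝒳)) μ) {𝒵 : Type*}
    [MetricSpace 𝒵] [CompactSpace 𝒵] [MeasurableSpace 𝒵] [BorelSpace 𝒵] {φ : (Γ → 𝒳) → 𝒵}
    (hφ : Measurable φ) {ψ : ℕ → (Γ → 𝒳) → 𝒵} (hψ : ∀ j, Measurable (ψ j))
    (h : ∀ᵐ x ∂(μ : Measure (Γ → 𝒳)), Tendsto (fun j => ψ j x) atTop (𝓝 (φ x))) :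
    Tendsto (fun j => μ.map (measurable_factorMap (hψ j)).aemeasurable) atTop
      (𝓝 (μ.map (measurable_factorMap hφ).aemeasurable)) := by
  have h1 : ∀ᵐ x ∂(μ : Measure (Γ → 𝒳)), ∀ g,
      Tendsto (fun j => ψ j (rightShift g x)) atTop (𝓝 (φ (rightShift g x))) :=
    ae_all_iff.2 fun g => (hμ g).quasiMeasurePreserving.ae h
  rw [ProbabilityMeasure.tendsto_iff_forall_integral_tendsto]
  intro F
  have hF := F.continuous.measurable
  simp only [ProbabilityMeasure.toMeasure_map]
  rw [integral_map (measurable_factorMap hφ).aemeasurable hF.aestronglyMeasurable]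
  simp_rw [fun j => integral_map (μ := (μ : Measure (Γ → 𝒳)))
    (measurable_factorMap (hψ j)).aemeasurable hF.aestronglyMeasurable]
  refine tendsto_integral_of_dominated_convergence (fun _ => ‖F‖)
    (fun j => (hF.comp (measurable_factorMap (hψ j))).aestronglyMeasurable)
    (integrable_const _) (fun j => Filter.Eventually.of_forall fun x => F.norm_coe_le_norm _) ?_
  filter_upwards [h1] with x hx
  exact (F.continuous.tendsto _).comp (tendsto_pi_nhds.2 hx)

end Approx

/-! ### Covering numbers -/

section Covering

theorem expRate_mono (V : Type*) [Fintype V] {M N : ℕ∞} (h : M ≤ N) :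
    expRate V M ≤ expRate V N := by
  unfold expRate
  refine EReal.div_le_div_right_of_nonneg (by positivity) (ENNReal.log_monotone ?_)
  exact_mod_cast h

section Hamming

variable {V 𝒳 : Type*} [Fintype V] [MetricSpace 𝒳]

theorem hammingAvg_comm (x y : V → 𝒳) : hammingAvg x y = hammingAvg y x := by
  simp only [hammingAvg, dist_comm]

theorem hammingAvg_triangle (x y z : V → 𝒳) :
    hammingAvg x z ≤ hammingAvg x y + hammingAvg y z := by
  unfold hammingAvg
  rw [← add_div, ← Finset.sum_add_distrib]
  gcongr
  exact dist_triangle _ _ _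

theorem hammingAvg_comp_perm (π : Equiv.Perm V) (x y : V → 𝒳) :
    hammingAvg (fun v => x (π v)) (fun v => y (π v)) = hammingAvg x y := by
  unfold hammingAvg
  congr 1
  exact Equiv.sum_comp π fun v => dist (x v) (y v)

theorem continuous_hammingAvg_left (y : V → 𝒳) : Continuous fun x : V → 𝒳 => hammingAvg x y := by
  unfold hammingAvg
  fun_prop

end Hamming

/-- The centres in `F` need not be images of points of `Y`. Each useful one is replaced by a point
of `Y` mapped near it, at the price of doubling the radius. -/
theorem covNum_le_card_of_map {α V 𝒴 : Type*} [Fintype V] [MetricSpace 𝒴] {d : α → α → ℝ}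
    {δ δ' : ℝ} {Y : Set α} {Ψ : α → V → 𝒴} {F : Finset (V → 𝒴)}
    (hF : ∀ y ∈ Y, ∃ z ∈ F, hammingAvg (Ψ y) z < δ')
    (hd : ∀ y ∈ Y, ∀ y' ∈ Y, hammingAvg (Ψ y) (Ψ y') < 2 * δ' → d y y' < δ) :
    covNum d δ Y ≤ F.card := by
  classical
  let F₁ := F.filter fun z => ∃ y ∈ Y, hammingAvg (Ψ y) z < δ'
  have hF₁ : ∀ z ∈ F₁, ∃ y ∈ Y, hammingAvg (Ψ y) z < δ' := fun z hz => (Finset.mem_filter.1 hz).2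
  choose r hr hrz using hF₁
  refine (iInf₂_le (F₁.attach.image fun z => r z.1 z.2) ⟨?_, fun y hy => ?_⟩).trans ?_
  · refine Nat.cast_le.2 (Finset.card_image_le.trans ?_)
    rw [Finset.card_attach]
    exact Finset.card_filter_le _ _
  · intro y hy
    obtain ⟨z, -, rfl⟩ := Finset.mem_image.1 (Finset.mem_coe.1 hy)
    exact hr z.1 z.2
  · obtain ⟨z, hz, hyz⟩ := hF y hy
    have hz₁ : z ∈ F₁ := Finset.mem_filter.2 ⟨hz, y, hy, hyz⟩
    refine ⟨r z hz₁, Finset.mem_image.2 ⟨⟨z, hz₁⟩, Finset.mem_attach _ _, rfl⟩,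
      hd y hy _ (hr z hz₁) ?_⟩
    have h1 := hammingAvg_triangle (Ψ y) z (Ψ (r z hz₁))
    rw [hammingAvg_comm z] at h1
    linarith [hrz z hz₁]

theorem covNum_le_of_map {α V 𝒴 : Type*} [Fintype V] [MetricSpace 𝒴] {d : α → α → ℝ}
    {δ δ' : ℝ} {Y : Set α} {Ψ : α → V → 𝒴} {Y' : Set (V → 𝒴)} (hY : ∀ y ∈ Y, Ψ y ∈ Y')
    (hd : ∀ y ∈ Y, ∀ y' ∈ Y, hammingAvg (Ψ y) (Ψ y') < 2 * δ' → d y y' < δ) :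
    covNum d δ Y ≤ covNum hammingAvg δ' Y' :=
  le_iInf₂ fun _ hF => covNum_le_card_of_map (fun y hy => hF.2 _ (hY y hy)) hd

/-- A competitor `Y'` may be non-measurable. It is enlarged to the open union of the balls of its
cover, whose preimage has the right mass, and removing `Yᶜ` costs the other `ε / 2`. -/
theorem covNumMeasure_le_of_map {α V 𝒴 : Type*} [MeasurableSpace α] [Fintype V] [MetricSpace 𝒴]
    [CompactSpace 𝒴] [MeasurableSpace 𝒴] [BorelSpace 𝒴] {d : α → α → ℝ}
    {δ δ' ε : ℝ} {m : ProbabilityMeasure α} {Y : Set α} {Ψ : α → V → 𝒴} (hΨ : Measurable Ψ)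
    (hY : (m : Measure α).real Yᶜ < ε / 2)
    (hd : ∀ y ∈ Y, ∀ y' ∈ Y, hammingAvg (Ψ y) (Ψ y') < 2 * δ' → d y y' < δ) :
    covNumMeasure d ε δ m ≤ covNumMeasure hammingAvg (ε / 2) δ' (m.map hΨ.aemeasurable) := by
  refine le_iInf₂ fun Y' hY' => le_iInf₂ fun F hF => ?_
  let B : Set (V → 𝒴) := ⋃ z ∈ F, {y | hammingAvg y z < δ'}
  have hB : IsOpen B := isOpen_biUnion fun z _ =>
    isOpen_lt (continuous_hammingAvg_left z) continuous_const
  have hYB : Y' ⊆ B := fun y hy => by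
    obtain ⟨z, hz, h⟩ := hF.2 y hy
    exact Set.mem_biUnion (Finset.mem_coe.2 hz) h
  have h1 : 1 - ε / 2 < (m : Measure α).real (Ψ ⁻¹' B) := by
    rw [← map_measureReal_apply hΨ hB.measurableSet]
    exact hY'.trans_le (measureReal_mono hYB (measure_ne_top _ _))
  have h2 : (m : Measure α).real (Ψ ⁻¹' B) ≤ (m : Measure α).real (Y ∩ Ψ ⁻¹' B)
      + (m : Measure α).real Yᶜ := by
    refine (measureReal_mono ?_).trans (measureReal_union_le _ _)
    intro x hx
    by_cases h : x ∈ Y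
    · exact Or.inl ⟨h, hx⟩
    · exact Or.inr h
  refine (iInf₂_le (Y ∩ Ψ ⁻¹' B) (by linarith)).trans
    (covNum_le_card_of_map (δ' := δ') ?_ fun y hy y' hy' => hd y hy.1 y' hy'.1)
  rintro y ⟨-, hy⟩
  obtain ⟨z, hz, h⟩ := Set.mem_iUnion₂.1 hy
  exact ⟨z, hz, h⟩

end Covering

/-! ### Joint models determine and are determined by their marginals -/

section Joint

variable {Γ : Type w} [Group Γ] [Countable Γ]
  {𝒳 𝒴 : Type*} [MetricSpace 𝒳] [CompactSpace 𝒳] [MeasurableSpace 𝒳] [BorelSpace 𝒳]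
  [MetricSpace 𝒴] [CompactSpace 𝒴] [MeasurableSpace 𝒴] [BorelSpace 𝒴]

/-- Distances to a finite net determine a point up to `δ`. This reduces questions about `𝒳`-valued
maps to finitely many real functions. -/
theorem exists_net_dist_le (𝒳 : Type*) [MetricSpace 𝒳] [CompactSpace 𝒳] {δ : ℝ} (hδ : 0 < δ) :
    ∃ t : Finset 𝒳, ∀ a b : 𝒳, dist a b ≤ δ + ∑ c ∈ t, |dist a c - dist b c| := by
  obtain ⟨t, -, ht, hc⟩ := Metric.finite_approx_of_totallyBounded
    (isCompact_univ (X := 𝒳)).totallyBounded (δ / 2) (half_pos hδ)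
  lift t to Finset 𝒳 using ht
  refine ⟨t, fun a b => ?_⟩
  obtain ⟨c, hct, hac⟩ := Set.mem_iUnion₂.1 (hc (Set.mem_univ a))
  have h1 := Finset.single_le_sum (f := fun c => |dist a c - dist b c|)
    (fun c _ => abs_nonneg _) (Finset.mem_coe.1 hct)
  have h2 := neg_abs_le (dist a c - dist b c)
  have h3 := dist_triangle_right a b c
  have h4 : dist a c < δ / 2 := hac
  linarith

/-- If the first coordinate of a joint law is a function of the second names, then for good joint
models closeness of the second coordinates forces closeness of the first coordinates. -/
theorem exists_determination (L : ProbabilityMeasure (Γ → 𝒳 × 𝒴)) {θ : (Γ → 𝒴) → 𝒳}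
    (hθ : Measurable θ)
    (hL : ∀ᵐ z ∂(L : Measure (Γ → 𝒳 × 𝒴)), (z 1).1 = θ fun g => (z g).2) {δ : ℝ} (hδ : 0 < δ) :
    ∃ δ' > 0, ∃ O ∈ 𝓝 L, ∀ (V : Type v) [Fintype V] [Nonempty V] (σ : Γ → Equiv.Perm V),
      ∀ z ∈ goodModels O σ, ∀ z' ∈ goodModels O σ,
        hammingAvg (fun v => (z v).2) (fun v => (z' v).2) < δ' →
        hammingAvg (fun v => (z v).1) (fun v => (z' v).1) < δ := by
  obtain ⟨t, ht⟩ := exists_net_dist_le 𝒳 (show 0 < δ / 4 by positivity)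
  let κ : ℝ := δ / (16 * (t.card + 1))
  have hκ : 0 < κ := by positivity
  have hbd : ∀ c a : 𝒳, |dist a c| ≤ Metric.diam (Set.univ : Set 𝒳) := fun c a => by
    rw [abs_of_nonneg dist_nonneg]
    exact Metric.dist_le_diam_of_mem isCompact_univ.isBounded (Set.mem_univ _) (Set.mem_univ _)
  have hint : ∀ c : 𝒳, Integrable (fun y => dist (θ y) c)
      (mapState measurable_snd L : Measure (Γ → 𝒴)) := fun c =>
    Integrable.of_bound (hθ.dist measurable_const).aestronglyMeasurable _
      (Filter.Eventually.of_forall fun y => hbd c (θ y))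
  choose g hg hgκ using fun c : 𝒳 => exists_lipCyl_approx (mapState measurable_snd L) (hint c) hκ
  choose E C hC hgl using fun c => mem_lipCyl.1 (hg c)
  -- A continuous test function for the failure of `g c`, applied to the second name, to predict the
  -- distance of the first coordinate from `c`. Its integral against `L` is at most `κ`, so a bound
  -- `2 * κ` is an open condition on empirical distributions.
  let D : 𝒳 → C(Γ → 𝒳 × 𝒴, ℝ) := fun c =>
    ⟨fun z => |dist (z 1).1 c - g c fun k => (z k).2|, by
      have : Continuous fun (z : Γ → 𝒳 × 𝒴) k => (z k).2 := by fun_prop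
      fun_prop⟩
  have hD : ∀ c, ∫ z, D c z ∂(L : Measure (Γ → 𝒳 × 𝒴)) ≤ κ := fun c => by
    refine le_trans (le_of_eq ?_) (hgκ c)
    rw [mapState, ProbabilityMeasure.toMeasure_map,
      integral_map (φ := fun (z : Γ → 𝒳 × 𝒴) k => (z k).2)
        (f := fun y => |dist (θ y) c - g c y|) (measurable_pi_lambda _ fun i => measurable_snd.comp
          (measurable_pi_apply i)).aemeasurable
        (((hθ.dist measurable_const).sub (g c).continuous.measurable).abs).aestronglyMeasurable]
    refine integral_congr_ae ?_
    filter_upwards [hL] with z hz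
    change |dist (z 1).1 c - _| = _
    rw [hz]
  have hDO : ∀ c, {P : ProbabilityMeasure (Γ → 𝒳 × 𝒴) | ∫ z, D c z ∂(P : Measure _) < 2 * κ}
      ∈ 𝓝 L := fun c =>
    (tendsto_integral_of_tendsto tendsto_id (D c)).eventually
      (gt_mem_nhds (by linarith [hD c] : ∫ z, D c z ∂(L : Measure (Γ → 𝒳 × 𝒴)) < 2 * κ))
  let K : ℝ := ∑ c ∈ t, C c * (E c).card
  have hK : 0 ≤ K := Finset.sum_nonneg fun c _ => mul_nonneg (hC c) (Nat.cast_nonneg _)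
  -- Here `K` is the total Lipschitz cost: each `E c` contributes one permuted copy of the Hamming
  -- average for each of its elements.
  refine ⟨δ / (4 * (K + 1)), by positivity, _, (Filter.biInter_finset_mem t).2 fun c _ => hDO c, ?_⟩
  intro V _ _ σ z hz z' hz' hzz
  have hcard : (0 : ℝ) < Fintype.card V := by exact_mod_cast Fintype.card_pos
  have hgood : ∀ z ∈ goodModels (⋂ c ∈ t, {P : ProbabilityMeasure (Γ → 𝒳 × 𝒴) |
      ∫ z, D c z ∂(P : Measure _) < 2 * κ}) σ, ∀ c ∈ t,
      (∑ v, D c (pullbackName σ v z)) / Fintype.card V < 2 * κ := fun z hz c hc => by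
    rw [← integral_empirical]
    exact Set.mem_iInter₂.1 hz c hc
  have hpt : ∀ v, dist (z (σ 1 v)).1 (z' (σ 1 v)).1 ≤ δ / 4 + ∑ c ∈ t,
      (D c (pullbackName σ v z) + D c (pullbackName σ v z')
        + C c * ∑ k ∈ E c, dist (z (σ k v)).2 (z' (σ k v)).2) := fun v => by
    refine (ht _ _).trans (add_le_add_right (Finset.sum_le_sum fun c _ => ?_) _)
    have h1 := hgl c (fun k => (z (σ k v)).2) (fun k => (z' (σ k v)).2)
    have h2 : D c (pullbackName σ v z) = |dist (z (σ 1 v)).1 c - g c fun k => (z (σ k v)).2| := rfl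
    have h3 : D c (pullbackName σ v z') = |dist (z' (σ 1 v)).1 c - g c fun k => (z' (σ k v)).2| :=
      rfl
    rw [h2, h3]
    refine le_trans ?_ (add_le_add_right h1 _)
    rw [abs_sub_comm (dist (z' (σ 1 v)).1 c)]
    exact (abs_sub_le _ (g c fun k => (z (σ k v)).2) _).trans (by
      have := abs_sub_le (g c fun k => (z (σ k v)).2) (g c fun k => (z' (σ k v)).2)
        (dist (z' (σ 1 v)).1 c)
      linarith)
  have hperm : ∀ c, (∑ v, C c * ∑ k ∈ E c, dist (z (σ k v)).2 (z' (σ k v)).2) / Fintype.card V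
      = C c * (E c).card * hammingAvg (fun v => (z v).2) (fun v => (z' v).2) := fun c => by
    rw [← Finset.mul_sum, Finset.sum_comm]
    have : ∀ k, ∑ v, dist (z (σ k v)).2 (z' (σ k v)).2 = ∑ v, dist (z v).2 (z' v).2 := fun k =>
      Equiv.sum_comp (σ k) fun v => dist (z v).2 (z' v).2
    simp only [this, Finset.sum_const, nsmul_eq_mul, hammingAvg]
    ring
  -- Names read the coordinate at `σ 1 v`, and `σ 1` need not be the identity; being a permutation,
  -- it preserves the average.
  rw [← hammingAvg_comp_perm (σ 1)]
  calc hammingAvg (fun v => (z (σ 1 v)).1) (fun v => (z' (σ 1 v)).1)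
      ≤ (∑ v, (δ / 4 + ∑ c ∈ t, (D c (pullbackName σ v z) + D c (pullbackName σ v z')
        + C c * ∑ k ∈ E c, dist (z (σ k v)).2 (z' (σ k v)).2))) / Fintype.card V := by
        unfold hammingAvg
        gcongr with v
        exact hpt v
    _ = δ / 4 + ∑ c ∈ t, ((∑ v, D c (pullbackName σ v z)) / Fintype.card V
        + (∑ v, D c (pullbackName σ v z')) / Fintype.card V
        + C c * (E c).card * hammingAvg (fun v => (z v).2) (fun v => (z' v).2)) := by
        simp only [← hperm]
        rw [Finset.sum_add_distrib, Finset.sum_comm, add_div]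
        congr 1
        · rw [Finset.sum_const, nsmul_eq_mul, Finset.card_univ, mul_div_cancel_left₀ _ hcard.ne']
        · rw [Finset.sum_div]
          refine Finset.sum_congr rfl fun c _ => ?_
          rw [Finset.sum_add_distrib, Finset.sum_add_distrib, add_div, add_div]
    _ ≤ δ / 4 + ∑ c ∈ t, (2 * κ + 2 * κ
        + C c * (E c).card * hammingAvg (fun v => (z v).2) (fun v => (z' v).2)) := by
        gcongr with c hc
        · exact (hgood z hz c hc).le
        · exact (hgood z' hz' c hc).le
    _ = δ / 4 + t.card * (4 * κ) + K * hammingAvg (fun v => (z v).2) (fun v => (z' v).2) := by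
        rw [Finset.sum_add_distrib, Finset.sum_const, nsmul_eq_mul, ← Finset.sum_mul]
        ring
    _ < δ := by
        have h1 : t.card * (4 * κ) ≤ δ / 4 := by
          have : (t.card + 1 : ℝ) * (4 * κ) = δ / 4 := by
            simp only [κ]; field_simp; norm_num
          nlinarith
        have h2 : K * hammingAvg (fun v => (z v).2) (fun v => (z' v).2) ≤ K * (δ / (4 * (K + 1))) :=
          mul_le_mul_of_nonneg_left hzz.le hK
        have h3 : K * (δ / (4 * (K + 1))) ≤ δ / 4 := by
          rw [mul_div_assoc', div_le_div_iff₀ (by positivity) (by positivity)]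
          nlinarith
        linarith

end Joint

/-! ### Comparison of the entropies of isomorphic processes -/

theorem GSystem.Isomorphic.symm {Γ : Type w} [Group Γ] {A : GSystem.{u} Γ} {B : GSystem.{u'} Γ}
    (h : A.Isomorphic B) : B.Isomorphic A := by
  obtain ⟨φ, ψ, hφ, hψ, h1, h2, h3⟩ := h
  have hψm : MeasurePreserving ψ B.measure A.measure := by
    refine ⟨hψ, ?_⟩
    rw [← hφ.map_eq, Measure.map_map hψ hφ.measurable]
    have : ψ ∘ φ =ᵐ[A.measure] id := h1
    rw [Measure.map_congr this, Measure.map_id]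
  refine ⟨ψ, φ, hψm, hφ.measurable, h2, h1, fun g => ?_⟩
  filter_upwards [h2, hψm.quasiMeasurePreserving.ae (h3 g), hψm.quasiMeasurePreserving.ae
    ((A.measurePreserving g).quasiMeasurePreserving.ae h1)] with y e1 e2 e3
  rw [← e3, e2, e1]

theorem GSystem.Isomorphic.trans {Γ : Type w} [Group Γ] {A : GSystem.{u} Γ} {B : GSystem.{u'} Γ}
    {C : GSystem.{v} Γ} (h : A.Isomorphic B) (h' : B.Isomorphic C) : A.Isomorphic C := by
  have hs' := h.symm
  have hs := h'.symm
  obtain ⟨φ, ψ, hφ, hψ, h1, h2, h3⟩ := h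
  obtain ⟨φ', ψ', hφ', hψ', h1', h2', h3'⟩ := h'
  have hψm : MeasurePreserving ψ' C.measure B.measure := by
    refine ⟨hψ', ?_⟩
    rw [← hφ'.map_eq, Measure.map_map hψ' hφ'.measurable]
    have : ψ' ∘ φ' =ᵐ[B.measure] id := h1'
    rw [Measure.map_congr this, Measure.map_id]
  refine ⟨φ' ∘ φ, ψ ∘ ψ', hφ'.comp hφ, hψ.comp hψ', ?_, ?_, fun g => ?_⟩
  · filter_upwards [h1, hφ.quasiMeasurePreserving.ae h1'] with x e1 e2
    simp only [Function.comp_apply, e2, e1]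
  · filter_upwards [h2', hψm.quasiMeasurePreserving.ae h2] with x e1 e2
    simp only [Function.comp_apply, e2, e1]
  · filter_upwards [h3 g, hφ.quasiMeasurePreserving.ae (h3' g)] with x e1 e2
    simp only [Function.comp_apply, e1, e2]

namespace MetricProcess

variable {Γ : Type w} [Group Γ] [Countable Γ]

/-- `L` is the law of the pair of a name and its image under the isomorphism, and `θ` comes from the
inverse map. Only the second coordinate has to be approximated; the first is copied exactly, so no
information about the original model is lost. -/
theorem exists_joint {P : MetricProcess.{u} Γ} {Q : MetricProcess.{u'} Γ}
    (h : P.toGSystem.Isomorphic Q.toGSystem) :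
    ∃ (L : ProbabilityMeasure (Γ → P.State × Q.State)) (θ : (Γ → Q.State) → P.State)
      (Ψ : ℕ → (Γ → P.State) → P.State × Q.State) (hΨ : ∀ j, Measurable (Ψ j)),
      mapState measurable_snd L = Q.law ∧ Measurable θ ∧
      (∀ᵐ z ∂(L : Measure (Γ → P.State × Q.State)), (z 1).1 = θ fun g => (z g).2) ∧
      (∀ j, FinDep (Ψ j)) ∧
      (∀ j, ∀ᵐ x ∂(P.law : Measure (Γ → P.State)), ContinuousAt (factorMap (Ψ j)) x) ∧
      Tendsto (fun j => P.law.map (measurable_factorMap (hΨ j)).aemeasurable) atTop (𝓝 L) ∧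
      ∀ j x, (Ψ j x).1 = x 1 := by
  obtain ⟨α, β, hα, hβ, h1, -, h3⟩ := h
  change (Γ → P.State) → (Γ → Q.State) at α
  change (Γ → Q.State) → (Γ → P.State) at β
  change MeasurePreserving α (P.law : Measure (Γ → P.State)) (Q.law : Measure (Γ → Q.State)) at hα
  change Measurable β at hβ
  change ∀ᵐ x ∂(P.law : Measure (Γ → P.State)), β (α x) = x at h1
  change ∀ g : Γ, ∀ᵐ x ∂(P.law : Measure (Γ → P.State)),
    α (rightShift g x) = rightShift g (α x) at h3
  have hα1 : Measurable fun x => α x 1 := (measurable_pi_apply 1).comp hα.measurable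
  let φ : (Γ → P.State) → P.State × Q.State := fun x => (x 1, α x 1)
  have hφ : Measurable φ := (measurable_pi_apply 1).prodMk hα1
  have hφα : ∀ᵐ x ∂(P.law : Measure (Γ → P.State)), factorMap φ x = fun g => (x g, α x g) := by
    filter_upwards [ae_all_iff.2 h3] with x hx
    funext g
    simp only [factorMap, φ, hx g, rightShift, one_mul]
  obtain ⟨ψ, e1, e2, e3, e4⟩ := exists_seq_ae_continuous_approx P.law hα1
  have hΨ : ∀ j, Measurable fun x : Γ → P.State => (x 1, ψ j x) := fun j =>
    (measurable_pi_apply 1).prodMk (e1 j)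
  refine ⟨P.law.map (measurable_factorMap hφ).aemeasurable, fun y => β y 1,
    fun j x => (x 1, ψ j x), hΨ, ?_, (measurable_pi_apply 1).comp hβ, ?_, ?_, ?_, ?_,
    fun _ _ => rfl⟩
  · refine ProbabilityMeasure.toMeasure_injective ?_
    rw [mapState, ProbabilityMeasure.toMeasure_map, ProbabilityMeasure.toMeasure_map,
      Measure.map_map measurable_unzip_snd (measurable_factorMap hφ), ← hα.map_eq]
    refine Measure.map_congr ?_
    filter_upwards [hφα] with x hx
    simp only [Function.comp_apply, hx]
  · rw [ProbabilityMeasure.toMeasure_map, ae_map_iff (measurable_factorMap hφ).aemeasurable]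
    · filter_upwards [hφα, h1] with x hx hx1
      simp only [hx, hx1]
    · exact measurableSet_eq_fun (measurable_fst.comp (measurable_pi_apply 1))
        (((measurable_pi_apply 1).comp hβ).comp measurable_unzip_snd)
  · intro j
    classical
    obtain ⟨E, hE⟩ := e2 j
    exact ⟨insert 1 E, fun x x' hx => Prod.ext (hx 1 (Finset.mem_insert_self _ _))
      (hE x x' fun g hg => hx g (Finset.mem_insert_of_mem hg))⟩
  · intro j
    refine ae_continuousAt_factorMap P.invariant ?_
    filter_upwards [e3 j] with x hx
    exact (continuous_apply 1).continuousAt.prodMk hx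
  · refine tendsto_map_factorMap P.invariant hφ hΨ ?_
    filter_upwards [e4] with x hx
    exact tendsto_const_nhds.prodMk_nhds hx

theorem hammingAvg_lt_of_modelMap {V 𝒳 𝒴 : Type*} [Fintype V] [MetricSpace 𝒳] {δ : ℝ}
    {σ : Γ → Equiv.Perm V} {Ψ : (Γ → 𝒳) → 𝒳 × 𝒴} (hΨ : ∀ x, (Ψ x).1 = x 1) {x x' : V → 𝒳}
    (h : hammingAvg (fun v => (modelMap σ Ψ x v).1) (fun v => (modelMap σ Ψ x' v).1) < δ) :
    hammingAvg x x' < δ := by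
  rw [← hammingAvg_comp_perm (σ 1)]
  simpa only [modelMap, hΨ, pullbackName] using h

variable {V : ℕ → Type v} [∀ n, Fintype (V n)] [∀ n, Nonempty (V n)]
  {σ : ∀ n, Γ → Equiv.Perm (V n)}

/-- One finitely determined map sends good models of `P` to good models of the joining. Their second
coordinates are good for `Q`, and a cover of these pulls back because the second coordinate
determines the first. -/
theorem soficEntropy_le_of_isomorphic (hσ : IsSoficApproximation σ) {P : MetricProcess.{u} Γ}
    {Q : MetricProcess.{u'} Γ} (h : P.toGSystem.Isomorphic Q.toGSystem) :
    P.soficEntropy σ ≤ Q.soficEntropy σ := by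
  obtain ⟨L, θ, Ψ, hΨ, hLQ, hθ, hLθ, hfd, hc, hlim, hfst⟩ := exists_joint h
  refine iSup₂_le fun δ hδ => ?_
  obtain ⟨δ', hδ', O'', hO'', hdet⟩ := exists_determination L hθ hLθ hδ
  refine le_iSup₂_of_le (δ' / 2) (half_pos hδ') (le_iInf₂ fun O' hO' => ?_)
  have hms : Continuous (mapState measurable_snd :
      ProbabilityMeasure (Γ → P.State × Q.State) → ProbabilityMeasure (Γ → Q.State)) :=
    ProbabilityMeasure.continuous_map (by fun_prop)
  have hO₂ : O'' ∩ mapState measurable_snd ⁻¹' O' ∈ 𝓝 L := by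
    refine inter_mem hO'' (hms.continuousAt ?_)
    rwa [hLQ]
  obtain ⟨j, hj⟩ := (hlim.eventually (eventually_eventually_nhds.2 hO₂)).exists
  -- Along this filter both the empirical distribution tends to the law and `n` tends to infinity,
  -- so the conclusion holds uniformly over all good models of large index.
  have hl := tendsto_empirical_modelMap hσ (hfd j) (hΨ j) (hc j)
    (ι := Σ n, (V n → P.State)) (a := id)
    (l := comap (fun a => empirical (σ a.1) a.2) (𝓝 P.law) ⊓ comap Sigma.fst atTop)
    (tendsto_comap.mono_left inf_le_right) (tendsto_comap.mono_left inf_le_left) hj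
  obtain ⟨S, ⟨O, hO, hOS⟩, T, ⟨N, hN, hNT⟩, hST⟩ := mem_inf_iff_superset.1 hl
  refine iInf₂_le_of_le O hO (limsup_le_limsup ?_)
  filter_upwards [hN] with n hn
  have hgood : ∀ x ∈ goodModels O (σ n), modelMap (σ n) (Ψ j) x ∈
      goodModels (O'' ∩ mapState measurable_snd ⁻¹' O') (σ n) := fun x hx =>
    hST (a := ⟨n, x⟩) ⟨hOS hx, hNT hn⟩
  refine expRate_mono _ (covNum_le_of_map
    (Ψ := fun x v => (modelMap (σ n) (Ψ j) x v).2) (fun x hx => ?_) fun x hx x' hx' hxx => ?_)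
  · change empirical (σ n) _ ∈ O'
    rw [empirical_map (σ n) measurable_snd]
    exact (hgood x hx).2
  · rw [mul_div_cancel₀ _ two_ne_zero] at hxx
    exact hammingAvg_lt_of_modelMap (hfst j)
      (hdet (V n) (σ n) _ (hgood x hx).1 _ (hgood x' hx').1 hxx)

theorem quenchedEntropy_le_soficEntropy (P : MetricProcess.{u} Γ) :
    P.quenchedEntropy σ ≤ P.soficEntropy σ := by
  refine iSup₂_le fun k hk => iSup₂_le fun m hm => iSup₂_le fun δ hδ => iSup₂_le fun ε hε => ?_
  refine le_iSup₂_of_le δ hδ (le_iInf₂ fun O hO => ?_)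
  have h1 : limsup (fun i => expRate (V (k i)) (covNum hammingAvg δ (goodModels O (σ (k i)))))
      atTop ≤ limsup (fun n => expRate (V n) (covNum hammingAvg δ (goodModels O (σ n)))) atTop :=
    (limsup_comp (fun n => expRate (V n) (covNum hammingAvg δ (goodModels O (σ n)))) k atTop).trans_le
      (limsup_le_limsup_of_le hk.tendsto_atTop)
  refine le_trans (limsup_le_limsup ?_) h1
  filter_upwards [(hm.2 O hO).eventually (lt_mem_nhds (show 1 - ε < 1 by linarith))] with i hi
  exact expRate_mono _ (iInf₂_le (goodModels O (σ (k i))) hi)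

theorem doublyQuenchedEntropy_le_quenchedEntropy (P : MetricProcess.{u} Γ) :
    P.doublyQuenchedEntropy σ ≤ P.quenchedEntropy σ :=
  iSup₂_le fun k hk => iSup₂_le fun m hm => le_iSup₂_of_le k hk
    (le_iSup₂_of_le m hm.quenchedConv le_rfl)

/-- A single approximating map is not enough here: the image measures must converge to the law of
`Q` itself, which requires a diagonal choice of maps. -/
theorem doublyQuenchedEntropy_le_of_isomorphic (hσ : IsSoficApproximation σ)
    {P : MetricProcess.{u} Γ} {Q : MetricProcess.{u'} Γ}
    (h : P.toGSystem.Isomorphic Q.toGSystem) :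
    P.doublyQuenchedEntropy σ ≤ Q.doublyQuenchedEntropy σ := by
  obtain ⟨L, θ, Ψ, hΨ, hLQ, hθ, hLθ, hfd, hc, hlim, hfst⟩ := exists_joint h
  refine iSup₂_le fun k hk => iSup₂_le fun m hm => ?_
  have hσk := hσ.comp hk.tendsto_atTop
  obtain ⟨J, hJ⟩ := DoublyQuenchedConv.diagonal
    (fun j => DoublyQuenchedConv.modelMap hσk (hfd j) (hΨ j) hm (hc j)) hlim
  let M : ∀ i, ProbabilityMeasure (V (k i) → P.State × Q.State) := fun i =>
    (m i).map (measurable_modelMap (σ (k i)) (hΨ (J i))).aemeasurable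
  have hM : DoublyQuenchedConv (fun i => σ (k i)) M L := hJ
  have hM' : DoublyQuenchedConv (fun i => σ (k i)) (fun i => mapState measurable_snd (M i))
      Q.law := hLQ ▸ hM.mapState continuous_snd
  have hMq := (quenchedConv_iff.1 hM.quenchedConv).2
  refine iSup₂_le fun δ hδ => iSup₂_le fun ε hε => ?_
  obtain ⟨δ', hδ', O, hO, hdet⟩ := exists_determination L hθ hLθ hδ
  refine le_iSup₂_of_le k hk (le_iSup₂_of_le _ hM' (le_iSup₂_of_le (δ' / 2) (half_pos hδ')
    (le_iSup₂_of_le (ε / 2) (half_pos hε) (limsup_le_limsup ?_))))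
  have hz := (mem_whm.1 (hMq hO)).eventually (gt_mem_nhds (half_pos hε))
  filter_upwards [hz] with i hi
  refine expRate_mono _ ?_
  have hcov := covNumMeasure_le_of_map (d := hammingAvg) (δ := δ) (δ' := δ' / 2) (ε := ε) (m := m i)
    (Y := {x | modelMap (σ (k i)) (Ψ (J i)) x ∈ goodModels O (σ (k i))})
    (Ψ := fun x v => (modelMap (σ (k i)) (Ψ (J i)) x v).2)
    (measurable_unzip_snd.comp (measurable_modelMap (σ (k i)) (hΨ (J i)))) ?_ ?_
  · refine hcov.trans (le_of_eq ?_)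
    congr 1
    exact (ProbabilityMeasure.map_comp (m i) (measurable_modelMap (σ (k i)) (hΨ (J i)))
      measurable_unzip_snd).symm
  -- `O` may be non-measurable; the mass of a preimage is still at most the mass under the image
  -- measure.
  · refine lt_of_le_of_lt ?_ hi
    refine ENNReal.toReal_mono (measure_ne_top _ _) ?_
    exact Measure.le_map_apply (measurable_modelMap (σ (k i)) (hΨ (J i))).aemeasurable _
  · intro x hx x' hx' hxx
    rw [mul_div_cancel₀ _ two_ne_zero] at hxx
    exact hammingAvg_lt_of_modelMap (hfst (J i)) (hdet (V (k i)) (σ (k i)) _ hx _ hx' hxx)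

end MetricProcess

/-! ### Powers of measures on model spaces -/

section PowLaw

theorem integral_prod_infinitePi {I J Y : Type*} [Fintype J] [MeasurableSpace Y] {q : Measure Y}
    [IsProbabilityMeasure q] {e : J → I} (he : Function.Injective e) {F : J → Y → ℝ}
    (hF : ∀ j, Measurable (F j)) :
    ∫ y, ∏ j, F j (y (e j)) ∂(Measure.infinitePi fun _ : I => q) = ∏ j, ∫ y, F j y ∂q := by
  have h1 : ProbabilityTheory.iIndepFun (fun (i : I) (ω : I → Y) => ω i)
      (Measure.infinitePi fun _ : I => q) :=
    ProbabilityTheory.iIndepFun_infinitePi (X := fun _ x => x) fun _ => measurable_id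
  have h2 := h1.precomp he
  rw [h2.integral_fun_prod_comp (fun j => (measurable_pi_apply (e j)).aemeasurable)
    fun j => (hF j).aestronglyMeasurable]
  refine Finset.prod_congr rfl fun j _ => ?_
  conv_rhs => rw [← Measure.infinitePi_map_eval (fun _ : I => q) (e j)]
  rw [integral_map (measurable_pi_apply _).aemeasurable (hF j).aestronglyMeasurable]

theorem measureReal_prod_apply {X Y : Type*} [MeasurableSpace X] [MeasurableSpace Y]
    (μ : Measure X) (ν : Measure Y) [IsProbabilityMeasure μ] [IsProbabilityMeasure ν]
    {A : Set (X × Y)} (hA : MeasurableSet A) :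
    (μ.prod ν).real A = ∫ x, ν.real (Prod.mk x ⁻¹' A) ∂μ := by
  rw [measureReal_def, Measure.prod_apply hA]
  exact (integral_toReal (measurable_measure_prodMk_left hA).aemeasurable
    (Filter.Eventually.of_forall fun x => measure_lt_top _ _)).symm

/-- It is enough to check boxes. Slices of a box are boxes, so Fubini gives an integral of a product
of functions of distinct independent coordinates. -/
theorem infinitePi_prod_map_zip {I Y : Type*} [MeasurableSpace Y] (q : Measure Y)
    [IsProbabilityMeasure q] :
    ((Measure.infinitePi fun _ : I => q).prod (Measure.infinitePi fun _ : I => q)).map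
      (fun (p : (I → Y) × (I → Y)) i => (p.1 i, p.2 i))
      = Measure.infinitePi fun _ : I => q.prod q := by
  refine Measure.eq_infinitePi (fun _ : I => q.prod q) fun s t ht => ?_
  have hS : MeasurableSet (Set.pi (s : Set I) t) := MeasurableSet.pi s.countable_toSet
    fun i _ => ht i
  rw [Measure.map_apply measurable_zip hS,
    ← ENNReal.toReal_eq_toReal_iff' (measure_ne_top _ _)
      (ENNReal.prod_ne_top fun _ _ => measure_ne_top _ _), ENNReal.toReal_prod]
  change ((Measure.infinitePi fun _ : I => q).prod (Measure.infinitePi fun _ : I => q)).real _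
    = ∏ i ∈ s, (q.prod q).real (t i)
  rw [measureReal_prod_apply _ _ (measurable_zip hS)]
  have h1 : ∀ x : I → Y, (Measure.infinitePi fun _ : I => q).real
      (Prod.mk x ⁻¹' ((fun (p : (I → Y) × (I → Y)) i => (p.1 i, p.2 i)) ⁻¹' Set.pi (s : Set I) t))
      = ∏ i : s, q.real (Prod.mk (x i) ⁻¹' t i) := fun x => by
    have : Prod.mk x ⁻¹' ((fun (p : (I → Y) × (I → Y)) i => (p.1 i, p.2 i)) ⁻¹'
        Set.pi (s : Set I) t) = Set.pi (s : Set I) fun i => Prod.mk (x i) ⁻¹' t i := rfl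
    rw [this, measureReal_def, Measure.infinitePi_pi (fun _ : I => q)
      fun i _ => measurable_prodMk_left (ht i), ENNReal.toReal_prod]
    exact (Finset.prod_coe_sort s fun i => q.real (Prod.mk (x i) ⁻¹' t i)).symm
  simp only [h1]
  rw [integral_prod_infinitePi (e := fun i : s => (i : I)) Subtype.val_injective
    (F := fun i y => q.real (Prod.mk y ⁻¹' t i))
    fun i => (measurable_measure_prodMk_left (ht i)).ennreal_toReal]
  rw [← Finset.prod_coe_sort s fun i => (q.prod q).real (t i)]
  exact Finset.prod_congr rfl fun i _ => (measureReal_prod_apply q q (ht i)).symm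

theorem measurable_uncurrySwap {I V 𝒳 : Type*} [MeasurableSpace 𝒳] :
    Measurable fun (y : I → V → 𝒳) (p : V × I) => y p.2 p.1 :=
  measurable_pi_lambda _ fun p => (measurable_pi_apply p.1).comp (measurable_pi_apply p.2)

/-- The power `q ^ I`, as a measure on `𝒳 ^ (V × I)`, of a measure `q` on `𝒳 ^ V`. -/
def powLaw {V 𝒳 : Type*} [MeasurableSpace 𝒳] (I : Type*) (q : ProbabilityMeasure (V → 𝒳)) :
    ProbabilityMeasure (V × I → 𝒳) :=
  ProbabilityMeasure.map (Ω := I → V → 𝒳) ⟨Measure.infinitePi fun _ : I => (q : Measure (V → 𝒳)),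
    inferInstance⟩ (f := fun y p => y p.2 p.1) measurable_uncurrySwap.aemeasurable

theorem toMeasure_powLaw {V 𝒳 : Type*} [MeasurableSpace 𝒳] (I : Type*)
    (q : ProbabilityMeasure (V → 𝒳)) : (powLaw I q : Measure (V × I → 𝒳)) =
      Measure.map (fun (y : I → V → 𝒳) (p : V × I) => y p.2 p.1)
        (Measure.infinitePi fun _ : I => (q : Measure (V → 𝒳))) := rfl

/-- This reduces doubly-quenched convergence of powers to quenched convergence of powers. -/
theorem squareLaw_powLaw {V 𝒳 : Type*} [MeasurableSpace 𝒳] (I : Type*)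
    (q : ProbabilityMeasure (V → 𝒳)) : squareLaw (powLaw I q) = powLaw I (squareLaw q) := by
  have hΦ : Measurable fun (x : I → (V → 𝒳) × (V → 𝒳)) i v => ((x i).1 v, (x i).2 v) :=
    measurable_pi_lambda _ fun i => measurable_zip.comp (measurable_pi_apply i)
  have h1 : Measure.infinitePi (fun _ : I => (squareLaw q : Measure (V → 𝒳 × 𝒳)))
      = (((Measure.infinitePi fun _ : I => (q : Measure (V → 𝒳))).prod
        (Measure.infinitePi fun _ : I => (q : Measure (V → 𝒳)))).map
          fun (p : (I → V → 𝒳) × (I → V → 𝒳)) i => (p.1 i, p.2 i)).map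
        fun (x : I → (V → 𝒳) × (V → 𝒳)) i v => ((x i).1 v, (x i).2 v) := by
    rw [infinitePi_prod_map_zip (q : Measure (V → 𝒳))]
    have := Measure.infinitePi_map_pi (μ := fun _ : I => (q : Measure (V → 𝒳)).prod
      (q : Measure (V → 𝒳))) (f := fun _ (p : (V → 𝒳) × (V → 𝒳)) v => (p.1 v, p.2 v))
      fun _ => measurable_zip
    rw [this, toMeasure_squareLaw]
  refine ProbabilityMeasure.toMeasure_injective ?_
  rw [toMeasure_squareLaw, toMeasure_powLaw, toMeasure_powLaw, h1,
    Measure.map_prod_map _ _ measurable_uncurrySwap measurable_uncurrySwap,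
    Measure.map_map (f := Prod.map (fun (y : I → V → 𝒳) (p : V × I) => y p.2 p.1)
      fun (y : I → V → 𝒳) (p : V × I) => y p.2 p.1)
      (g := fun (p : (V × I → 𝒳) × (V × I → 𝒳)) i => (p.1 i, p.2 i)) measurable_zip
      (measurable_uncurrySwap.prodMap measurable_uncurrySwap),
    Measure.map_map (f := fun (p : (I → V → 𝒳) × (I → V → 𝒳)) i => (p.1 i, p.2 i))
      (g := fun (x : I → (V → 𝒳) × (V → 𝒳)) i v => ((x i).1 v, (x i).2 v)) hΦ measurable_zip,
    Measure.map_map (g := fun (y : I → V → 𝒳 × 𝒳) (p : V × I) => y p.2 p.1)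
      measurable_uncurrySwap (hΦ.comp measurable_zip)]
  rfl

/-- The integral against a power of a product of functions of distinct factors. -/
theorem integral_prod_powLaw {V 𝒳 I J : Type*} [Fintype J] [MeasurableSpace 𝒳]
    (q : ProbabilityMeasure (V → 𝒳)) {e : J → I} (he : Function.Injective e)
    {F : J → (V → 𝒳) → ℝ} (hF : ∀ j, Measurable (F j)) :
    ∫ y, ∏ j, F j (fun v => y (v, e j)) ∂(powLaw I q : Measure (V × I → 𝒳))
      = ∏ j, ∫ y, F j y ∂(q : Measure (V → 𝒳)) := by
  have hm : ∀ i, Measurable fun (y : V × I → 𝒳) v => y (v, i) := fun i =>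
    measurable_pi_lambda _ fun v => measurable_pi_apply _
  rw [toMeasure_powLaw, integral_map (φ := fun (y : I → V → 𝒳) (p : V × I) => y p.2 p.1)
    (f := fun y => ∏ j, F j fun v => y (v, e j)) measurable_uncurrySwap.aemeasurable
    (Finset.measurable_prod _ fun j _ => (hF j).comp (hm _)).aestronglyMeasurable]
  exact integral_prod_infinitePi he hF

end PowLaw

/-! ### The process of a generating map -/

/-- The metric process of the names of a measurable map of a system to a compact metric space. -/
def GSystem.processOfMap {Γ : Type w} [Group Γ] [Countable Γ] (A : GSystem.{u} Γ) {𝒳 : Type u'}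
    [MetricSpace 𝒳] [CompactSpace 𝒳] [MeasurableSpace 𝒳] [BorelSpace 𝒳] {f : A.carrier → 𝒳}
    (hf : Measurable f) : MetricProcess.{u'} Γ where
  State := 𝒳
  law := ProbabilityMeasure.map (Ω := A.carrier) ⟨A.measure, inferInstance⟩
    (f := fun x (g : Γ) => f (A.act g x)) (measurable_pi_lambda _ fun g =>
      hf.comp (A.measurePreserving g).measurable).aemeasurable
  invariant g := by
    have hF : Measurable fun x (g : Γ) => f (A.act g x) :=
      measurable_pi_lambda _ fun g => hf.comp (A.measurePreserving g).measurable
    refine ⟨measurable_rightShift g, ?_⟩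
    change Measure.map _ (Measure.map (fun x (g : Γ) => f (A.act g x)) A.measure) =
      Measure.map (fun x (g : Γ) => f (A.act g x)) A.measure
    rw [Measure.map_map (measurable_rightShift g) hF]
    conv_rhs => rw [← (A.measurePreserving g).map_eq,
      Measure.map_map hF (A.measurePreserving g).measurable]
    congr 1
    funext x k
    simp [rightShift, A.act_mul]

theorem GSystem.processOfMap_isomorphic {Γ : Type w} [Group Γ] [Countable Γ] (A : GSystem.{u} Γ)
    {𝒳 : Type u'} [MetricSpace 𝒳] [CompactSpace 𝒳] [MeasurableSpace 𝒳] [BorelSpace 𝒳]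
    {f : A.carrier → 𝒳} (hf : Measurable f)
    (hinj : Function.Injective fun x (g : Γ) => f (A.act g x)) :
    A.Isomorphic (A.processOfMap hf).toGSystem := by
  let F : A.carrier → Γ → 𝒳 := fun x g => f (A.act g x)
  have hF : Measurable F :=
    measurable_pi_lambda _ fun g => hf.comp (A.measurePreserving g).measurable
  have hne : Nonempty A.carrier := nonempty_of_isProbabilityMeasure A.measure
  have hFe : MeasurableEmbedding F := hF.measurableEmbedding hinj
  obtain ⟨ψ, hψ, hψF⟩ := hFe.exists_measurable_extend measurable_id fun _ => hne
  have hψF' : ∀ x, ψ (F x) = x := fun x => congrFun hψF x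
  refine ⟨F, ψ, ⟨hF, rfl⟩, hψ, Filter.Eventually.of_forall hψF', ?_, fun g =>
    Filter.Eventually.of_forall fun x => ?_⟩
  · have : ∀ᵐ y ∂(Measure.map F A.measure), F (ψ y) = y := by
      have hr : ∀ᵐ y ∂(Measure.map F A.measure), y ∈ Set.range F :=
        (ae_map_iff hF.aemeasurable hFe.measurableSet_range).2
          (Filter.Eventually.of_forall fun x => ⟨x, rfl⟩)
      filter_upwards [hr] with y hy
      obtain ⟨x, rfl⟩ := hy
      rw [hψF']
    exact this
  · change F (A.act g x) = rightShift g (F x)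
    funext k
    simp [F, rightShift, A.act_mul]

/-- The co-induction of a system with a generating map has a process whose law is a power. -/
theorem GSystem.exists_coind_process {G : Type w} [Group G] [Countable G] (A : GSystem.{u} G)
    (H : Type v) [Group H] [Countable H] {𝒳 : Type u'} [MetricSpace 𝒳] [CompactSpace 𝒳]
    [MeasurableSpace 𝒳] [BorelSpace 𝒳] {f : A.carrier → 𝒳} (hf : Measurable f)
    (hinj : Function.Injective f) :
    ∃ (law : ProbabilityMeasure (G → 𝒳)) (hm : Measurable fun x : (A.coind H).carrier => f (x 1)),
      (A.coind H).Isomorphic ((A.coind H).processOfMap hm).toGSystem ∧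
      ((A.coind H).processOfMap hm).law = powLaw H law := by
  have hm : Measurable fun x : H → A.carrier => f (x 1) := hf.comp (measurable_pi_apply 1)
  have hF : Measurable fun x (g : G) => f (A.act g x) :=
    measurable_pi_lambda _ fun g => hf.comp (A.measurePreserving g).measurable
  refine ⟨ProbabilityMeasure.map (Ω := A.carrier) ⟨A.measure, inferInstance⟩
    (f := fun x (g : G) => f (A.act g x)) hF.aemeasurable, hm,
    GSystem.processOfMap_isomorphic _ hm ?_, ?_⟩
  · intro x y hxy
    funext k
    have := congrFun hxy (1, k)
    simpa [GSystem.coind, coindAct, A.act_one] using hinj this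
  · refine ProbabilityMeasure.toMeasure_injective ?_
    change Measure.map (fun (x : H → A.carrier) (p : G × H) => f (A.act p.1 (x (1 * p.2))))
      (Measure.infinitePi fun _ : H => A.measure) =
      Measure.map (fun (y : H → G → 𝒳) (p : G × H) => y p.2 p.1) (Measure.infinitePi fun _ : H =>
        Measure.map (fun x (g : G) => f (A.act g x)) A.measure)
    rw [← Measure.infinitePi_map_pi (μ := fun _ : H => A.measure)
        (f := fun _ x (g : G) => f (A.act g x)) fun _ => hF,
      Measure.map_map (f := fun (x : H → A.carrier) i (g : G) => f (A.act g (x i)))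
        (g := fun (y : H → G → 𝒳) (p : G × H) => y p.2 p.1) measurable_uncurrySwap
        (measurable_pi_lambda _ fun i => hF.comp (measurable_pi_apply i))]
    simp only [one_mul]
    rfl

/-! ### Products of sofic approximations -/

section ProductApproximation

variable {V W : ℕ → Type*} [∀ n, Fintype (V n)] [∀ n, Nonempty (V n)] [∀ n, Fintype (W n)]
  [∀ n, Nonempty (W n)]

theorem tendsto_fst_whp_prod :
    Tendsto (fun a : Σ n, V n × W n => (⟨a.1, a.2.1⟩ : Σ n, V n)) (whp fun n => V n × W n)
      (whp V) := by
  intro S hS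
  refine mem_whp.2 ((mem_whp.1 hS).congr fun n => ?_)
  have h : (Fintype.card (W n) : ℝ) ≠ 0 := by exact_mod_cast Fintype.card_ne_zero
  have e : Nat.card {p : V n × W n // (⟨n, p.1⟩ : Σ n, V n) ∉ S}
      = Nat.card {v : V n // (⟨n, v⟩ : Σ n, V n) ∉ S} * Fintype.card (W n) := by
    rw [← Nat.card_eq_fintype_card, ← Nat.card_prod]
    exact Nat.card_congr
      (Equiv.prodSubtypeFstEquivSubtypeProd (p := fun v => (⟨n, v⟩ : Σ n, V n) ∉ S))
  change _ = (Nat.card {p : V n × W n // (⟨n, p.1⟩ : Σ n, V n) ∉ S} : ℝ) / _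
  rw [e, Fintype.card_prod]
  push_cast
  rw [mul_div_mul_right _ _ h]

theorem tendsto_equiv_whp (e : ∀ n, V n ≃ W n) :
    Tendsto (fun a : Σ n, V n => (⟨a.1, e a.1 a.2⟩ : Σ n, W n)) (whp V) (whp W) := by
  intro S hS
  refine mem_whp.2 ((mem_whp.1 hS).congr fun n => ?_)
  rw [Fintype.card_congr (e n)]
  congr 2
  exact (Nat.card_congr ((e n).subtypeEquiv fun v => Iff.rfl)).symm

theorem tendsto_snd_whp_prod :
    Tendsto (fun a : Σ n, V n × W n => (⟨a.1, a.2.2⟩ : Σ n, W n)) (whp fun n => V n × W n)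
      (whp W) :=
  tendsto_fst_whp_prod.comp (tendsto_equiv_whp fun n => Equiv.prodComm (V n) (W n))

theorem eventually_exists_of_whp {p : ∀ n, V n → Prop} (h : ∀ᶠ a in whp V, p a.1 a.2) :
    ∀ᶠ n in atTop, ∃ v, p n v := by
  filter_upwards [(mem_whp.1 h).eventually (gt_mem_nhds one_pos)] with n hn
  by_contra hc
  push Not at hc
  have e : Nat.card {v : V n // ¬ p n v} = Fintype.card (V n) := by
    rw [← Nat.card_eq_fintype_card]
    exact Nat.card_congr (Equiv.subtypeUnivEquiv hc)
  change (Nat.card {v : V n // ¬ p n v} : ℝ) / _ < 1 at hn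
  rw [e, div_self (by exact_mod_cast Fintype.card_ne_zero)] at hn
  exact lt_irrefl _ hn

/-! ### Freeness and disjointness of finite orbit pieces -/

variable {G H : Type*} [Group G] [Group H] {σ : ∀ n, G → Equiv.Perm (V n)}
  {τ : ∀ n, H → Equiv.Perm (W n)}

theorem IsSoficApproximation.prod (hσ : IsSoficApproximation σ) (hτ : IsSoficApproximation τ) :
    IsSoficApproximation (soficProd σ τ) where
  mul p q := by
    rw [WHP_iff (p := fun n v => soficProd σ τ n p (soficProd σ τ n q v)
      = soficProd σ τ n (p * q) v)]
    have h1 := (WHP_iff (p := fun n v => σ n p.1 (σ n q.1 v) = σ n (p.1 * q.1) v)).1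
      (hσ.mul p.1 q.1)
    have h2 := (WHP_iff (p := fun n v => τ n p.2 (τ n q.2 v) = τ n (p.2 * q.2) v)).1
      (hτ.mul p.2 q.2)
    filter_upwards [tendsto_fst_whp_prod.eventually h1, tendsto_snd_whp_prod.eventually h2]
      with a ha1 ha2
    exact Prod.ext ha1 ha2
  free p hp := by
    rw [WHP_iff (p := fun n v => soficProd σ τ n p v ≠ v)]
    by_cases h1 : p.1 = 1
    · have h2 : p.2 ≠ 1 := fun h2 => hp (Prod.ext h1 h2)
      filter_upwards [tendsto_snd_whp_prod.eventually
        ((WHP_iff (p := fun n v => τ n p.2 v ≠ v)).1 (hτ.free p.2 h2))] with a ha h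
      exact ha (congrArg Prod.snd h)
    · filter_upwards [tendsto_fst_whp_prod.eventually
        ((WHP_iff (p := fun n v => σ n p.1 v ≠ v)).1 (hσ.free p.1 h1))] with a ha h
      exact ha (congrArg Prod.fst h)

/-- If `h` and `h'` agree at `w`, then multiplicativity makes `h * h'⁻¹` fix the image of `w` under
`h'`. That image is as uniformly distributed as `w`. -/
theorem IsSoficApproximation.eventually_ne (hτ : IsSoficApproximation τ) {h h' : H}
    (hh : h ≠ h') : ∀ᶠ a in whp W, τ a.1 h a.2 ≠ τ a.1 h' a.2 := by
  have h1 := (WHP_iff (p := fun n w => τ n (h * h'⁻¹) w ≠ w)).1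
    (hτ.free (h * h'⁻¹) fun hc => hh (mul_inv_eq_one.1 hc))
  have h2 := (WHP_iff (p := fun n w => τ n (h * h'⁻¹) (τ n h' w) = τ n (h * h'⁻¹ * h') w)).1
    (hτ.mul (h * h'⁻¹) h')
  filter_upwards [(tendsto_perm_whp fun n => τ n h').eventually h1, h2] with a ha1 ha2 hc
  rw [inv_mul_cancel_right] at ha2
  exact ha1 (ha2.trans hc)

theorem IsSoficApproximation.eventually_injOn (hτ : IsSoficApproximation τ) (E : Finset H) :
    ∀ᶠ a in whp W, Set.InjOn (fun h => τ a.1 h a.2) E := by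
  have : ∀ p ∈ E ×ˢ E, ∀ᶠ a in whp W, p.1 ≠ p.2 → τ a.1 p.1 a.2 ≠ τ a.1 p.2 a.2 :=
    fun p _ => by
      by_cases hp : p.1 = p.2
      · exact Filter.Eventually.of_forall fun a h => absurd hp h
      · filter_upwards [hτ.eventually_ne hp] with a ha _ using ha
  filter_upwards [(Filter.eventually_all_finset _).2 this] with a ha h hh h' hh' he
  by_contra hc
  exact ha (h, h') (Finset.mk_mem_product hh hh') hc he

theorem IsSoficApproximation.tendsto_card [Infinite H] (hτ : IsSoficApproximation τ) :
    Tendsto (fun n => Fintype.card (W n)) atTop atTop := by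
  refine tendsto_atTop.2 fun N => ?_
  obtain ⟨E, hE⟩ := Infinite.exists_subset_card_eq H N
  filter_upwards [eventually_exists_of_whp (p := fun n w => Set.InjOn (fun h => τ n h w) E)
    (hτ.eventually_injOn E)] with n ⟨w, hw⟩
  rw [← hE]
  exact Finset.card_le_card_of_injOn _ (fun _ _ => Finset.mem_univ _) hw

/-- The exceptional pairs form the graph of a bijection, a proportion `1 / |W n|` of all pairs. -/
theorem eventually_ne_whp_prod (hW : Tendsto (fun n => Fintype.card (W n)) atTop atTop)
    (π ρ : ∀ n, Equiv.Perm (W n)) :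
    ∀ᶠ a in whp fun n => W n × W n, π a.1 a.2.1 ≠ ρ a.1 a.2.2 := by
  have h0 : Tendsto (fun n => ((Fintype.card (W n) : ℝ))⁻¹) atTop (𝓝 0) :=
    tendsto_inv_atTop_zero.comp (tendsto_natCast_atTop_atTop.comp hW)
  refine mem_whp.2 (h0.congr fun n => ?_)
  have e : Nat.card {p : W n × W n // ¬ π n p.1 ≠ ρ n p.2} = Fintype.card (W n) := by
    rw [← Nat.card_eq_fintype_card]
    refine (Nat.card_congr (Equiv.ofBijective
      (fun w => (⟨(w, (ρ n).symm (π n w)), by simp⟩ :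
        {p : W n × W n // ¬ π n p.1 ≠ ρ n p.2})) ⟨fun w w' h => ?_, fun p => ?_⟩)).symm
    · simpa using congrArg (fun q => q.1.1) h
    · refine ⟨p.1.1, Subtype.ext (Prod.ext rfl ?_)⟩
      change (ρ n).symm (π n p.1.1) = _
      rw [not_not.1 p.2, Equiv.symm_apply_apply]
  change _ = (Nat.card {p : W n × W n // ¬ π n p.1 ≠ ρ n p.2} : ℝ) / _
  have h : (Fintype.card (W n) : ℝ) ≠ 0 := by exact_mod_cast Fintype.card_ne_zero
  rw [e, Fintype.card_prod]
  push_cast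
  field_simp

/-- Two random points have disjoint finite orbit pieces with high probability. -/
theorem IsSoficApproximation.eventually_injective_sum [Infinite H] (hτ : IsSoficApproximation τ)
    (E : Finset H) : ∀ᶠ a in whp fun n => W n × W n, Function.Injective
      (Sum.elim (fun h : E => τ a.1 h a.2.1) fun h : E => τ a.1 h a.2.2) := by
  have h1 : ∀ᶠ a in whp fun n => W n × W n, ∀ p ∈ E ×ˢ E,
      τ a.1 p.1 a.2.1 ≠ τ a.1 p.2 a.2.2 :=
    (Filter.eventually_all_finset _).2 fun p _ => eventually_ne_whp_prod hτ.tendsto_card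
      (fun n => τ n p.1) fun n => τ n p.2
  filter_upwards [h1, tendsto_fst_whp_prod.eventually (hτ.eventually_injOn E),
    tendsto_snd_whp_prod.eventually (hτ.eventually_injOn E)] with a ha ha1 ha2
  refine Function.Injective.sumElim (fun h h' e => Subtype.ext (ha1 h.2 h'.2 e))
    (fun h h' e => Subtype.ext (ha2 h.2 h'.2 e)) fun h h' =>
      ha (h, h') (Finset.mk_mem_product h.2 h'.2)

end ProductApproximation

/-! ### Quenched convergence of powers -/

section QuenchedPower

/-- Pairwise decorrelation of the names implies quenched convergence. -/
theorem quenchedConv_of_pairs {Γ 𝒳 : Type*} [Countable Γ] [MetricSpace 𝒳] [CompactSpace 𝒳]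
    [MeasurableSpace 𝒳] [BorelSpace 𝒳] {U : ℕ → Type*} [∀ n, Fintype (U n)] [∀ n, Nonempty (U n)]
    {σ : ∀ n, Γ → Equiv.Perm (U n)} {m : ∀ n, ProbabilityMeasure (U n → 𝒳)}
    {μ : ProbabilityMeasure (Γ → 𝒳)}
    (h1 : Tendsto (fun a : Σ n, U n =>
        (m a.1).map (measurable_pullbackName (σ a.1) a.2).aemeasurable) (whp U) (𝓝 μ))
    (h2 : ∀ (E : Finset Γ) (f : Γ → C(𝒳, ℝ)), Tendsto (fun a : Σ n, U n × U n =>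
      ∫ x, cylFun E f (pullbackName (σ a.1) a.2.1 x) * cylFun E f (pullbackName (σ a.1) a.2.2 x)
        ∂(m a.1 : Measure (U a.1 → 𝒳))) (whp fun n => U n × U n)
        (𝓝 ((∫ x, cylFun E f x ∂(μ : Measure (Γ → 𝒳))) ^ 2))) :
    QuenchedConv σ m μ := by
  refine quenchedConv_iff.2 ⟨h1, tendsto_of_cylFun fun E f => ?_⟩
  set F := cylFun E f with hF
  set c := ∫ x, F x ∂(μ : Measure (Γ → 𝒳)) with hc
  have hm : ∀ n (v : U n), Continuous fun x => F (pullbackName (σ n) v x) := fun n v =>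
    F.continuous.comp (continuous_pi fun g => continuous_apply _)
  have hb : ∀ n (v : U n) x, |F (pullbackName (σ n) v x)| ≤ ‖F‖ := fun n v x =>
    F.norm_coe_le_norm _
  have hint : ∀ n {g : (U n → 𝒳) → ℝ} (_ : Continuous g), Integrable g (m n : Measure _) :=
    fun n g hg => hg.integrable_of_hasCompactSupport (HasCompactSupport.of_compactSpace g)
  have hmean : Tendsto (fun a : Σ n, U n => ∫ x, F (pullbackName (σ a.1) a.2 x)
      ∂(m a.1 : Measure (U a.1 → 𝒳))) (whp U) (𝓝 c) := by
    refine (tendsto_integral_of_tendsto h1 F).congr fun a => ?_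
    rw [ProbabilityMeasure.toMeasure_map, integral_map (φ := pullbackName (σ a.1) a.2)
      (f := fun y => F y) (measurable_pullbackName _ _).aemeasurable
      F.continuous.measurable.aestronglyMeasurable]
  have hmeanb : ∀ a : Σ n, U n, |∫ x, F (pullbackName (σ a.1) a.2 x)
      ∂(m a.1 : Measure (U a.1 → 𝒳))| ≤ ‖F‖ := fun a => by
    simpa using norm_integral_le_of_norm_le_const (μ := (m a.1 : Measure (U a.1 → 𝒳)))
      (f := fun x => F (pullbackName (σ a.1) a.2 x)) (C := ‖F‖) (Filter.Eventually.of_forall fun x => hb a.1 a.2 x)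
  have hpairb : ∀ a : Σ n, U n × U n, |∫ x, F (pullbackName (σ a.1) a.2.1 x) *
      F (pullbackName (σ a.1) a.2.2 x) ∂(m a.1 : Measure (U a.1 → 𝒳))| ≤ ‖F‖ * ‖F‖ := fun a => by
    simpa using norm_integral_le_of_norm_le_const (μ := (m a.1 : Measure (U a.1 → 𝒳)))
      (f := fun x => F (pullbackName (σ a.1) a.2.1 x) * F (pullbackName (σ a.1) a.2.2 x))
      (Filter.Eventually.of_forall fun x => by
        rw [Real.norm_eq_abs, abs_mul]
        exact mul_le_mul (hb _ _ _) (hb _ _ _) (abs_nonneg _) (norm_nonneg _))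
  have hA := average_tendsto_of_whp hmeanb hmean
  have hB := average_tendsto_of_whp hpairb (h2 E f)
  -- The second moment of the empirical average is an average over pairs of points, so the
  -- hypothesis on pairs makes the variance vanish; Chebyshev's inequality concludes.
  have hvar : Tendsto (fun n => ∫ x, ((∑ v, F (pullbackName (σ n) v x)) / Fintype.card (U n) - c)
      ^ 2 ∂(m n : Measure (U n → 𝒳))) atTop (𝓝 0) := by
    have h3 := (hB.sub ((hA.const_mul (2 * c)))).add_const (c ^ 2)
    have h4 : c ^ 2 - 2 * c * c + c ^ 2 = 0 := by ring
    rw [h4] at h3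
    refine h3.congr fun n => ?_
    have hcard : (Fintype.card (U n) : ℝ) ≠ 0 := by exact_mod_cast Fintype.card_ne_zero
    have e1 : ∀ x, ((∑ v, F (pullbackName (σ n) v x)) / Fintype.card (U n) - c) ^ 2
        = (∑ p : U n × U n, F (pullbackName (σ n) p.1 x) * F (pullbackName (σ n) p.2 x))
          / Fintype.card (U n × U n)
          - 2 * c * ((∑ v, F (pullbackName (σ n) v x)) / Fintype.card (U n)) + c ^ 2 := fun x => by
      have e2 : ∑ p : U n × U n, F (pullbackName (σ n) p.1 x) * F (pullbackName (σ n) p.2 x)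
          = (∑ v, F (pullbackName (σ n) v x)) * ∑ v, F (pullbackName (σ n) v x) := by
        rw [Fintype.sum_prod_type]
        exact (Finset.sum_mul_sum Finset.univ Finset.univ (fun v => F (pullbackName (σ n) v x))
          fun v => F (pullbackName (σ n) v x)).symm
      rw [e2, Fintype.card_prod]
      push_cast
      field_simp
      ring
    simp only [e1]
    have c1 : Continuous fun x => (∑ p : U n × U n, F (pullbackName (σ n) p.1 x) *
        F (pullbackName (σ n) p.2 x)) / (Fintype.card (U n × U n) : ℝ) :=
      (continuous_finsetSum _ fun p _ => (hm n p.1).mul (hm n p.2)).div_const _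
    have c2 : Continuous fun x => 2 * c * ((∑ v, F (pullbackName (σ n) v x)) / Fintype.card (U n)) :=
      ((continuous_finsetSum _ fun v _ => hm n v).div_const _).const_mul _
    symm
    rw [integral_add (f := fun x => (∑ p : U n × U n, F (pullbackName (σ n) p.1 x) *
        F (pullbackName (σ n) p.2 x)) / (Fintype.card (U n × U n) : ℝ) -
        2 * c * ((∑ v, F (pullbackName (σ n) v x)) / Fintype.card (U n)))
        ((hint n c1).sub (hint n c2)) (integrable_const _),
      integral_sub (hint n c1) (hint n c2), integral_div, integral_const_mul, integral_div,
      integral_finsetSum _ fun p _ => hint n ((hm n p.1).mul (hm n p.2)),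
      integral_finsetSum _ fun v _ => hint n (hm n v)]
    simp
  simp only [integral_empirical]
  rw [Metric.tendsto_nhds]
  intro ε hε
  have h5 := hvar.div_const (ε ^ 2)
  rw [zero_div] at h5
  refine mem_whm.2 (squeeze_zero (fun n => measureReal_nonneg) (fun n => ?_) h5)
  have c3 : Continuous fun x =>
      ((∑ v, F (pullbackName (σ n) v x)) / (Fintype.card (U n) : ℝ) - c) ^ 2 :=
    (((continuous_finsetSum _ fun v _ => hm n v).div_const _).sub continuous_const).pow 2
  have h6 := mul_meas_ge_le_integral_of_nonneg (μ := (m n : Measure (U n → 𝒳)))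
    (Filter.Eventually.of_forall fun x => sq_nonneg _) (hint n c3) (ε ^ 2)
  rw [le_div_iff₀ (by positivity), mul_comm]
  refine le_trans (mul_le_mul_of_nonneg_left (measureReal_mono ?_ (measure_ne_top _ _))
    (by positivity)) h6
  intro x hx
  rw [Set.mem_ofPred_eq, Set.mem_ofPred_eq, Real.dist_eq, not_lt] at hx
  rw [Set.mem_ofPred_eq, ← sq_abs (_ - c)]
  exact pow_le_pow_left₀ hε.le hx 2

variable {G H 𝒳 : Type*} [Group G] [Group H] [Countable G] [Countable H] [MetricSpace 𝒳]
  [CompactSpace 𝒳] [MeasurableSpace 𝒳] [BorelSpace 𝒳]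

/-- A product of functions of finitely many coordinates can be arranged in columns. -/
theorem exists_cylFun_columns (E : Finset (G × H)) (f : G × H → C(𝒳, ℝ)) :
    ∃ (E₁ : Finset G) (E₂ : Finset H) (f' : H → G → C(𝒳, ℝ)), ∀ y : G × H → 𝒳,
      cylFun E f y = ∏ h : E₂, cylFun E₁ (f' h) fun g => y (g, h) := by
  classical
  refine ⟨E.image Prod.fst, E.image Prod.snd, fun h g => if (g, h) ∈ E then f (g, h) else 1,
    fun y => ?_⟩
  have hs : E ⊆ E.image Prod.fst ×ˢ E.image Prod.snd := fun p hp =>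
    Finset.mem_product.2 ⟨Finset.mem_image_of_mem _ hp, Finset.mem_image_of_mem _ hp⟩
  rw [Finset.prod_coe_sort (E.image Prod.snd) fun h => cylFun (E.image Prod.fst)
    (fun g => if (g, h) ∈ E then f (g, h) else 1) fun g => y (g, h)]
  simp only [cylFun_apply]
  rw [← Finset.prod_product_right' (E.image Prod.fst) (E.image Prod.snd)
    fun g h => (if (g, h) ∈ E then f (g, h) else 1) (y (g, h)), ← Finset.prod_subset hs]
  · exact Finset.prod_congr rfl fun p hp => by rw [Prod.mk.eta, if_pos hp]
  · intro p _ hp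
    rw [Prod.mk.eta, if_neg hp]
    rfl

variable [Infinite H] {V W : ℕ → Type*} [∀ n, Fintype (V n)] [∀ n, Nonempty (V n)]
  [∀ n, Fintype (W n)] [∀ n, Nonempty (W n)] {σ : ∀ n, G → Equiv.Perm (V n)}
  {τ : ∀ n, H → Equiv.Perm (W n)}

/-- Powers of locally weak* convergent measures converge in the quenched sense. -/
theorem quenchedConv_powLaw (hτ : IsSoficApproximation τ) {q : ∀ n, ProbabilityMeasure (V n → 𝒳)}
    {ν : ProbabilityMeasure (G → 𝒳)}
    (hq : Tendsto (fun a : Σ n, V n =>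
        (q a.1).map (measurable_pullbackName (σ a.1) a.2).aemeasurable) (whp V) (𝓝 ν)) :
    QuenchedConv (soficProd σ τ) (fun n => powLaw (W n) (q n)) (powLaw H ν) := by
  have hmean : ∀ F : C(G → 𝒳, ℝ), Tendsto (fun a : Σ n, V n => ∫ x,
      F (pullbackName (σ a.1) a.2 x) ∂(q a.1 : Measure (V a.1 → 𝒳))) (whp V)
      (𝓝 (∫ x, F x ∂(ν : Measure (G → 𝒳)))) := fun F => by
    refine (tendsto_integral_of_tendsto hq F).congr fun a => ?_
    rw [ProbabilityMeasure.toMeasure_map, integral_map (φ := pullbackName (σ a.1) a.2)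
      (f := fun y => F y) (measurable_pullbackName _ _).aemeasurable
      F.continuous.measurable.aestronglyMeasurable]
  have hmeas : ∀ (F : C(G → 𝒳, ℝ)) n (v : V n), Measurable fun x => F (pullbackName (σ n) v x) :=
    fun F n v => F.continuous.measurable.comp (measurable_pullbackName _ _)
  refine quenchedConv_of_pairs (tendsto_of_cylFun fun E f => ?_) fun E f => ?_
  all_goals
    obtain ⟨E₁, E₂, f', hf'⟩ := exists_cylFun_columns E f
    have hlim : ∫ x, cylFun E f x ∂(powLaw H ν : Measure (G × H → 𝒳))
        = ∏ h : E₂, ∫ x, cylFun E₁ (f' h) x ∂(ν : Measure (G → 𝒳)) := by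
      simp only [hf']
      exact integral_prod_powLaw ν (e := fun h : E₂ => (h : H)) Subtype.val_injective
        (F := fun h => cylFun E₁ (f' h)) fun h => (cylFun E₁ (f' h)).continuous.measurable
    rw [hlim]
  · refine (tendsto_finsetProd _ fun (h : E₂) _ =>
      (hmean (cylFun E₁ (f' h))).comp tendsto_fst_whp_prod).congr' ?_
    -- At most points of `W n` the relevant columns are distinct, hence independent under the power.
    filter_upwards [tendsto_snd_whp_prod.eventually (hτ.eventually_injOn E₂)] with a ha
    rw [ProbabilityMeasure.toMeasure_map,
      integral_map (φ := pullbackName (soficProd σ τ a.1) a.2)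
      (f := fun y => cylFun E f y) (measurable_pullbackName _ _).aemeasurable
      (cylFun E f).continuous.measurable.aestronglyMeasurable]
    simp only [hf']
    exact (integral_prod_powLaw (q a.1) (e := fun h : E₂ => τ a.1 h a.2.2)
      (fun h h' e => Subtype.ext (ha h.2 h'.2 e))
      (F := fun h x => cylFun E₁ (f' h) (pullbackName (σ a.1) a.2.1 x))
      fun h => hmeas _ _ _).symm
  -- Only the two `W`-coordinates must be in general position. The columns read are then all
  -- distinct, whatever the relation between the two `V`-coordinates.
  · have hproj : Tendsto (fun a : Σ n, (V n × W n) × (V n × W n) =>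
        (⟨a.1, (a.2.1.2, a.2.2.2)⟩ : Σ n, W n × W n))
        (whp fun n => (V n × W n) × (V n × W n)) (whp fun n => W n × W n) :=
      (tendsto_snd_whp_prod (V := fun n => V n × V n) (W := fun n => W n × W n)).comp
        (tendsto_equiv_whp fun n => Equiv.prodProdProdComm (V n) (W n) (V n) (W n))
    have hleft : Tendsto (fun a : Σ n, (V n × W n) × (V n × W n) =>
        (⟨a.1, a.2.1.1⟩ : Σ n, V n)) (whp fun n => (V n × W n) × (V n × W n)) (whp V) :=
      tendsto_fst_whp_prod.comp
        (tendsto_fst_whp_prod (V := fun n => V n × W n) (W := fun n => V n × W n))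
    have hright : Tendsto (fun a : Σ n, (V n × W n) × (V n × W n) =>
        (⟨a.1, a.2.2.1⟩ : Σ n, V n)) (whp fun n => (V n × W n) × (V n × W n)) (whp V) :=
      tendsto_fst_whp_prod.comp
        (tendsto_snd_whp_prod (V := fun n => V n × W n) (W := fun n => V n × W n))
    rw [sq]
    refine ((tendsto_finsetProd _ fun (h : E₂) _ => (hmean (cylFun E₁ (f' h))).comp hleft).mul
      (tendsto_finsetProd _ fun (h : E₂) _ => (hmean (cylFun E₁ (f' h))).comp hright)).congr' ?_
    filter_upwards [hproj.eventually (hτ.eventually_injective_sum E₂)] with a ha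
    have := integral_prod_powLaw (q a.1) ha (F := Sum.elim
      (fun h x => cylFun E₁ (f' h) (pullbackName (σ a.1) a.2.1.1 x))
      (fun h x => cylFun E₁ (f' h) (pullbackName (σ a.1) a.2.2.1 x)))
      (by rintro (h | h) <;> exact hmeas _ _ _)
    simp only [Fintype.prod_sum_type, Sum.elim_inl, Sum.elim_inr] at this
    simp only [hf']
    exact this.symm

end QuenchedPower

/-! ### Doubly-quenched convergence of powers -/

/-- Squaring is continuous and commutes with taking names and with powers, so the quenched statement
applies to the squares of `q n`. -/
theorem doublyQuenchedConv_powLaw {G H 𝒳 : Type*} [Group G] [Group H] [Countable G] [Countable H]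
    [MetricSpace 𝒳] [CompactSpace 𝒳] [MeasurableSpace 𝒳] [BorelSpace 𝒳] [Infinite H]
    {V W : ℕ → Type*} [∀ n, Fintype (V n)] [∀ n, Nonempty (V n)] [∀ n, Fintype (W n)]
    [∀ n, Nonempty (W n)] {σ : ∀ n, G → Equiv.Perm (V n)} {τ : ∀ n, H → Equiv.Perm (W n)}
    (hτ : IsSoficApproximation τ) {q : ∀ n, ProbabilityMeasure (V n → 𝒳)}
    {ν : ProbabilityMeasure (G → 𝒳)}
    (hq : Tendsto (fun a : Σ n, V n =>
        (q a.1).map (measurable_pullbackName (σ a.1) a.2).aemeasurable) (whp V) (𝓝 ν)) :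
    DoublyQuenchedConv (soficProd σ τ) (fun n => powLaw (W n) (q n)) (powLaw H ν) := by
  change QuenchedConv _ (fun n => squareLaw (powLaw (W n) (q n))) (squareLaw (powLaw H ν))
  simp only [squareLaw_powLaw]
  refine quenchedConv_powLaw hτ ((continuous_squareLaw.continuousAt.tendsto.comp hq).congr
    fun a => ?_)
  exact squareLaw_map (measurable_pullbackName (σ a.1) a.2) (q a.1)

/-! ### Averages of columns -/

section Columns

/-- The distribution of `f i` for uniformly distributed `i`. -/
def uniformLaw {ι Ω : Type*} [Fintype ι] [Nonempty ι] [MeasurableSpace Ω] (f : ι → Ω) :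
    ProbabilityMeasure Ω :=
  ⟨(Fintype.card ι : ℝ≥0∞)⁻¹ • ∑ i, Measure.dirac (f i), ⟨by simp [ENNReal.inv_mul_cancel]⟩⟩

theorem integral_uniformLaw {ι Ω : Type*} [Fintype ι] [Nonempty ι] [MeasurableSpace Ω]
    [MeasurableSingletonClass Ω] (f : ι → Ω) (g : Ω → ℝ) :
    ∫ y, g y ∂(uniformLaw f : Measure Ω) = (∑ i, g (f i)) / Fintype.card ι := by
  change ∫ y, g y ∂((Fintype.card ι : ℝ≥0∞)⁻¹ • ∑ i, Measure.dirac (f i)) = _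
  rw [integral_smul_measure, integral_finsetSum_measure fun v _ => integrable_dirac (by simp)]
  simp [div_eq_inv_mul]

/-- The distribution of a random column of a random element of `F`. -/
def columnLaw {V W 𝒳 : Type*} [Fintype W] [Nonempty W] [MeasurableSpace 𝒳]
    (F : Finset (V × W → 𝒳)) [Nonempty F] : ProbabilityMeasure (V → 𝒳) :=
  uniformLaw fun (p : F × W) v => p.1.1 (v, p.2)

/-- The squared deviation from its mean of an average over columns. -/
def columnDeviation {G H 𝒳 : Type*} [MetricSpace 𝒳] (T : Finset H) (F : C(G → 𝒳, ℝ)) (c : ℝ) :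
    C(G × H → 𝒳, ℝ) :=
  ⟨fun y => ((∑ h ∈ T, F fun g => y (g, h)) / T.card - c) ^ 2, by fun_prop⟩

variable {G H 𝒳 : Type*} [Countable G] [Countable H] [MetricSpace 𝒳]
  [CompactSpace 𝒳] [MeasurableSpace 𝒳] [BorelSpace 𝒳]

/-- Distinct columns are independent under the power, so covariances vanish and only the `|T|`
diagonal terms remain among `|T| ^ 2`. -/
theorem integral_columnDeviation_le {T : Finset H} (hT : T.Nonempty) (F : C(G → 𝒳, ℝ))
    (ν : ProbabilityMeasure (G → 𝒳)) :
    ∫ y, columnDeviation T F (∫ x, F x ∂(ν : Measure (G → 𝒳))) y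
      ∂(powLaw H ν : Measure (G × H → 𝒳)) ≤ (2 * ‖F‖) ^ 2 / T.card := by
  classical
  set c := ∫ x, F x ∂(ν : Measure (G → 𝒳)) with hc
  have hcard : (T.card : ℝ) ≠ 0 := by exact_mod_cast hT.card_pos.ne'
  have hcF : |c| ≤ ‖F‖ := by
    simpa using norm_integral_le_of_norm_le_const (μ := (ν : Measure (G → 𝒳)))
      (f := fun x => F x) (C := ‖F‖) (Filter.Eventually.of_forall fun x => F.norm_coe_le_norm x)
  let D : H → C(G × H → 𝒳, ℝ) := fun h => ⟨fun y => F (fun g => y (g, h)) - c, by fun_prop⟩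
  have hint : ∀ g : C(G × H → 𝒳, ℝ), Integrable g (powLaw H ν : Measure (G × H → 𝒳)) :=
    fun g => g.continuous.integrable_of_hasCompactSupport (HasCompactSupport.of_compactSpace g)
  have hintF : Integrable F (ν : Measure (G → 𝒳)) :=
    F.continuous.integrable_of_hasCompactSupport (HasCompactSupport.of_compactSpace F)
  have e1 : ∀ y, columnDeviation T F c y
      = (∑ p ∈ T ×ˢ T, (D p.1 * D p.2) y) / (T.card : ℝ) ^ 2 := fun y => by
    have : ∑ p ∈ T ×ˢ T, (D p.1 * D p.2) y = (∑ h ∈ T, (F (fun g => y (g, h)) - c)) ^ 2 := by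
      rw [sq, Finset.sum_mul_sum, Finset.sum_product]
      rfl
    rw [this, Finset.sum_sub_distrib, Finset.sum_const, nsmul_eq_mul, ← div_pow, sub_div,
      mul_div_cancel_left₀ _ hcard]
    rfl
  have e2 : ∀ h h', h ≠ h' → ∫ y, (D h * D h') y ∂(powLaw H ν : Measure (G × H → 𝒳)) = 0 :=
    fun h h' hh => by
      have := integral_prod_powLaw ν (I := H) (J := Bool) (e := fun b => cond b h h')
        (by intro a b hab; cases a <;> cases b <;> simp_all [eq_comm])
        (F := fun _ x => F x - c) fun _ => F.continuous.measurable.sub_const c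
      simp only [Fintype.prod_bool, cond_true, cond_false] at this
      refine this.trans ?_
      rw [integral_sub hintF (integrable_const c)]
      simp [hc]
  have e3 : ∀ h, ∫ y, (D h * D h) y ∂(powLaw H ν : Measure (G × H → 𝒳)) ≤ (2 * ‖F‖) ^ 2 :=
    fun h => by
      have hb : ∀ y, (D h * D h) y ≤ (2 * ‖F‖) ^ 2 := fun y => by
        change (F (fun g => y (g, h)) - c) * (F (fun g => y (g, h)) - c) ≤ _
        rw [← sq, ← sq_abs]
        refine pow_le_pow_left₀ (abs_nonneg _) ((abs_sub _ _).trans ?_) 2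
        have := F.norm_coe_le_norm fun g => y (g, h)
        rw [Real.norm_eq_abs] at this
        linarith
      refine (integral_mono (hint _) (integrable_const _) hb).trans ?_
      simp
  simp only [e1]
  rw [integral_div, integral_finsetSum _ fun p _ => hint _, Finset.sum_product]
  have e4 : ∀ h ∈ T, ∑ h' ∈ T, ∫ y, (D h * D h') y ∂(powLaw H ν : Measure (G × H → 𝒳))
      ≤ (2 * ‖F‖) ^ 2 := fun h hh => by
    rw [Finset.sum_eq_single_of_mem h hh fun h' _ hn => e2 h h' hn.symm]
    exact e3 h
  refine (div_le_div_of_nonneg_right (Finset.sum_le_sum e4) (sq_nonneg _)).trans ?_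
  rw [Finset.sum_const, nsmul_eq_mul, sq (T.card : ℝ), mul_div_mul_left _ _ hcard]

variable [Group G] [Group H]

/-- Moving `w` by `τ h` permutes the columns, so the mean over a random column equals the mean of
averages over `T`. Cauchy-Schwarz then bounds the squared deviation. -/
theorem sq_integral_columnLaw_le {V W : Type*} [Fintype V] [Fintype W] [Nonempty W]
    (σ : G → Equiv.Perm V) (τ : H → Equiv.Perm W) (X : Finset (V × W → 𝒳)) [Nonempty X]
    {T : Finset H} (hT : T.Nonempty) (F : C(G → 𝒳, ℝ)) (c : ℝ) (v : V) :
    (∫ y, F (pullbackName σ v y) ∂(columnLaw X : Measure (V → 𝒳)) - c) ^ 2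
      ≤ (∑ p : X × W, columnDeviation T F c (fun k => p.1.1 (σ k.1 v, τ k.2 p.2)))
        / Fintype.card (X × W) := by
  have hN : (Fintype.card (X × W) : ℝ) ≠ 0 := by exact_mod_cast Fintype.card_ne_zero
  have hcard : (T.card : ℝ) ≠ 0 := by exact_mod_cast hT.card_pos.ne'
  have e1 : ∀ h, ∑ p : X × W, F (fun g => p.1.1 (σ g v, τ h p.2))
      = ∑ p : X × W, F (fun g => p.1.1 (σ g v, p.2)) := fun h =>
    Fintype.sum_equiv (Equiv.prodCongr (Equiv.refl X) (τ h)) _ _ fun p => rfl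
  have e2 : ∫ y, F (pullbackName σ v y) ∂(columnLaw X : Measure (V → 𝒳)) - c
      = (∑ p : X × W, ((∑ h ∈ T, F fun g => p.1.1 (σ g v, τ h p.2)) / T.card - c))
        / Fintype.card (X × W) := by
    have h1 := integral_uniformLaw (fun (p : X × W) v => p.1.1 (v, p.2))
      fun y : V → 𝒳 => F (pullbackName σ v y)
    refine (congrArg (· - c) h1).trans ?_
    rw [Finset.sum_sub_distrib, ← Finset.sum_div, Finset.sum_comm]
    simp only [e1]
    rw [Finset.sum_const, Finset.sum_const, nsmul_eq_mul, nsmul_eq_mul,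
      mul_div_cancel_left₀ _ hcard, Finset.card_univ, sub_div, mul_div_cancel_left₀ _ hN]
    rfl
  rw [e2, div_pow, div_le_div_iff₀ (by positivity) (by positivity)]
  have h2 := sq_sum_le_card_mul_sum_sq (s := (Finset.univ : Finset (X × W)))
    (f := fun p => ((∑ h ∈ T, F fun g => p.1.1 (σ g v, τ h p.2)) / T.card - c))
  rw [Finset.card_univ] at h2
  calc _ ≤ _ := mul_le_mul_of_nonneg_right h2 (Nat.cast_nonneg _)
    _ = _ := by
      change _ = (∑ p : X × W, ((∑ h ∈ T, F fun g => p.1.1 (σ g v, τ h p.2)) / T.card - c) ^ 2) * _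
      ring

variable [Infinite H] {V W : ℕ → Type*} [∀ n, Fintype (V n)] [∀ n, Nonempty (V n)]
  [∀ n, Fintype (W n)] [∀ n, Nonempty (W n)] {σ : ∀ n, G → Equiv.Perm (V n)}
  {τ : ∀ n, H → Equiv.Perm (W n)}

/-- If the elements of `X n` are good models of a power, then the random columns converge
locally weak* to the base. -/
theorem tendsto_columnLaw {ν : ProbabilityMeasure (G → 𝒳)}
    {X : ∀ n, Finset (V n × W n → 𝒳)} [∀ n, Nonempty (X n)]
    (hX : ∀ 𝒪 ∈ 𝓝 (powLaw H ν), ∀ᶠ n in atTop, ∀ x ∈ X n, empirical (soficProd σ τ n) x ∈ 𝒪) :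
    Tendsto (fun a : Σ n, V n =>
        (columnLaw (X a.1)).map (measurable_pullbackName (σ a.1) a.2).aemeasurable) (whp V)
      (𝓝 ν) := by
  refine tendsto_of_cylFun fun E f => ?_
  set F := cylFun E f
  set c := ∫ x, F x ∂(ν : Measure (G → 𝒳)) with hc
  have key : Tendsto (fun n => (∑ v : V n, (∫ y, F (pullbackName (σ n) v y)
      ∂(columnLaw (X n) : Measure (V n → 𝒳)) - c) ^ 2) / Fintype.card (V n)) atTop (𝓝 0) := by
    rw [Metric.tendsto_nhds]
    intro ε hε
    -- The infinite group supplies a set `T` so large that the variance bound drops below `ε`.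
    obtain ⟨N, hN⟩ := exists_nat_gt ((2 * ‖F‖) ^ 2 / ε)
    have hN0 : (0 : ℝ) < N := lt_of_le_of_lt (by positivity) hN
    obtain ⟨T, hT⟩ := Infinite.exists_subset_card_eq H N
    have hTn : T.Nonempty := Finset.card_pos.1 (by rw [hT]; exact_mod_cast hN0)
    have hlim : ∫ y, columnDeviation T F c y ∂(powLaw H ν : Measure (G × H → 𝒳)) < ε := by
      refine (integral_columnDeviation_le hTn F ν).trans_lt ?_
      rw [hT, div_lt_iff₀ hN0, mul_comm ε]
      exact (div_lt_iff₀ hε).1 hN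
    filter_upwards [hX _ ((tendsto_integral_of_tendsto tendsto_id (columnDeviation T F c)).eventually
      (gt_mem_nhds hlim))] with n hn
    have hnn : ∀ v : V n, 0 ≤ (∫ y, F (pullbackName (σ n) v y)
      ∂(columnLaw (X n) : Measure (V n → 𝒳)) - c) ^ 2 := fun v => sq_nonneg _
    have hV : (0 : ℝ) < Fintype.card (V n) := by exact_mod_cast Fintype.card_pos
    have hW : (0 : ℝ) < Fintype.card (W n) := by exact_mod_cast Fintype.card_pos
    have hXc : (0 : ℝ) < Fintype.card (X n) := by exact_mod_cast Fintype.card_pos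
    rw [Real.dist_0_eq_abs, abs_of_nonneg (div_nonneg (Finset.sum_nonneg fun v _ => hnn v)
      hV.le), div_lt_iff₀ hV]
    refine (Finset.sum_le_sum fun v _ => sq_integral_columnLaw_le (σ n) (τ n) (X n) hTn F c
      v).trans_lt ?_
    rw [← Finset.sum_div, div_lt_iff₀ (by exact_mod_cast Fintype.card_pos)]
    -- Summed over `v`, the bounds become averages over `V n × W n` of a test function of names,
    -- which goodness of each model controls.
    have e1 : ∑ v : V n, ∑ p : X n × W n,
        columnDeviation T F c (fun k => p.1.1 (σ n k.1 v, τ n k.2 p.2))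
        = ∑ x : X n, ∑ p : V n × W n,
          columnDeviation T F c (pullbackName (soficProd σ τ n) p x.1) := by
      rw [Finset.sum_comm, Fintype.sum_prod_type]
      refine Finset.sum_congr rfl fun x _ => ?_
      rw [Finset.sum_comm, Fintype.sum_prod_type]
      rfl
    rw [e1]
    have e2 : ∀ x : X n, ∑ p : V n × W n,
        columnDeviation T F c (pullbackName (soficProd σ τ n) p x.1)
        < ε * (Fintype.card (V n) * Fintype.card (W n)) := fun x => by
      have := hn x.1 x.2
      change ∫ y, columnDeviation T F c y ∂(empirical (soficProd σ τ n) x.1 : Measure _) < ε at this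
      rw [integral_empirical, div_lt_iff₀ (by exact_mod_cast Fintype.card_pos),
        Fintype.card_prod] at this
      exact_mod_cast this
    refine (Finset.sum_lt_sum_of_nonempty Finset.univ_nonempty fun x _ => e2 x).trans_eq ?_
    rw [Finset.sum_const, Finset.card_univ, nsmul_eq_mul, Fintype.card_prod]
    push_cast
    ring
  have h1 := tendsto_whp_of_average (V := V) (f := fun a => (∫ y, F (pullbackName (σ a.1) a.2 y)
      ∂(columnLaw (X a.1) : Measure (V a.1 → 𝒳)) - c) ^ 2) (fun a => sq_nonneg _) key
  have h2 := h1.sqrt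
  simp only [Real.sqrt_sq_eq_abs, Real.sqrt_zero] at h2
  have h3 := ((tendsto_zero_iff_abs_tendsto_zero _).2 h2).add_const c
  rw [zero_add] at h3
  refine h3.congr fun a => ?_
  rw [ProbabilityMeasure.toMeasure_map,
    integral_map (φ := pullbackName (σ a.1) a.2)
      (f := fun y => F y) (measurable_pullbackName _ _).aemeasurable
      F.continuous.measurable.aestronglyMeasurable]
  ring

end Columns

/-! ### Finite entropy estimates -/

section FiniteEntropy

variable {ι B W : Type*} [Fintype ι] [Fintype B] [Fintype W]

theorem sum_prod_mul_apply [DecidableEq W] {p : B → ℝ} (hp : ∑ b, p b = 1) (g : B → ℝ) (w : W) :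
    ∑ z : W → B, (∏ w', p (z w')) * g (z w) = ∑ b, p b * g b := by
  have h := Fintype.prod_sum fun (w' : W) (b : B) => p b * if w' = w then g b else 1
  rw [← Finset.mul_prod_erase _ _ (Finset.mem_univ w)] at h
  have h1 : ∏ w' ∈ Finset.univ.erase w, ∑ b, p b * (if w' = w then g b else 1) = 1 :=
    Finset.prod_eq_one fun w' hw' => by simp [Finset.ne_of_mem_erase hw', hp]
  rw [h1, mul_one] at h
  simp only [if_true] at h
  rw [h]
  refine Finset.sum_congr rfl fun z _ => ?_
  rw [Finset.prod_mul_distrib, Finset.prod_ite_eq' Finset.univ w fun w' => g (z w')]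
  simp

theorem sum_negMulLog_prod [DecidableEq W] {p : B → ℝ} (hp : ∑ b, p b = 1) :
    ∑ z : W → B, Real.negMulLog (∏ w, p (z w))
      = Fintype.card W * ∑ b, Real.negMulLog (p b) := by
  have h1 : ∀ z : W → B, Real.negMulLog (∏ w, p (z w))
      = ∑ w, (∏ w', p (z w')) * (-Real.log (p (z w))) := fun z => by
    rw [← Finset.mul_sum, Finset.sum_neg_distrib]
    -- A word containing a letter of weight zero contributes nothing to either side.
    by_cases h : ∃ w, p (z w) = 0
    · obtain ⟨w, hw⟩ := h
      rw [Finset.prod_eq_zero (Finset.mem_univ w) hw]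
      simp
    · push Not at h
      rw [← Real.log_prod fun w _ => h w, Real.negMulLog]
      ring
  simp only [h1]
  rw [Finset.sum_comm]
  simp only [sum_prod_mul_apply hp fun b => -Real.log (p b)]
  rw [Finset.sum_const, Finset.card_univ, nsmul_eq_mul]
  simp [Real.negMulLog]

/-- This is `log x ≤ x - 1` at `x = 1 / (K t)`. Summed over at most `K` points, it gives the usual
entropy bound with an error of at most one. -/
theorem negMulLog_le {t K : ℝ} (ht : 0 ≤ t) (hK : 0 < K) :
    Real.negMulLog t ≤ t * Real.log K + 1 / K - t := by
  rcases ht.eq_or_lt with rfl | ht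
  · simpa using hK.le
  · have h := Real.log_le_sub_one_of_pos (x := (K * t)⁻¹) (by positivity)
    rw [Real.log_inv, Real.log_mul hK.ne' ht.ne'] at h
    have h2 := mul_le_mul_of_nonneg_left h ht.le
    have h3 : t * ((K * t)⁻¹ - 1) = 1 / K - t := by field_simp
    rw [h3] at h2
    rw [Real.negMulLog]
    linarith

theorem sum_negMulLog_le {α : Type*} {S : Finset α} {Q : α → ℝ} (hQ : ∀ z, 0 ≤ Q z) {K : ℝ}
    (hK : 0 < K) (hSK : S.card ≤ K) :
    ∑ z ∈ S, Real.negMulLog (Q z) ≤ (∑ z ∈ S, Q z) * Real.log K + 1 := by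
  have h : ∑ z ∈ S, Real.negMulLog (Q z) ≤ ∑ z ∈ S, (Q z * Real.log K + 1 / K) :=
    Finset.sum_le_sum fun z _ => (negMulLog_le (hQ z) hK).trans (by linarith [hQ z])
  refine h.trans ?_
  rw [Finset.sum_add_distrib, ← Finset.sum_mul, Finset.sum_const, nsmul_eq_mul, mul_one_div]
  gcongr
  exact (div_le_one hK).2 hSK

/-- A family of distinct words is not much larger than a set carrying most of the power of the
distribution of a random letter of a random word. -/
theorem log_card_le_of_powers [DecidableEq W] [Nonempty ι] [Nonempty W] {D : ι → W → B}
    (hD : Function.Injective D) {p : B → ℝ}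
    (hp : ∀ g : B → ℝ, ∑ b, p b * g b = (∑ i : ι × W, g (D i.1 i.2)) / Fintype.card (ι × W))
    {S : Finset (W → B)} {ε : ℝ} (hε : ε < 1) (hS : 1 - ε ≤ ∑ z ∈ S, ∏ w, p (z w)) :
    Real.log (Fintype.card ι) ≤
      Real.log S.card + ε * (Fintype.card W * Real.log (Fintype.card B)) + 2 := by
  classical
  have hι : (0 : ℝ) < Fintype.card ι := by exact_mod_cast Fintype.card_pos
  have hW : (0 : ℝ) < Fintype.card W := by exact_mod_cast Fintype.card_pos
  have hB : 0 < Fintype.card B :=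
    Fintype.card_pos_iff.2 ⟨D (Classical.arbitrary ι) (Classical.arbitrary W)⟩
  have hpb : ∀ b, p b = (∑ i : ι × W, if D i.1 i.2 = b then (1 : ℝ) else 0)
      / Fintype.card (ι × W) := fun b => by
    rw [← hp fun b' => if b' = b then 1 else 0]
    simp
  have hp0 : ∀ b, 0 ≤ p b := fun b => by
    rw [hpb]
    exact div_nonneg (Finset.sum_nonneg fun i _ => by split_ifs <;> norm_num) (Nat.cast_nonneg _)
  have hppos : ∀ i w, 0 < p (D i w) := fun i w => by
    rw [hpb]
    refine div_pos ?_ (by exact_mod_cast Fintype.card_pos)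
    refine Finset.sum_pos' (fun i _ => by split_ifs <;> norm_num) ⟨(i, w), Finset.mem_univ _, ?_⟩
    simp
  have hp1 : ∑ b, p b = 1 := by
    have := hp fun _ => 1
    simpa using this
  set Q : (W → B) → ℝ := fun z => ∏ w, p (z w) with hQ
  have hQ0 : ∀ z, 0 ≤ Q z := fun z => Finset.prod_nonneg fun w _ => hp0 _
  have hQ1 : ∑ z, Q z = 1 := by
    rw [← Fintype.prod_sum fun (_ : W) b => p b]
    simp [hp1]
  -- Subadditivity of entropy: the mean of `-log (Q (D i))` is exactly the entropy of the product
  -- weight `Q`. Since the words are distinct, their `Q`-weights sum to at most one, and Gibbs'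
  -- inequality bounds this mean below by `log |ι|`.
  have hlow : Fintype.card ι * Real.log (Fintype.card ι)
      ≤ Fintype.card ι * (Fintype.card W * ∑ b, Real.negMulLog (p b)) := by
    have h1 : ∑ b, Real.negMulLog (p b) = (∑ i : ι × W, -Real.log (p (D i.1 i.2)))
        / Fintype.card (ι × W) := by
      rw [← hp fun b => -Real.log (p b)]
      simp [Real.negMulLog]
    have h2 : ∑ i : ι × W, -Real.log (p (D i.1 i.2)) = ∑ i, -Real.log (Q (D i)) := by
      rw [Fintype.sum_prod_type]
      refine Finset.sum_congr rfl fun i _ => ?_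
      rw [hQ, Real.log_prod fun w _ => (hppos i w).ne', Finset.sum_neg_distrib]
    rw [h1, h2, Fintype.card_prod]
    push_cast
    have h3 : (Fintype.card ι : ℝ) * (Fintype.card W * ((∑ i, -Real.log (Q (D i)))
        / (Fintype.card ι * Fintype.card W))) = ∑ i, -Real.log (Q (D i)) := by
      field_simp
    rw [h3, ← sub_nonneg, ← nsmul_eq_mul, ← Finset.card_univ, ← Finset.sum_const,
      ← Finset.sum_sub_distrib, ← neg_nonpos, ← Finset.sum_neg_distrib]
    have h4 : ∀ i, -(-Real.log (Q (D i)) - Real.log (Fintype.card ι))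
        ≤ Fintype.card ι * Q (D i) - 1 := fun i => by
      have hQi : 0 < Q (D i) := Finset.prod_pos fun w _ => hppos i w
      have := Real.log_le_sub_one_of_pos (mul_pos hι hQi)
      rw [Real.log_mul hι.ne' hQi.ne'] at this
      linarith
    have h5 : ∑ i, Q (D i) ≤ 1 := by
      rw [← hQ1, ← Finset.sum_image (s := Finset.univ) (g := D) (f := Q) fun i _ j _ h => hD h]
      exact Finset.sum_le_sum_of_subset_of_nonneg (Finset.subset_univ _) fun z _ _ => hQ0 z
    rw [Finset.card_univ]
    refine (Finset.sum_le_sum fun i _ => h4 i).trans ?_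
    rw [Finset.sum_sub_distrib, ← Finset.mul_sum]
    simp only [Finset.sum_const, Finset.card_univ, nsmul_eq_mul, mul_one]
    nlinarith
  have hlow' := le_of_mul_le_mul_left hlow hι
  have hSpos : 0 < S.card := by
    rw [Finset.card_pos]
    by_contra hc
    rw [Finset.not_nonempty_iff_eq_empty.1 hc, Finset.sum_empty] at hS
    linarith
  have hS1 : (1 : ℝ) ≤ S.card := by exact_mod_cast hSpos
  -- The entropy is split between `S` and its complement, the latter of weight at most `ε` among
  -- `|B| ^ |W|` words. Each part adds an error of one, hence the constant `2`.
  have hupS := sum_negMulLog_le (S := S) hQ0 (K := S.card) (by linarith) le_rfl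
  have hupC := sum_negMulLog_le (S := Sᶜ) hQ0 (K := (Fintype.card B : ℝ) ^ Fintype.card W)
    (by positivity) (by
      have : Sᶜ.card ≤ Fintype.card (W → B) := Finset.card_le_univ _
      rw [Fintype.card_fun] at this
      exact_mod_cast this)
  have hsum := Finset.sum_add_sum_compl S Q
  have hent := Finset.sum_add_sum_compl S fun z => Real.negMulLog (Q z)
  rw [sum_negMulLog_prod hp1] at hent
  rw [Real.log_pow] at hupC
  rw [hQ1] at hsum
  have hlogS : 0 ≤ Real.log S.card := Real.log_nonneg hS1
  have hlogB : 0 ≤ (Fintype.card W : ℝ) * Real.log (Fintype.card B) :=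
    mul_nonneg hW.le (Real.log_nonneg (by exact_mod_cast hB))
  have hS' : ∑ z ∈ Sᶜ, Q z ≤ ε := by
    change 1 - ε ≤ ∑ z ∈ S, Q z at hS
    linarith
  have hS'' : ∑ z ∈ S, Q z ≤ 1 := by
    linarith [Finset.sum_nonneg fun z (_ : z ∈ Sᶜ) => hQ0 z]
  have b1 := mul_le_mul_of_nonneg_right hS'' hlogS
  have b2 := mul_le_mul_of_nonneg_right hS' hlogB
  linarith

/-- The sum factorizes over coordinates, and each factor is at most `1 + |A| exp (-l) ≤ exp (|A| exp
(-l))`. -/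
theorem sum_exp_hammingDist_le {U A : Type*} [Fintype U] [Fintype A] [DecidableEq U]
    [DecidableEq A] (z₀ : U → A) (l : ℝ) :
    ∑ z : U → A, Real.exp (-l * hammingDist z z₀)
      ≤ Real.exp (Fintype.card U * (Fintype.card A * Real.exp (-l))) := by
  have h1 : ∀ z : U → A, Real.exp (-l * hammingDist z z₀)
      = ∏ u, (if z u ≠ z₀ u then Real.exp (-l) else 1) := fun z => by
    rw [Finset.prod_ite, Finset.prod_const, Finset.prod_const_one, mul_one, ← Real.exp_nat_mul,
      mul_comm]
    rfl
  simp only [h1]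
  rw [← Fintype.prod_sum fun (u : U) (a : A) => if a ≠ z₀ u then Real.exp (-l) else 1,
    Real.exp_nat_mul, ← Finset.card_univ (α := U), ← Finset.prod_const]
  have h2 : ∀ a a₀ : A, 0 ≤ (if a ≠ a₀ then Real.exp (-l) else 1) := fun a a₀ => by
    split_ifs
    · exact (Real.exp_pos _).le
    · exact zero_le_one
  have h3 : ∀ a a₀ : A, (if a ≠ a₀ then Real.exp (-l) else 1)
      ≤ Real.exp (-l) + if a = a₀ then 1 else 0 := fun a a₀ => by
    by_cases h : a = a₀
    · simp [h, Real.exp_nonneg]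
    · simp [h]
  refine Finset.prod_le_prod (fun u _ => Finset.sum_nonneg fun a _ => h2 a _) fun u _ => ?_
  refine (Finset.sum_le_sum fun a _ => h3 a _).trans ?_
  rw [Finset.sum_add_distrib, Finset.sum_const, Finset.card_univ, nsmul_eq_mul,
    Finset.sum_ite_eq' Finset.univ (z₀ u) fun _ => (1 : ℝ), if_pos (Finset.mem_univ _)]
  exact Real.add_one_le_exp _

/-- The exponential bound for the size of a Hamming ball. -/
theorem card_hammingBall_le {U A : Type*} [Fintype U] [Fintype A] [DecidableEq U] [DecidableEq A]
    (z₀ : U → A) (r : ℝ) {l : ℝ} (hl : 0 ≤ l) {S : Finset (U → A)}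
    (hS : ∀ z ∈ S, (hammingDist z z₀ : ℝ) ≤ r) :
    (S.card : ℝ) ≤ Real.exp (l * r + Fintype.card U * (Fintype.card A * Real.exp (-l))) := by
  have h1 : ∀ z ∈ S, Real.exp (-l * r) ≤ Real.exp (-l * hammingDist z z₀) := fun z hz => by
    have := mul_le_mul_of_nonneg_left (hS z hz) hl
    exact Real.exp_le_exp.2 (by linarith)
  have h2 := (Finset.card_nsmul_le_sum S _ _ h1).trans
    ((Finset.sum_le_sum_of_subset_of_nonneg (Finset.subset_univ S)
      fun z _ _ => (Real.exp_pos _).le).trans (sum_exp_hammingDist_le z₀ l))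
  rw [nsmul_eq_mul] at h2
  have h3 := mul_le_mul_of_nonneg_right h2 (Real.exp_pos (l * r)).le
  rw [mul_assoc, ← Real.exp_add, ← Real.exp_add, neg_mul, neg_add_cancel, Real.exp_zero,
    mul_one, add_comm] at h3
  exact h3

end FiniteEntropy

/-! ### Covering numbers of powers -/

section PowerCovering

theorem lt_log_of_lt_expRate {U : Type*} [Fintype U] [Nonempty U] {a : ℝ} {N : ℕ}
    (h : (a : EReal) < expRate U N) : 0 < N ∧ a * Fintype.card U < Real.log N := by
  have hU : (0 : EReal) < Fintype.card U := by exact_mod_cast Fintype.card_pos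
  rw [expRate, EReal.lt_div_iff hU (EReal.natCast_ne_top _)] at h
  rcases Nat.eq_zero_or_pos N with rfl | hN
  · simp at h
  · refine ⟨hN, ?_⟩
    rw [ENNReal.log_pos_real' (by simpa using hN)] at h
    simp only [ENat.toENNReal_coe, ENNReal.toReal_natCast] at h
    exact_mod_cast h

theorem le_expRate {U : Type*} [Fintype U] [Nonempty U] {b : ℝ} {N : ℕ∞}
    (h : ENNReal.ofReal (Real.exp (b * Fintype.card U)) ≤ N) : (b : EReal) ≤ expRate U N := by
  have hU : (0 : EReal) < Fintype.card U := by exact_mod_cast Fintype.card_pos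
  rw [expRate, EReal.le_div_iff_mul_le hU (EReal.natCast_ne_top _)]
  refine le_trans (le_of_eq ?_) (ENNReal.log_monotone h)
  rw [ENNReal.log_ofReal_of_pos (Real.exp_pos _), Real.log_exp]
  push_cast
  rfl

theorem le_expRate_covNumMeasure {U : Type*} [Fintype U] [Nonempty U] {α : Type*}
    [MeasurableSpace α] {d : α → α → ℝ} {ε δ b : ℝ} {μ : ProbabilityMeasure α}
    (h : ∀ (Y : Set α), 1 - ε < (μ : Measure α).real Y → ∀ F : Finset α,
      (∀ y ∈ Y, ∃ z ∈ F, d y z < δ) → 0 < F.card ∧ b * Fintype.card U ≤ Real.log F.card) :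
    (b : EReal) ≤ expRate U (covNumMeasure d ε δ μ) := by
  have h1 : (⌈Real.exp (b * Fintype.card U)⌉₊ : ℕ∞) ≤ covNumMeasure d ε δ μ := by
    refine le_iInf₂ fun Y hY => le_iInf₂ fun F hF => ?_
    obtain ⟨h2, h3⟩ := h Y hY F hF.2
    rw [Nat.cast_le, Nat.ceil_le]
    exact (Real.le_log_iff_exp_le (by exact_mod_cast h2)).1 h3
  refine (le_expRate ?_).trans (expRate_mono U h1)
  refine (ENNReal.ofReal_le_ofReal (Nat.le_ceil _)).trans ?_
  rw [ENNReal.ofReal_natCast]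
  rfl

/-- Used to thin a set of models to one for each colouring; if equal colours mean closeness, the
representatives still form a net. -/
theorem exists_representatives {α β : Type*} [Finite β] (f : α → β) (Y : Set α) :
    ∃ X : Finset α, (X : Set α) ⊆ Y ∧ Set.InjOn f X ∧ ∀ y ∈ Y, ∃ x ∈ X, f x = f y := by
  obtain ⟨s, hs, hb⟩ := Set.exists_subset_bijOn Y f
  have hfin : s.Finite := Set.Finite.of_injOn (hb.mapsTo) hb.injOn (Set.toFinite _)
  refine ⟨hfin.toFinset, by simpa using hs, by simpa using hb.injOn, fun y hy => ?_⟩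
  obtain ⟨x, hx, hxy⟩ := hb.surjOn (Set.mem_image_of_mem f hy)
  exact ⟨x, by simpa using hx, hxy⟩

variable {V W 𝒳 A : Type*} [Fintype V] [Fintype W] [Nonempty V] [Nonempty W] [MetricSpace 𝒳]
  [MeasurableSpace 𝒳] [BorelSpace 𝒳] [Fintype A]

theorem measureReal_powLaw {B : Type*} [MeasurableSpace B] [MeasurableSingletonClass B]
    (q : ProbabilityMeasure (V → 𝒳)) {C : (V → 𝒳) → B} (hC : Measurable C) (z : W → B) :
    (powLaw W q : Measure (V × W → 𝒳)).real {x | ∀ w, C (fun v => x (v, w)) = z w}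
      = ∏ w, (q : Measure (V → 𝒳)).real (C ⁻¹' {z w}) := by
  have hT : MeasurableSet {x : V × W → 𝒳 | ∀ w, C (fun v => x (v, w)) = z w} := by
    rw [Set.ofPred_forall]
    exact MeasurableSet.iInter fun w => (hC.comp (measurable_pi_lambda _ fun v =>
      measurable_pi_apply (v, w))) (measurableSet_singleton (z w))
  rw [toMeasure_powLaw, map_measureReal_apply measurable_uncurrySwap hT]
  have : (fun (y : W → V → 𝒳) (p : V × W) => y p.2 p.1) ⁻¹'
      {x : V × W → 𝒳 | ∀ w, C (fun v => x (v, w)) = z w}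
      = Set.pi (Finset.univ : Finset W) fun w => C ⁻¹' {z w} := by
    ext y
    simp [Set.mem_pi]
  rw [this, measureReal_def, Measure.infinitePi_pi (fun _ : W => (q : Measure (V → 𝒳)))
    fun w _ => hC (measurableSet_singleton (z w)), ENNReal.toReal_prod]
  rfl

theorem sum_measureReal_columnLaw {B : Type*} [Fintype B] [MeasurableSpace B]
    [MeasurableSingletonClass B] (X : Finset (V × W → 𝒳)) [Nonempty X] {C : (V → 𝒳) → B}
    (hC : Measurable C) (g : B → ℝ) :
    ∑ b, (columnLaw X : Measure (V → 𝒳)).real (C ⁻¹' {b}) * g b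
      = (∑ i : X × W, g (C fun v => i.1.1 (v, i.2))) / Fintype.card (X × W) := by
  have h1 := integral_uniformLaw (fun (p : X × W) v => p.1.1 (v, p.2)) fun y : V → 𝒳 => g (C y)
  refine Eq.trans ?_ h1
  have hg : Measurable g := measurable_of_countable g
  have h2 := integral_map (μ := (columnLaw X : Measure (V → 𝒳))) (φ := C) (f := g)
    hC.aemeasurable hg.aestronglyMeasurable
  refine Eq.trans ?_ h2
  have : IsProbabilityMeasure (Measure.map C (columnLaw X : Measure (V → 𝒳))) :=
    Measure.isProbabilityMeasure_map hC.aemeasurable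
  rw [integral_fintype (Integrable.of_finite)]
  refine Finset.sum_congr rfl fun b _ => ?_
  rw [map_measureReal_apply hC (measurableSet_singleton b), smul_eq_mul]

/-- Lower bound for the coverings of a large set by the power of the column distribution of a
set of models with distinct discretizations. -/
theorem log_card_le_of_cover {c : 𝒳 → A} {η : ℝ} (hη : 0 < η)
    (hc : ∀ x y, dist x y < η → c x = c y) {X : Finset (V × W → 𝒳)} [Nonempty X]
    (hX : Set.InjOn (fun (x : V × W → 𝒳) u => c (x u)) X) {ε l ρ : ℝ} (hε : ε < 1) (hl : 0 ≤ l)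
    (hρ : 0 ≤ ρ) {Y : Set (V × W → 𝒳)}
    (hY : 1 - ε < (powLaw W (columnLaw X) : Measure (V × W → 𝒳)).real Y)
    {F : Finset (V × W → 𝒳)} (hF : ∀ y ∈ Y, ∃ z ∈ F, hammingAvg y z < ρ * η) :
    0 < F.card ∧ Real.log X.card ≤ Real.log F.card + Fintype.card (V × W) *
      (l * ρ + Fintype.card A * Real.exp (-l) + ε * Real.log (Fintype.card A)) + 2 := by
  classical
  let : MeasurableSpace A := ⊤
  have : DiscreteMeasurableSpace A := ⟨fun _ => trivial⟩
  have hcm : Measurable c := measurable_to_countable' fun a => by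
    refine (Metric.isOpen_iff.2 fun x hx => ⟨η, hη, fun y hy => ?_⟩).measurableSet
    exact (hc y x hy).trans hx
  have hC : Measurable fun (y : V → 𝒳) v => c (y v) :=
    measurable_pi_lambda _ fun v => hcm.comp (measurable_pi_apply v)
  have hU : (0 : ℝ) < Fintype.card (V × W) := by exact_mod_cast Fintype.card_pos
  have hFpos : 0 < F.card := by
    by_contra hc0
    have hY0 : Y = ∅ := Set.eq_empty_iff_forall_notMem.2 fun y hy => by
      obtain ⟨z, hz, -⟩ := hF y hy
      exact hc0 (Finset.card_pos.2 ⟨z, hz⟩)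
    rw [hY0, measureReal_empty] at hY
    linarith
  refine ⟨hFpos, ?_⟩
  -- Each disagreement of colours costs distance at least `η`, so average distance below `ρ * η`
  -- leaves at most a proportion `ρ` of disagreements.
  let ball : (V × W → 𝒳) → Finset (W → V → A) := fun x₀ => Finset.univ.filter fun z =>
    (hammingDist (fun u : V × W => z u.2 u.1) (fun u => c (x₀ u)) : ℝ) ≤ ρ * Fintype.card (V × W)
  have hball : ∀ x₀, ((ball x₀).card : ℝ) ≤ Real.exp (Fintype.card (V × W) *
      (l * ρ + Fintype.card A * Real.exp (-l))) := fun x₀ => by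
    have hinj : Function.Injective fun (z : W → V → A) (u : V × W) => z u.2 u.1 := fun z z' h => by
      funext w v
      exact congrFun h (v, w)
    rw [← Finset.card_image_of_injective _ hinj]
    refine (card_hammingBall_le (fun u => c (x₀ u)) (ρ * Fintype.card (V × W)) hl
      fun z hz => ?_).trans (le_of_eq (congrArg Real.exp (by ring)))
    obtain ⟨z', hz', rfl⟩ := Finset.mem_image.1 hz
    exact (Finset.mem_filter.1 hz').2
  let S : Finset (W → V → A) := F.biUnion ball
  have hScard : (S.card : ℝ) ≤ F.card * Real.exp (Fintype.card (V × W) *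
      (l * ρ + Fintype.card A * Real.exp (-l))) := by
    have h1 : (S.card : ℝ) ≤ ∑ x₀ ∈ F, ((ball x₀).card : ℝ) := by
      exact_mod_cast Finset.card_biUnion_le
    refine h1.trans ((Finset.sum_le_sum fun x₀ _ => hball x₀).trans_eq ?_)
    rw [Finset.sum_const, nsmul_eq_mul]
  have hYS : Y ⊆ ⋃ z ∈ S, {x : V × W → 𝒳 | ∀ w, (fun v => c (x (v, w))) = z w} := by
    intro y hy
    obtain ⟨x₀, hx₀, hd⟩ := hF y hy
    refine Set.mem_iUnion₂.2 ⟨fun w v => c (y (v, w)), Finset.mem_biUnion.2 ⟨x₀, hx₀,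
      Finset.mem_filter.2 ⟨Finset.mem_univ _, ?_⟩⟩, fun w => rfl⟩
    rw [hammingAvg, div_lt_iff₀ hU] at hd
    have h1 : ∀ u ∈ Finset.univ.filter fun u : V × W => c (y u) ≠ c (x₀ u),
        η ≤ dist (y u) (x₀ u) := fun u hu => by
      by_contra hlt
      exact (Finset.mem_filter.1 hu).2 (hc _ _ (not_le.1 hlt))
    have h2 := (Finset.card_nsmul_le_sum _ _ _ h1).trans
      (Finset.sum_le_sum_of_subset_of_nonneg (Finset.filter_subset _ _)
        fun u _ _ => dist_nonneg)
    rw [nsmul_eq_mul] at h2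
    have h3 : (hammingDist (fun u => c (y u)) (fun u => c (x₀ u)) : ℝ) * η
        ≤ ρ * Fintype.card (V × W) * η := by
      refine le_trans h2 (hd.le.trans (le_of_eq (by ring)))
    exact le_of_mul_le_mul_right h3 hη
  have hS : 1 - ε ≤ ∑ z ∈ S, ∏ w, (columnLaw X : Measure (V → 𝒳)).real
      ((fun (y : V → 𝒳) v => c (y v)) ⁻¹' {z w}) := by
    refine hY.le.trans ((measureReal_mono hYS (measure_ne_top _ _)).trans
      ((measureReal_biUnion_finset_le _ _).trans_eq (Finset.sum_congr rfl fun z _ => ?_)))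
    exact measureReal_powLaw (columnLaw X) hC z
  -- The letters are whole coloured columns: the alphabet is `V → A`, and the words are indexed by
  -- `W`.
  have hmain := log_card_le_of_powers (ι := X) (D := fun x w v => c (x.1 (v, w)))
    (fun x x' h => Subtype.ext (hX x.2 x'.2 (funext fun u => congrFun (congrFun h u.2) u.1)))
    (sum_measureReal_columnLaw X hC) hε hS
  have hlogS : Real.log S.card ≤ Real.log F.card + Fintype.card (V × W) *
      (l * ρ + Fintype.card A * Real.exp (-l)) := by
    rcases Nat.eq_zero_or_pos S.card with h0 | h0
    · rw [h0, Nat.cast_zero, Real.log_zero]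
      have := Real.log_natCast_nonneg F.card
      positivity
    · rw [← Real.log_exp (Fintype.card (V × W) * (l * ρ + Fintype.card A * Real.exp (-l))),
        ← Real.log_mul (by exact_mod_cast hFpos.ne') (Real.exp_pos _).ne']
      exact Real.log_le_log (by exact_mod_cast h0) hScard
  rw [Fintype.card_coe, Fintype.card_fun, Nat.cast_pow, Real.log_pow] at hmain
  have hcard : (Fintype.card (V × W) : ℝ) = Fintype.card V * Fintype.card W := by
    rw [Fintype.card_prod]
    push_cast
    rfl
  have e : ε * ((Fintype.card W : ℝ) * (Fintype.card V * Real.log (Fintype.card A)))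
      = Fintype.card (V × W) * (ε * Real.log (Fintype.card A)) := by
    rw [hcard]
    ring
  rw [e] at hmain
  linarith

end PowerCovering

/-! ### Sofic entropy of powers -/

/-- Differently coloured good models are numerous, and the power of their column law inherits both
their convergence and the exponential size of the family. -/
theorem MetricProcess.soficEntropy_le_doublyQuenchedEntropy {G : Type u} {H : Type v} [Group G]
    [Group H] [Countable G] [Countable H] [Infinite H] {V W : ℕ → Type*} [∀ n, Fintype (V n)]
    [∀ n, Nonempty (V n)] [∀ n, Fintype (W n)] [∀ n, Nonempty (W n)]
    {σ : ∀ n, G → Equiv.Perm (V n)} {τ : ∀ n, H → Equiv.Perm (W n)}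
    (hτ : IsSoficApproximation τ) (P : MetricProcess.{u'} (G × H))
    {ν : ProbabilityMeasure (G → P.State)} (hν : P.law = powLaw H ν)
    (hdisc : ∀ δ : ℝ, 0 < δ → ∃ (A : Type) (_ : Fintype A) (c : P.State → A),
      (∀ x y, c x = c y → dist x y < δ) ∧ ∃ η > 0, ∀ x y, dist x y < η → c x = c y) :
    P.soficEntropy (soficProd σ τ) ≤ P.doublyQuenchedEntropy (soficProd σ τ) := by
  refine EReal.ge_of_forall_gt_iff_ge.1 fun z hz => ?_
  obtain ⟨a, hza, ha⟩ := EReal.lt_iff_exists_real_btwn.1 hz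
  have hza' : z < a := by exact_mod_cast hza
  simp only [soficEntropy, lt_iSup_iff] at ha
  obtain ⟨δ, hδ, ha⟩ := ha
  obtain ⟨A, hA, c, hcδ, η, hη, hc⟩ := hdisc δ hδ
  obtain ⟨O, hO⟩ := (𝓝 P.law).exists_antitone_basis
  have hfreq : ∀ j, ∃ᶠ n in atTop, (a : EReal) < expRate (V n × W n)
      (covNum hammingAvg δ (goodModels (O j) (soficProd σ τ n))) := fun j =>
    frequently_lt_of_lt_limsup (by isBoundedDefault)
      (ha.trans_le (iInf₂_le (O j) (hO.1.mem_of_mem trivial)))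
  -- Along one subsequence the neighbourhoods shrink to the law while the covering numbers keep the
  -- rate `a`.
  obtain ⟨k, hk, hka⟩ := extraction_forall_of_frequently hfreq
  choose X hXO hXinj hXrep using fun j => exists_representatives
    (fun (x : V (k j) × W (k j) → P.State) u => c (x u))
    (goodModels (O j) (soficProd σ τ (k j)))
  have hXcard : ∀ j, 0 < (X j).card ∧
      a * Fintype.card (V (k j) × W (k j)) < Real.log (X j).card := fun j => by
    refine lt_log_of_lt_expRate ((hka j).trans_le (expRate_mono _ (iInf₂_le (X j)
      ⟨hXO j, fun y hy => ?_⟩)))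
    obtain ⟨x, hx, hxy⟩ := hXrep j y hy
    refine ⟨x, hx, ?_⟩
    rw [hammingAvg, div_lt_iff₀ (by exact_mod_cast Fintype.card_pos), mul_comm]
    refine (Finset.sum_lt_sum_of_nonempty Finset.univ_nonempty fun u _ =>
      hcδ (y u) (x u) (congrFun hxy u).symm).trans_eq ?_
    rw [Finset.sum_const, Finset.card_univ, nsmul_eq_mul]
  have : ∀ j, Nonempty (X j) := fun j => (Finset.card_pos.1 (hXcard j).1).to_subtype
  have hk' : Tendsto k atTop atTop := hk.tendsto_atTop
  have hconv : DoublyQuenchedConv (fun i => soficProd σ τ (k i))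
      (fun j => powLaw (W (k j)) (columnLaw (X j))) P.law := by
    rw [hν]
    refine doublyQuenchedConv_powLaw (V := fun j => V (k j)) (W := fun j => W (k j))
      (σ := fun i => σ (k i)) (τ := fun i => τ (k i)) (hτ.comp hk') ?_
    refine tendsto_columnLaw (V := fun j => V (k j)) (W := fun j => W (k j))
      (σ := fun i => σ (k i)) (τ := fun i => τ (k i)) fun 𝒪 h𝒪 => ?_
    rw [← hν] at h𝒪
    obtain ⟨i, -, hi⟩ := hO.1.mem_iff.1 h𝒪
    filter_upwards [eventually_ge_atTop i] with j hj x hx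
    exact hi (hO.2 hj (hXO j hx))
  -- The loss from `a` to `z` is spent in four quarters: the size term `|A| exp (-l)`, the radius
  -- term `l * ρ`, the entropy `ε log |A|` of the exceptional set, and the constant `2`, absorbed
  -- because `|V × W|` tends to infinity. Thus `l` is chosen before `ρ`.
  set κ := a - z with hκ
  have hκ0 : 0 < κ := sub_pos.2 hza'
  obtain ⟨l, hl0, hl⟩ : ∃ l : ℝ, 0 < l ∧ Fintype.card A * Real.exp (-l) ≤ κ / 4 := by
    have h1 : Tendsto (fun l : ℝ => Fintype.card A * Real.exp (-l)) atTop (𝓝 0) := by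
      simpa using (Real.tendsto_exp_neg_atTop_nhds_zero).const_mul (Fintype.card A : ℝ)
    obtain ⟨l, hl, hl0⟩ := ((h1.eventually (ge_mem_nhds (by positivity : 0 < κ / 4))).and
      (eventually_gt_atTop 0)).exists
    exact ⟨l, hl0, hl⟩
  obtain ⟨ρ, hρ0, hρ⟩ : ∃ ρ : ℝ, 0 < ρ ∧ l * ρ ≤ κ / 4 :=
    ⟨κ / 4 / l, by positivity, (mul_div_cancel₀ _ hl0.ne').le⟩
  have hlogA : 0 ≤ Real.log (Fintype.card A) := Real.log_natCast_nonneg _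
  obtain ⟨ε, hε0, hε1, hε⟩ : ∃ ε : ℝ, 0 < ε ∧ ε < 1 ∧ ε * Real.log (Fintype.card A) ≤ κ / 4 := by
    refine ⟨min (1 / 2) (κ / 4 / (Real.log (Fintype.card A) + 1)), by positivity,
      (min_le_left _ _).trans_lt (by norm_num), ?_⟩
    refine (mul_le_mul_of_nonneg_right (min_le_right _ _) hlogA).trans ?_
    rw [div_mul_eq_mul_div, div_le_iff₀ (by positivity)]
    nlinarith
  have hcardU : ∀ᶠ j in atTop, 2 ≤ κ / 4 * Fintype.card (V (k j) × W (k j)) := by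
    have h1 : Tendsto (fun j => κ / 4 * (Fintype.card (W (k j)) : ℝ)) atTop atTop :=
      (tendsto_natCast_atTop_atTop.comp (hτ.tendsto_card.comp hk')).const_mul_atTop (by positivity)
    filter_upwards [h1.eventually_ge_atTop 2] with j hj
    refine hj.trans (mul_le_mul_of_nonneg_left ?_ (by positivity))
    rw [Fintype.card_prod]
    exact_mod_cast Nat.le_mul_of_pos_left _ Fintype.card_pos
  have hlow : ∀ᶠ j in atTop, (z : EReal) ≤ expRate (V (k j) × W (k j))
      (covNumMeasure hammingAvg ε (ρ * η) (powLaw (W (k j)) (columnLaw (X j)))) := by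
    filter_upwards [hcardU] with j hj
    refine le_expRate_covNumMeasure fun Y hY F hF => ?_
    obtain ⟨h1, h2⟩ := log_card_le_of_cover hη hc (hXinj j) hε1 hl0.le hρ0.le hY hF
    refine ⟨h1, ?_⟩
    have h3 := (hXcard j).2
    have h4 : (Fintype.card (V (k j) × W (k j)) : ℝ) * (l * ρ + Fintype.card A * Real.exp (-l)
        + ε * Real.log (Fintype.card A)) ≤ Fintype.card (V (k j) × W (k j)) * (3 * (κ / 4)) :=
      mul_le_mul_of_nonneg_left (by linarith) (Nat.cast_nonneg _)
    have h5 : z = a - κ := by rw [hκ]; ring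
    rw [h5, sub_mul]
    nlinarith
  refine le_trans (le_limsup_of_frequently_le hlow.frequently (by isBoundedDefault)) ?_
  refine le_trans ?_ (le_iSup₂ (f := fun (k : ℕ → ℕ) (_ : StrictMono k) =>
    ⨆ (m : ∀ i, ProbabilityMeasure (V (k i) × W (k i) → P.State))
    (_ : DoublyQuenchedConv (fun i => soficProd σ τ (k i)) m P.law) (δ : ℝ) (_ : 0 < δ) (ε : ℝ)
    (_ : 0 < ε), limsup (fun i => expRate (V (k i) × W (k i)) (covNumMeasure hammingAvg ε δ (m i)))
      atTop) k hk)
  refine le_iSup₂_of_le (fun j => powLaw (W (k j)) (columnLaw (X j))) hconv ?_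
  exact le_iSup₂_of_le (ρ * η) (by positivity) (le_iSup₂_of_le ε hε0 le_rfl)

/-! ### Processes over the Cantor space -/

/-- The ultrametric of the Cantor space. -/
@[reducible] def cantorMetric : MetricSpace (ℕ → Bool) :=
  PiNat.metricSpace

-- The colour is the initial segment of length `n`. Agreement of segments is equivalent to distance
-- at most `(1 / 2) ^ n`, so small pieces and a uniform gap between them come together; this is why
-- the Cantor space is chosen.
attribute [local instance] cantorMetric in
theorem exists_cantor_discretization (δ : ℝ) (hδ : 0 < δ) :
    ∃ (A : Type) (_ : Fintype A) (c : (ℕ → Bool) → A),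
      (∀ x y, c x = c y → dist x y < δ) ∧ ∃ η > 0, ∀ x y, dist x y < η → c x = c y := by
  obtain ⟨n, hn⟩ := exists_pow_lt_of_lt_one hδ (by norm_num : (1 / 2 : ℝ) < 1)
  have key : ∀ x y : ℕ → Bool, (fun i : Fin n => x i) = (fun i : Fin n => y i) ↔
      dist x y ≤ (1 / 2) ^ n := fun x y => by
    rw [← PiNat.mem_cylinder_iff_dist_le, PiNat.mem_cylinder_iff]
    exact ⟨fun h i hi => congrFun h ⟨i, hi⟩, fun h => funext fun i => h i i.2⟩
  exact ⟨Fin n → Bool, inferInstance, fun x i => x i, fun x y h => ((key x y).1 h).trans_lt hn,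
    (1 / 2) ^ n, by positivity, fun x y h => (key x y).2 h.le⟩

attribute [local instance] cantorMetric in
/-- A co-induced system has a process for which the sofic entropy is at most the doubly-quenched
entropy. -/
theorem exists_coind_process_soficEntropy_le {G : Type u} {H : Type v} [Group G] [Group H]
    [Countable G] [Countable H] [Infinite H] {V W : ℕ → Type*} [∀ n, Fintype (V n)]
    [∀ n, Nonempty (V n)] [∀ n, Fintype (W n)] [∀ n, Nonempty (W n)]
    (σ : ∀ n, G → Equiv.Perm (V n)) {τ : ∀ n, H → Equiv.Perm (W n)}
    (hτ : IsSoficApproximation τ) (A : GSystem.{u'} G) :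
    ∃ P : MetricProcess.{0} (G × H), (A.coind H).Isomorphic P.toGSystem ∧
      P.soficEntropy (soficProd σ τ) ≤ P.doublyQuenchedEntropy (soficProd σ τ) := by
  obtain ⟨f, hf, hinj⟩ :=
    MeasurableSpace.measurable_injection_nat_bool_of_countablySeparated A.carrier
  obtain ⟨law, hm, hiso, hlaw⟩ := A.exists_coind_process H hf hinj
  exact ⟨_, hiso, MetricProcess.soficEntropy_le_doublyQuenchedEntropy hτ _ hlaw
    exists_cantor_discretization⟩

end

/-! ### The cycle of inequalities -/

theorem theoremE {G : Type*} {H : Type*} [Group G] [Group H] [Countable G] [Countable H]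
    [Infinite H] {V : ℕ → Type*} {W : ℕ → Type*} [∀ n, Fintype (V n)] [∀ n, Nonempty (V n)]
    [∀ n, Fintype (W n)] [∀ n, Nonempty (W n)]
    (σ : ∀ n, G → Equiv.Perm (V n)) (hσ : IsSoficApproximation σ)
    (τ : ∀ n, H → Equiv.Perm (W n)) (hτ : IsSoficApproximation τ)
    (A : GSystem G) (P Q R : MetricProcess (G × H))
    (hP : P.toGSystem.Isomorphic (A.coind H)) (hQ : Q.toGSystem.Isomorphic (A.coind H))
    (hR : R.toGSystem.Isomorphic (A.coind H)) :
    P.soficEntropy (soficProd σ τ) = Q.quenchedEntropy (soficProd σ τ) ∧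
      Q.quenchedEntropy (soficProd σ τ) = R.doublyQuenchedEntropy (soficProd σ τ) := by
  obtain ⟨P₀, h₀, hle⟩ := exists_coind_process_soficEntropy_le σ hτ A
  have hστ := hσ.prod hτ
  -- The inequalities run in a circle through the special process `P₀`; only the middle one uses the
  -- power structure of the co-induced law.
  have hqP := (Q.quenchedEntropy_le_soficEntropy (σ := soficProd σ τ)).trans
    (MetricProcess.soficEntropy_le_of_isomorphic hστ (hQ.trans hP.symm))
  have hPR := (MetricProcess.soficEntropy_le_of_isomorphic hστ (hP.trans h₀)).trans
    (hle.trans (MetricProcess.doublyQuenchedEntropy_le_of_isomorphic hστ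
      (h₀.symm.trans hR.symm)))
  have hRQ := (MetricProcess.doublyQuenchedEntropy_le_of_isomorphic hστ
    (hR.trans hQ.symm)).trans (Q.doublyQuenchedEntropy_le_quenchedEntropy (σ := soficProd σ τ))
  exact ⟨le_antisymm (hPR.trans hRQ) hqP, le_antisymm (hqP.trans hPR) hRQ⟩
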